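/- Let $k$ be an algebraically closed field of characteristic $0$ and $g\in\{5,7,8,9,10,12\}$. Put $G=\mathbb Z_2\oplus A_4$ if $g\in\{5,7,9\}$ and $G=SL_2(3)$ if $g\in\{8,10,12\}$. Let $\mathcal X: Y^2=F(X)$ be a hyperelliptic curve of genus $g$ over $k$ ($F\in k[X]$ squarefree of degree $2g+1$ or $2g+2$) whose automorphism group $\mathrm{Aut}(\mathcal X)=\mathrm{Aut}(k(\mathcal X)/k)$ has a subgroup isomorphic to $G$, that is, $\mathcal X\in\mathcal L_g^G$. Isomorphism of curves over $k$ means $k$-isomorphism of function fields. **Invariants.** Let $d=2g+2$ and let $F$ also denote the binary form $\sum_i a_iX^iZ^{d-i}$ attached to $F(X)=\sum_i a_iX^i$. For binary forms $f,h$ of degrees $n,m$ put $$(f,h)^r=\frac{(m-r)!\,(n-r)!}{n!\,m!}\sum_{j=0}^r(-1)^j\binom rj\frac{\partial^rf}{\partial X^{r-j}\partial Z^j}\,\frac{\partial^rh}{\partial X^j\partial Z^{r-j}} .$$ Let $J_{4j}=(F,F)^{d-2j}$, $I_2=(F,F)^d$, $I_3=(F,J_d)^d$ (if $4\mid d$),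 $I_4'=(J_8,J_8)^8$; let $I_6,I_6',I_6^*,I_6^\star$ be $\big((F,J_{4j})^{4j},(F,J_{4j})^{4j}\big)^{d-4j}$ for $j=1,2,3,4$ respectively; let $I_{12}=(L,L)^8$ with $L=\big((F,J_4)^4,(F,J_8)^8\big)^{d-10}$, and $I_{12}^*=\big((J_{16},S)^4,(J_{16},S)^4\big)^{12}$ with $S=(J_{12},J_{16})^{12}$. Define $\mathfrak p(\mathcal X)$ as follows. * $g=5,9$: $\left(\frac{I_4'}{I_2^2},\frac{I_3^2}{I_2^3}\right)$ if $I_2\ne0$, and $\frac{(I_4')^3}{I_3^4}$ if $I_2=0$. * $g=8,12$: $\left(\frac{I_4'}{I_2^2},\frac{I_6^*}{I_2^3}\right)$ if $I_2\neq0$, and $\frac{(I_6^*)^2}{(I_4')^3}$ if $I_2=0$. * $g=7$: $\left(\frac{I_6'}{I_3^2},\frac{I_6}{I_3^2}\right)$ if $I_3\ne0$, and $\frac{I_6}{I_6'}$ if $I_3=0$. * $g=10$: $\left(\frac{(I_6')^2}{I_{12}},\frac{I_6^2}{I_{12}}\right)$ if $I_{12}\ne0$, and $\frac{(I_6^\star)^2}{I_{12}^*}$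 if $I_{12}=0$. **Parametrization.** For $\mu\in k$ define $\mathfrak p_g(\mu)$ as follows; the single value applies when the stated condition holds, and the pair otherwise. * $\mathfrak p_5(\mu)=\left(\frac{49}{3630}\frac{(5\mu-484)^2}{(5\mu+924)^2},\ \frac{10}{27951}\frac{\mu(5\mu+30492)^2}{(5\mu+924)^3}\right)$, and $\frac{2^5\cdot7^2}{3^7\cdot5^3}$ if $5\mu+924=0$. * With $D=1093\mu^3+49566\mu^2-838068\mu+1549768$, $B=(97\mu+1606)(87\mu^2+528\mu+2596)$ and $E=(61\mu^2-44\mu-6556)^2(2021\mu^2+1496\mu-157476)$: $\mathfrak p_7(\mu)=\left(\frac6{245}\frac{B^2}{D^2},\ \frac{301158}{30625}\frac{E}{D^2}\right)$, and $\frac{50193}{125}\frac{E}{B^2}$ if $D=0$. * $\mathfrak p_8(\mu)=\left(\frac{49}{11236320}\frac{(279\mu+15028)^2}{(7\mu+884)^2},\ \frac1{1360026486}\frac{\mu(3675\mu+3321188)^2}{(7\mu+884)^3}\right)$, and $\frac{2^3\cdot3^{11}\cdot101^4}{5^3\cdot7^4\cdot13^6}$ if $7\mu+884=0$. * $\mathfrak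 p_9(\mu)=\left(\frac{605}{5633766}\frac{(9\mu-7220)^2}{(3\mu+836)^2},\ \frac{90}{370680937}\frac{\mu(157\mu+79420)^2}{(3\mu+836)^3}\right)$, and $\frac{2^9\cdot5\cdot11^2}{3^7}$ if $3\mu+836=0$. * With $a=251\mu-782$, $b=115\mu^2-68\mu-6596$ and $c=(181\mu+1598)(3813\mu^2+15912\mu-39236)$: $\mathfrak p_{10}(\mu)=\left(\frac{147}{90250}\frac{c^2}{a^2b^2},\ \frac{5007792000}{121}\frac{(7877\mu^2+3128\mu-374884)^2b^2}{a^2c^2}\right)$, and, if $abc=0$, $$-\tfrac{950367275}{21168}\cdot\tfrac{(25170477\mu^3+402998158\mu^2-4363415636\mu+13083554824)^4}{(1268277\mu^2-5261568\mu+18129548)^2\,(7959\mu^2-65756\mu-287844)^2\,q},$$ where $q=228384659961\mu^4-22196181318948\mu^3+185588379432544\mu^2-447275488903152\mu+658755318269936$. * $\mathfrak p_{12}(\mu)=\left(\frac1{268203000}\frac{(6611\mu-501500)^2}{(11\mu+1700)^2},\ \frac{56}{284015801875}\frac{\mu(20933\mu-5686500)^2}{(11\mu+1700)^3}\right)$,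 and $\frac{2\cdot3^3\cdot5\cdot41^4}{7^4\cdot11^2\cdot17^2}$ if $11\mu+1700=0$. **Parameter.** Let $G_\lambda(X)=X^{12}-\lambda X^{10}-33X^8+2\lambda X^6-33X^4-\lambda X^2+1$. Call $\mu\in k$ a *parameter* of $\mathcal X$ if, for some $\lambda\in k$ and some choice of $\sqrt{-3}$, the curve $\mathcal X$ is isomorphic to $Y^2=H(X)$, where * $H=G_\lambda$ for $g=5$, $\ H=X(X^4-1)G_\lambda$ for $g=8$, $\ H=(X^8+14X^4+1)G_\lambda$ for $g=9$, $\ H=X(X^4-1)(X^8+14X^4+1)G_\lambda$ for $g=12$, and $\mu=\lambda^2$ in these four cases; * $H=(X^4+2\sqrt{-3}X^2+1)G_\lambda$ for $g=7$, $\ H=X(X^4-1)(X^4+2\sqrt{-3}X^2+1)G_\lambda$ for $g=10$, and $\lambda=\mu\sqrt{-3}$ in these two cases. **Claim.** 1. $\mathcal X$ has a parameter, and every parameter $\mu$ of $\mathcal X$ satisfies $\mathfrak p(\mathcal X)=\mathfrak p_g(\mu)$. 2. Let $\mu$ be a parameter of $\mathcal X$; or let $\mu\in k$ be such that $\mathfrak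 p(\mathcal X)=\mathfrak p_g(\mu)$ and, unless $g\in\{5,9\}$, $\mu$ is the only element of $k$ with that value of $\mathfrak p_g$. Suppose that $\mu\neq0$, or $g\in\{7,10\}$, or $\mathrm{Aut}(\mathcal X)\cong G$. Then $\mathcal X$ is isomorphic to the curve $\mathcal X_g$ given by $$\begin{aligned} \mathcal X_5:\ Y^2&=M(X),\\ \mathcal X_7:\ Y^2&=(3X^4+6X^2-1)\,N(X),\\ \mathcal X_8:\ Y^2&=X(\mu X^4-1)\,M(X),\\ \mathcal X_9:\ Y^2&=(\mu^2X^8+14\mu X^4+1)\,M(X),\\ \mathcal X_{10}:\ Y^2&=X(3X^4+1)(3X^4+6X^2-1)\,N(X),\\ \mathcal X_{12}:\ Y^2&=X(\mu X^4-1)(\mu^2X^8+14\mu X^4+1)\,M(X), \end{aligned}$$ where $M(X)=\mu^3X^{12}-\mu^3X^{10}-33\mu^2X^8+2\mu^2X^6-33\mu X^4-\mu X^2+1$ and $N(X)=27X^{12}-27\mu X^{10}+297X^8-18\mu X^6-99X^4-3\mu X^2-1$. -/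

import Mathlib

open scoped Polynomial

noncomputable section

namespace HyperA4

variable {k : Type*} [Field k]

/-! ### Hyperelliptic curves and their function fields -/

/-- `Y² = F(X)` is an affine equation of a hyperelliptic curve of genus `g`: the binary form of
degree `2g+2` attached to `F` has `2g+2` distinct zeros on the projective line (one of them may be
the point at infinity, and then `F` has degree `2g+1`). -/
def IsHyperelliptic (g : ℕ) (F : k[X]) : Prop :=
  Squarefree F ∧ (F.natDegree = 2 * g + 1 ∨ F.natDegree = 2 * g + 2)

/-- The function field `k(X, Y)`, `Y² = F(X)`, of the curve. -/
abbrev FunctionField (F : k[X]) : Type _ :=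
  AdjoinRoot (Polynomial.X ^ 2 - Polynomial.C (algebraMap k[X] (RatFunc k) F) : (RatFunc k)[X])

/-- Isomorphism of curves, as `k`-isomorphism of their function fields. -/
def CurveIso (F F' : k[X]) : Prop :=
  Nonempty (FunctionField F ≃ₐ[k] FunctionField F')

/-- The automorphism group of the curve. -/
abbrev CurveAut (F : k[X]) : Type _ := FunctionField F ≃ₐ[k] FunctionField F

/-- The group `ℤ₂ ⊕ A₄`. -/
abbrev Z2A4 : Type := Multiplicative (ZMod 2) × alternatingGroup (Fin 4)

/-- The group `SL₂(3)`. -/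
abbrev SL23 : Type := Matrix.SpecialLinearGroup (Fin 2) (ZMod 3)

/-- The group `A` has a subgroup isomorphic to `G`, where `G = ℤ₂ ⊕ A₄` for odd `g` and
`G = SL₂(3)` for even `g`. -/
def ContainsG (g : ℕ) (A : Type*) [Group A] : Prop :=
  if Odd g then ∃ φ : Z2A4 →* A, Function.Injective φ
  else ∃ φ : SL23 →* A, Function.Injective φ

/-- The group `A` is isomorphic to `G`, with `G` as above. -/
def IsomorphicToG (g : ℕ) (A : Type*) [Group A] : Prop :=
  if Odd g then Nonempty (A ≃* Z2A4) else Nonempty (A ≃* SL23)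

/-! ### Transvectants and invariants of binary forms -/

/-- The binary form `∑ aᵢ Xⁱ Z^(d-i)` of degree `d` attached to `F = ∑ aᵢ Xⁱ`. The variables `X`
and `Z` are number `0` and number `1`. -/
def binaryForm (d : ℕ) (F : k[X]) : MvPolynomial (Fin 2) k :=
  ∑ i ∈ Finset.range (d + 1),
    MvPolynomial.C (F.coeff i) * MvPolynomial.X 0 ^ i * MvPolynomial.X 1 ^ (d - i)

/-- The partial derivative `∂^(a+b) f / ∂X^a ∂Z^b`. -/
def partialXZ (a b : ℕ) (f : MvPolynomial (Fin 2) k) : MvPolynomial (Fin 2) k :=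
  (MvPolynomial.pderiv 0)^[a] ((MvPolynomial.pderiv 1)^[b] f)

/-- The `r`-th transvectant `(f, h)^r` of binary forms `f` of degree `n` and `h` of degree `m`
(used for `r ≤ n` and `r ≤ m` only). -/
def transvectant (n m r : ℕ) (f h : MvPolynomial (Fin 2) k) : MvPolynomial (Fin 2) k :=
  MvPolynomial.C ((((m - r).factorial * (n - r).factorial : ℕ) : k) /
      ((n.factorial * m.factorial : ℕ) : k)) *
    ∑ j ∈ Finset.range (r + 1),
      MvPolynomial.C ((-1 : k) ^ j * (r.choose j : k)) *
        (partialXZ (r - j) j f * partialXZ j (r - j) h)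

section Invariants

variable (g : ℕ) (F : k[X])

/-- The binary form of degree `d = 2g+2` of the curve. -/
def form : MvPolynomial (Fin 2) k := binaryForm (2 * g + 2) F

/-- The covariant `J_{4j} = (F, F)^(d-2j)`, of order `4j`. -/
def covJ (j : ℕ) : MvPolynomial (Fin 2) k :=
  transvectant (2 * g + 2) (2 * g + 2) (2 * g + 2 - 2 * j) (form g F) (form g F)

/-- `(F, J_{4j})^(4j)`, of order `d - 4j`. -/
def covFJ (j : ℕ) : MvPolynomial (Fin 2) k :=
  transvectant (2 * g + 2) (4 * j) (4 * j) (form g F) (covJ g F j)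

/-- `((F, J_{4j})^(4j), (F, J_{4j})^(4j))^(d-4j)`, an invariant of degree 6. -/
def invSix (j : ℕ) : k :=
  MvPolynomial.constantCoeff
    (transvectant (2 * g + 2 - 4 * j) (2 * g + 2 - 4 * j) (2 * g + 2 - 4 * j)
      (covFJ g F j) (covFJ g F j))

/-- `I₂ = (F, F)^d`. -/
def I2 : k :=
  MvPolynomial.constantCoeff
    (transvectant (2 * g + 2) (2 * g + 2) (2 * g + 2) (form g F) (form g F))

/-- `I₃ = (F, J_d)^d`, for `d` divisible by 4. -/
def I3 : k :=
  MvPolynomial.constantCoeff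
    (transvectant (2 * g + 2) (2 * g + 2) (2 * g + 2) (form g F) (covJ g F ((2 * g + 2) / 4)))

/-- `I₄' = (J₈, J₈)^8`. -/
def I4' : k := MvPolynomial.constantCoeff (transvectant 8 8 8 (covJ g F 2) (covJ g F 2))

/-- `I₆ = ((F, J₄)^4, (F, J₄)^4)^(d-4)`. -/
def I6 : k := invSix g F 1

/-- `I₆' = ((F, J₈)^8, (F, J₈)^8)^(d-8)`. -/
def I6' : k := invSix g F 2

/-- `I₆^* = ((F, J₁₂)^12, (F, J₁₂)^12)^(d-12)`. -/
def I6ast : k := invSix g F 3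

/-- `I₆^⋆ = ((F, J₁₆)^16, (F, J₁₆)^16)^(d-16)`. -/
def I6star : k := invSix g F 4

/-- `M = ((F, J₄)^4, (F, J₈)^8)^(d-10)`, of order 8. -/
def covM : MvPolynomial (Fin 2) k :=
  transvectant (2 * g + 2 - 4) (2 * g + 2 - 8) (2 * g + 2 - 10) (covFJ g F 1) (covFJ g F 2)

/-- `I₁₂ = (M, M)^8`. -/
def I12 : k := MvPolynomial.constantCoeff (transvectant 8 8 8 (covM g F) (covM g F))

/-- `S = (J₁₂, J₁₆)^12`, of order 4. -/
def covS : MvPolynomial (Fin 2) k := transvectant 12 16 12 (covJ g F 3) (covJ g F 4)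

/-- `(J₁₆, S)^4`, of order 12. -/
def covJS : MvPolynomial (Fin 2) k := transvectant 16 4 4 (covJ g F 4) (covS g F)

/-- `I₁₂^* = ((J₁₆, S)^4, (J₁₆, S)^4)^12`. -/
def I12ast : k := MvPolynomial.constantCoeff (transvectant 12 12 12 (covJS g F) (covJS g F))

open Classical in
/-- The absolute invariants `𝔭` of the curve: a pair in general, and a single number on the
locus where the common denominator of the pair vanishes. The value for other `g` is irrelevant. -/
def invariantPoint : (k × k) ⊕ k :=
  if g = 5 ∨ g = 9 then
    if I2 g F ≠ 0 then
      .inl (I4' g F / I2 g F ^ 2, I3 g F ^ 2 / I2 g F ^ 3)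
    else .inr (I4' g F ^ 3 / I3 g F ^ 4)
  else if g = 8 ∨ g = 12 then
    if I2 g F ≠ 0 then
      .inl (I4' g F / I2 g F ^ 2, I6ast g F / I2 g F ^ 3)
    else .inr (I6ast g F ^ 2 / I4' g F ^ 3)
  else if g = 7 then
    if I3 g F ≠ 0 then
      .inl (I6' g F / I3 g F ^ 2, I6 g F / I3 g F ^ 2)
    else .inr (I6 g F / I6' g F)
  else
    if I12 g F ≠ 0 then
      .inl (I6' g F ^ 2 / I12 g F, I6 g F ^ 2 / I12 g F)
    else .inr (I6star g F ^ 2 / I12ast g F)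

end Invariants

/-! ### The parametrization of the loci by `μ` -/

open Classical in
/-- The parametrization `μ ↦ 𝔭` of the locus in genus `g ∈ {5, 7, 8, 9, 10, 12}`. -/
def paramPoint (g : ℕ) (μ : k) : (k × k) ⊕ k :=
  if g = 5 then
    if 5 * μ + 924 ≠ 0 then
      .inl (49 / 3630 * (5 * μ - 484) ^ 2 / (5 * μ + 924) ^ 2,
        10 / 27951 * (μ * (5 * μ + 30492) ^ 2) / (5 * μ + 924) ^ 3)
    else .inr (2 ^ 5 * 7 ^ 2 / (3 ^ 7 * 5 ^ 3))
  else if g = 7 then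
    if 1093 * μ ^ 3 + 49566 * μ ^ 2 - 838068 * μ + 1549768 ≠ 0 then
      .inl (6 / 245 * ((97 * μ + 1606) ^ 2 * (87 * μ ^ 2 + 528 * μ + 2596) ^ 2)
          / (1093 * μ ^ 3 + 49566 * μ ^ 2 - 838068 * μ + 1549768) ^ 2,
        301158 / 30625 * ((61 * μ ^ 2 - 44 * μ - 6556) ^ 2 * (2021 * μ ^ 2 + 1496 * μ - 157476))
          / (1093 * μ ^ 3 + 49566 * μ ^ 2 - 838068 * μ + 1549768) ^ 2)
    else
      .inr (50193 / 125 * ((61 * μ ^ 2 - 44 * μ - 6556) ^ 2 * (2021 * μ ^ 2 + 1496 * μ - 157476))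
        / ((97 * μ + 1606) ^ 2 * (87 * μ ^ 2 + 528 * μ + 2596) ^ 2))
  else if g = 8 then
    if 7 * μ + 884 ≠ 0 then
      .inl (49 / 11236320 * (279 * μ + 15028) ^ 2 / (7 * μ + 884) ^ 2,
        1 / 1360026486 * (μ * (3675 * μ + 3321188) ^ 2) / (7 * μ + 884) ^ 3)
    else .inr (2 ^ 3 * 3 ^ 11 * 101 ^ 4 / (5 ^ 3 * 7 ^ 4 * 13 ^ 6))
  else if g = 9 then
    if 3 * μ + 836 ≠ 0 then
      .inl (605 / 5633766 * (9 * μ - 7220) ^ 2 / (3 * μ + 836) ^ 2,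
        90 / 370680937 * (μ * (157 * μ + 79420) ^ 2) / (3 * μ + 836) ^ 3)
    else .inr (2 ^ 9 * 5 * 11 ^ 2 / 3 ^ 7)
  else if g = 10 then
    if (251 * μ - 782) * (115 * μ ^ 2 - 68 * μ - 6596) *
        ((181 * μ + 1598) * (3813 * μ ^ 2 + 15912 * μ - 39236)) ≠ 0 then
      .inl (147 / 90250 * ((181 * μ + 1598) ^ 2 * (3813 * μ ^ 2 + 15912 * μ - 39236) ^ 2)
          / ((251 * μ - 782) ^ 2 * (115 * μ ^ 2 - 68 * μ - 6596) ^ 2),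
        5007792000 / 121 *
            ((7877 * μ ^ 2 + 3128 * μ - 374884) ^ 2 * (115 * μ ^ 2 - 68 * μ - 6596) ^ 2)
          / ((251 * μ - 782) ^ 2 *
            ((181 * μ + 1598) ^ 2 * (3813 * μ ^ 2 + 15912 * μ - 39236) ^ 2)))
    else
      .inr (-(950367275 / 21168) *
          (25170477 * μ ^ 3 + 402998158 * μ ^ 2 - 4363415636 * μ + 13083554824) ^ 4
        / ((1268277 * μ ^ 2 - 5261568 * μ + 18129548) ^ 2 *
            (7959 * μ ^ 2 - 65756 * μ - 287844) ^ 2 *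
            (228384659961 * μ ^ 4 - 22196181318948 * μ ^ 3 + 185588379432544 * μ ^ 2
              - 447275488903152 * μ + 658755318269936)))
  else
    if 11 * μ + 1700 ≠ 0 then
      .inl (1 / 268203000 * (6611 * μ - 501500) ^ 2 / (11 * μ + 1700) ^ 2,
        56 / 284015801875 * (μ * (20933 * μ - 5686500) ^ 2) / (11 * μ + 1700) ^ 3)
    else .inr (2 * 3 ^ 3 * 5 * 41 ^ 4 / (7 ^ 4 * 11 ^ 2 * 17 ^ 2))

open Polynomial in
/-- `G_λ(X)`, whose zeros form the fibre over `c = λ` of the quotient map of the projective line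
by `A₄`. -/
def polyG (c : k) : k[X] :=
  X ^ 12 - C c * X ^ 10 - 33 * X ^ 8 + 2 * C c * X ^ 6 - 33 * X ^ 4 - C c * X ^ 2 + 1

open Polynomial in
/-- The right hand side of the normal form `Y² = …` with `λ = c`, where `s` is a square root
of `-3`. -/
def normalForm (g : ℕ) (s c : k) : k[X] :=
  if g = 5 then polyG c
  else if g = 7 then (X ^ 4 + 2 * C s * X ^ 2 + 1) * polyG c
  else if g = 8 then X * (X ^ 4 - 1) * polyG c
  else if g = 9 then (X ^ 8 + 14 * X ^ 4 + 1) * polyG c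
  else if g = 10 then X * (X ^ 4 - 1) * (X ^ 4 + 2 * C s * X ^ 2 + 1) * polyG c
  else X * (X ^ 4 - 1) * (X ^ 8 + 14 * X ^ 4 + 1) * polyG c

/-- `μ` is a parameter of the curve `Y² = F(X)`: the curve is isomorphic to its normal form with
some `λ = c`, where `μ = λ²` if `g ∈ {5, 8, 9, 12}` and `λ = μ √-3` if `g ∈ {7, 10}`. -/
def IsParameter (g : ℕ) (F : k[X]) (μ : k) : Prop :=
  ∃ s c : k, s ^ 2 = -3 ∧ (if g = 7 ∨ g = 10 then c = μ * s else μ = c ^ 2) ∧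
    CurveIso F (normalForm g s c)

/-! ### The explicit models over the field generated by `μ` -/

open Polynomial in
/-- The polynomial `M(X)`. -/
def polyM (μ : k) : k[X] :=
  C (μ ^ 3) * X ^ 12 - C (μ ^ 3) * X ^ 10 - 33 * C (μ ^ 2) * X ^ 8 + 2 * C (μ ^ 2) * X ^ 6
    - 33 * C μ * X ^ 4 - C μ * X ^ 2 + 1

open Polynomial in
/-- The factor of degree 12 in genus 7 and 10. -/
def polyN (μ : k) : k[X] :=
  27 * X ^ 12 - 27 * C μ * X ^ 10 + 297 * X ^ 8 - 18 * C μ * X ^ 6 - 99 * X ^ 4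
    - 3 * C μ * X ^ 2 - 1

open Polynomial in
/-- The right hand side of the model `Y² = …` in genus `g ∈ {5, 7, 8, 9, 10, 12}`. -/
def model (g : ℕ) (μ : k) : k[X] :=
  if g = 5 then polyM μ
  else if g = 7 then (3 * X ^ 4 + 6 * X ^ 2 - 1) * polyN μ
  else if g = 8 then X * (C μ * X ^ 4 - 1) * polyM μ
  else if g = 9 then (C (μ ^ 2) * X ^ 8 + 14 * C μ * X ^ 4 + 1) * polyM μ
  else if g = 10 then X * (3 * X ^ 4 + 1) * (3 * X ^ 4 + 6 * X ^ 2 - 1) * polyN μ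
  else X * (C μ * X ^ 4 - 1) * (C (μ ^ 2) * X ^ 8 + 14 * C μ * X ^ 4 + 1) * polyM μ

end HyperA4

end

/-!
# Hyperelliptic curves with tetrahedral automorphisms

**Isomorphisms and forms.** Two hyperelliptic curves `Y² = F(X)` of genus `g` are isomorphic if and
only if their binary forms of degree `2g+2` are equivalent under linear substitutions and scalars
(`exists_form_eq_of_algEquiv`, `curveIso_of_form_eq`). For one direction it has to be shown that the
image of `X` under an isomorphism is a rational function of `X`. A function `u` outside `k(X)` that
generates, like the image of `X`, a field over which `X` is quadratic would satisfy a primitive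
equation over `k[X]` with coefficients of degree at most two; its discriminant, of degree at most
four, would be `F` up to squares, which is impossible as `F` has degree at least five
(`snd_eq_zero_of_quadratic`). The image is then a fractional linear function, as both fields are
`k(X)`, and comparing the images of `Y²` gives the relation of the forms.

**Invariants.** Transvectants are covariants because Cayley's operator `Ω` commutes with linear
substitutions up to the determinant (`cayleyOmega_map_subst`); hence an invariant of degree `m` is
multiplied by the `m`-th power of one scalar depending on the substitution, and the quotients that
make up `invariantPoint` depend on the isomorphism class only (`invariantPoint_eq_of_curveIso`).
For the normal forms they are computed. If the coefficients of two forms are written with the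
binomial coefficients split off, their transvectant is given by an explicit integral bilinear
expression (`transvectant_nform`). The coefficients being polynomials in the parameter with rational
coefficients, each transvectant amounts to an identity of lists of integers, which is checked by
evaluation (`transvectant_listForm`).

**Existence of a parameter.** An automorphism of the curve acts on the line by a matrix, unique up
to scalars, under which the form is semi-invariant. Automorphisms acting trivially on the line are
central, and for `SL₂(3)` the central involution does act trivially, since otherwise the matrices of
two generators of the quaternion group would commute (`map_xGen_of_quaternion`). In all cases one
obtains a tetrahedral group acting on the line, whose matrices are brought to a standard form
(`exists_tetrahedral_basis`). Semi-invariants of the four-group are, up to the sextic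
`XZ(X⁴ - Z⁴)`, forms in `X⁴ + Z⁴` and `X²Z²`, hence in the quartics `Φ_s` and `Φ_{-s}`, where
`s² = -3`. The element of order three multiplies the quartics by scalars whose quotient is a
primitive cube root of unity, so that only products of quartics whose exponents agree modulo three
can occur together (`exists_sum_of_tetrahedral`). As the form is square-free, this leaves a product
of some of the sextic, `Φ_s` and `Φ_{-s}` with a member `a Φ_s³ + b Φ_{-s}³` of a pencil, and the
members of the pencil with `a + b ≠ 0` are the multiples of the `G_λ`
(`exists_curveIso_normalForm`).

**The models.** A scaling of `X` transforms the normal form into the model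
(`exists_normalForm_comp`, `exists_normalForm_comp_of_seven_or_ten`), except for `λ = 0` in the
genera `5`, `8`, `9`, `12`. In that case `X ↦ iX`, where `i² = -1`, induces an automorphism whose
order does not divide `6`, for odd `g`, or `12`, for even `g`. As `6` and `12` are exponents of
`ℤ₂ ⊕ A₄` and `SL₂(3)`, the automorphism group is not `G` (`not_isomorphicToG_of_zero`).
In genus `5` and `9` the parametrization is injective, as the second coordinate is a cubic
polynomial in the square root of the first, with a zero linear term (`eq_of_sq_eq_of_cubic_eq`).
-/

open scoped Polynomial

noncomputable section

namespace HyperA4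

variable {k : Type*} [Field k]

/-! ### Linear substitutions and transvectants -/

/-- The substitution `f ↦ f ∘ M` on binary forms, `Xᵢ ↦ ∑ⱼ Mᵢⱼ Xⱼ`. -/
def subst (M : Matrix (Fin 2) (Fin 2) k) : MvPolynomial (Fin 2) k →ₐ[k] MvPolynomial (Fin 2) k :=
  MvPolynomial.aeval fun i => MvPolynomial.C (M i 0) * MvPolynomial.X 0 +
    MvPolynomial.C (M i 1) * MvPolynomial.X 1

open MvPolynomial in
lemma subst_X (M : Matrix (Fin 2) (Fin 2) k) (i : Fin 2) :
    subst M (X i) = C (M i 0) * X 0 + C (M i 1) * X 1 := by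
  simp [subst]

lemma subst_C (M : Matrix (Fin 2) (Fin 2) k) (a : k) :
    subst M (MvPolynomial.C a) = MvPolynomial.C a := by
  simp [subst]

lemma subst_subst (M N : Matrix (Fin 2) (Fin 2) k) (f : MvPolynomial (Fin 2) k) :
    subst M (subst N f) = subst (N * M) f := by
  have : (subst M).comp (subst N) = subst (N * M) := by
    apply MvPolynomial.algHom_ext
    intro i
    simp only [AlgHom.comp_apply, subst_X, map_add, map_mul, subst_C, Matrix.mul_apply,
      Fin.sum_univ_two]
    ring
  exact DFunLike.congr_fun this f

lemma subst_one (f : MvPolynomial (Fin 2) k) : subst 1 f = f := by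
  have : subst (1 : Matrix (Fin 2) (Fin 2) k) = AlgHom.id k _ := by
    apply MvPolynomial.algHom_ext
    intro i
    fin_cases i <;> simp [subst_X]
  rw [this]; rfl

lemma constantCoeff_subst (M : Matrix (Fin 2) (Fin 2) k) (f : MvPolynomial (Fin 2) k) :
    MvPolynomial.constantCoeff (subst M f) = MvPolynomial.constantCoeff f := by
  induction f using MvPolynomial.induction_on with
  | C a => simp
  | add p q hp hq => simp [hp, hq]
  | mul_X p i hp => simp [subst_X]

/-- The chain rule for a linear substitution. -/
lemma pderiv_subst (M : Matrix (Fin 2) (Fin 2) k) (l : Fin 2) (f : MvPolynomial (Fin 2) k) :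
    MvPolynomial.pderiv l (subst M f) =
      M 0 l • subst M (MvPolynomial.pderiv 0 f) + M 1 l • subst M (MvPolynomial.pderiv 1 f) := by
  induction f using MvPolynomial.induction_on with
  | C a => simp
  | add p q hp hq => simp only [map_add, hp, hq, smul_add]; abel
  | mul_X p i hp =>
    simp only [map_mul, Derivation.leibniz, hp, subst_X, map_add, MvPolynomial.smul_eq_C_mul,
      smul_eq_mul, MvPolynomial.pderiv_C, MvPolynomial.pderiv_X]
    fin_cases i <;> fin_cases l <;> simp <;> ring

/-- The partial derivative as a linear endomorphism. -/
def pderivEnd (i : Fin 2) : Module.End k (MvPolynomial (Fin 2) k) :=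
  (MvPolynomial.pderiv i).toLinearMap

lemma pderivEnd_apply (i : Fin 2) (f : MvPolynomial (Fin 2) k) :
    pderivEnd i f = MvPolynomial.pderiv i f := rfl

lemma pderivEnd_pow_apply (i : Fin 2) (n : ℕ) (f : MvPolynomial (Fin 2) k) :
    (pderivEnd i ^ n) f = (MvPolynomial.pderiv i)^[n] f := by
  rw [Module.End.pow_apply]; rfl

lemma commute_pderivEnd : Commute (pderivEnd (k := k) 1) (pderivEnd 0) := by
  rw [Commute, SemiconjBy]
  have h0 : ∀ p : MvPolynomial (Fin 2) k, MvPolynomial.pderiv 1 (MvPolynomial.pderiv 0 p) =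
      MvPolynomial.pderiv 0 (MvPolynomial.pderiv 1 p) := by
    have : ⁅MvPolynomial.pderiv (R := k) (σ := Fin 2) 1,
        MvPolynomial.pderiv (R := k) (σ := Fin 2) 0⁆ = 0 := by
      apply MvPolynomial.derivation_ext
      intro i
      fin_cases i <;> simp [Derivation.commutator_apply, MvPolynomial.pderiv_X]
    intro p
    have h := DFunLike.congr_fun this p
    rwa [Derivation.commutator_apply, Derivation.coe_zero, Pi.zero_apply, sub_eq_zero] at h
  exact LinearMap.ext h0

/-- The tensor product of two linear endomorphisms of the ring of forms. -/
def tensorEnd (A B : Module.End k (MvPolynomial (Fin 2) k)) : Module.End k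
    (TensorProduct k (MvPolynomial (Fin 2) k) (MvPolynomial (Fin 2) k)) :=
  TensorProduct.map A B

lemma tensorEnd_tmul (A B : Module.End k (MvPolynomial (Fin 2) k))
    (f h : MvPolynomial (Fin 2) k) :
    tensorEnd A B (TensorProduct.tmul k f h) = TensorProduct.tmul k (A f) (B h) := rfl

lemma tensorEnd_mul (A B A' B' : Module.End k (MvPolynomial (Fin 2) k)) :
    tensorEnd A B * tensorEnd A' B' = tensorEnd (A * A') (B * B') :=
  (TensorProduct.map_mul _ _ _ _).symm

lemma tensorEnd_pow (A B : Module.End k (MvPolynomial (Fin 2) k)) (n : ℕ) :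
    tensorEnd A B ^ n = tensorEnd (A ^ n) (B ^ n) :=
  TensorProduct.map_pow _ _ _

/-- Cayley's operator `Ω = ∂_X ⊗ ∂_Z - ∂_Z ⊗ ∂_X`, acting on products of a form in one pair of
variables with a form in another pair. -/
def cayleyOmega : Module.End k
    (TensorProduct k (MvPolynomial (Fin 2) k) (MvPolynomial (Fin 2) k)) :=
  (-1 : k) • tensorEnd (pderivEnd 1) (pderivEnd 0) + tensorEnd (pderivEnd 0) (pderivEnd 1)

open TensorProduct in
lemma cayleyOmega_map_subst (M : Matrix (Fin 2) (Fin 2) k)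
    (t : MvPolynomial (Fin 2) k ⊗[k] MvPolynomial (Fin 2) k) :
    cayleyOmega (TensorProduct.map (subst M).toLinearMap (subst M).toLinearMap t) =
      M.det • TensorProduct.map (subst M).toLinearMap (subst M).toLinearMap (cayleyOmega t) := by
  induction t with
  | zero => simp
  | add x y hx hy => simp only [map_add, hx, hy, smul_add]
  | tmul f h =>
    simp only [cayleyOmega, LinearMap.add_apply, LinearMap.smul_apply, TensorProduct.map_tmul,
      map_add, map_smul, tensorEnd_tmul,
      AlgHom.toLinearMap_apply, pderivEnd_apply, pderiv_subst,
      TensorProduct.add_tmul, TensorProduct.tmul_add, ← TensorProduct.smul_tmul',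
      TensorProduct.tmul_smul, Matrix.det_fin_two]
    module

open TensorProduct in
lemma cayleyOmega_pow_map_subst (M : Matrix (Fin 2) (Fin 2) k) (r : ℕ)
    (t : MvPolynomial (Fin 2) k ⊗[k] MvPolynomial (Fin 2) k) :
    (cayleyOmega ^ r) (TensorProduct.map (subst M).toLinearMap (subst M).toLinearMap t) =
      M.det ^ r •
        TensorProduct.map (subst M).toLinearMap (subst M).toLinearMap ((cayleyOmega ^ r) t) := by
  induction r with
  | zero => simp
  | succ r ih =>
    rw [pow_succ', Module.End.mul_apply, ih, map_smul, cayleyOmega_map_subst, smul_smul,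
      ← pow_succ, Module.End.mul_apply]

lemma cayleyOmega_pow_tmul (r : ℕ) (f h : MvPolynomial (Fin 2) k) :
    LinearMap.mul' k _ ((cayleyOmega ^ r) (TensorProduct.tmul k f h)) =
      ∑ j ∈ Finset.range (r + 1), MvPolynomial.C ((-1 : k) ^ j * (r.choose j : k)) *
        (partialXZ (r - j) j f * partialXZ j (r - j) h) := by
  have hc : Commute ((-1 : k) • tensorEnd (pderivEnd (k := k) 1) (pderivEnd 0))
      (tensorEnd (pderivEnd 0) (pderivEnd 1)) := by
    apply Commute.smul_left
    rw [Commute, SemiconjBy, tensorEnd_mul, tensorEnd_mul, commute_pderivEnd.eq]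
  rw [cayleyOmega, hc.add_pow]
  simp only [LinearMap.sum_apply, map_sum]
  refine Finset.sum_congr rfl fun j _ => ?_
  rw [smul_pow, tensorEnd_pow, tensorEnd_pow]
  have e1 : (tensorEnd (pderivEnd (k := k) 1 ^ j) (pderivEnd 0 ^ j)) *
      (tensorEnd (pderivEnd 0 ^ (r - j)) (pderivEnd 1 ^ (r - j))) =
      tensorEnd (pderivEnd 0 ^ (r - j) * pderivEnd 1 ^ j)
        (pderivEnd 0 ^ j * pderivEnd 1 ^ (r - j)) := by
    rw [tensorEnd_mul, (commute_pderivEnd.pow_pow j (r - j)).eq]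
  rw [smul_mul_assoc, e1, ← nsmul_eq_mul']
  simp only [LinearMap.smul_apply, tensorEnd_tmul, map_smul, map_nsmul,
    Module.End.mul_apply, LinearMap.mul'_apply, pderivEnd_pow_apply, partialXZ]
  simp only [MvPolynomial.smul_eq_C_mul, nsmul_eq_mul, map_mul, map_natCast]
  ring

lemma transvectant_eq (n m r : ℕ) (f h : MvPolynomial (Fin 2) k) :
    transvectant n m r f h = MvPolynomial.C ((((m - r).factorial * (n - r).factorial : ℕ) : k) /
      ((n.factorial * m.factorial : ℕ) : k)) *
      LinearMap.mul' k _ ((cayleyOmega ^ r) (TensorProduct.tmul k f h)) := by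
  rw [cayleyOmega_pow_tmul, transvectant]

/-- Transvectants are covariants. -/
lemma transvectant_subst (M : Matrix (Fin 2) (Fin 2) k) (n m r : ℕ)
    (f h : MvPolynomial (Fin 2) k) :
    transvectant n m r (subst M f) (subst M h) =
      MvPolynomial.C (M.det ^ r) * subst M (transvectant n m r f h) := by
  have h1 := cayleyOmega_pow_map_subst M r (TensorProduct.tmul k f h)
  rw [TensorProduct.map_tmul] at h1
  simp only [AlgHom.toLinearMap_apply] at h1
  have h2 : ∀ t, LinearMap.mul' k _
      (TensorProduct.map (subst M).toLinearMap (subst M).toLinearMap t) =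
      subst M (LinearMap.mul' k _ t) := by
    intro t
    induction t with
    | zero => simp
    | add x y hx hy => simp only [map_add, hx, hy]
    | tmul f h => simp
  rw [transvectant_eq, transvectant_eq, h1, map_smul, h2, map_mul, subst_C,
    MvPolynomial.smul_eq_C_mul]
  ring

lemma transvectant_C_mul (a b : k) (n m r : ℕ) (f h : MvPolynomial (Fin 2) k) :
    transvectant n m r (MvPolynomial.C a * f) (MvPolynomial.C b * h) =
      MvPolynomial.C (a * b) * transvectant n m r f h := by
  rw [transvectant_eq, transvectant_eq, ← MvPolynomial.smul_eq_C_mul f,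
    ← MvPolynomial.smul_eq_C_mul h, TensorProduct.smul_tmul_smul, map_smul, map_smul,
    MvPolynomial.smul_eq_C_mul]
  ring

lemma transvectant_C_mul_subst (M : Matrix (Fin 2) (Fin 2) k) (a b : k) (n m r : ℕ)
    (f h : MvPolynomial (Fin 2) k) :
    transvectant n m r (MvPolynomial.C a * subst M f) (MvPolynomial.C b * subst M h) =
      MvPolynomial.C (a * b * M.det ^ r) * subst M (transvectant n m r f h) := by
  rw [transvectant_C_mul, transvectant_subst, ← mul_assoc, ← map_mul]

/-! ### Invariance of the absolute invariants -/

section Invariance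

variable {g : ℕ} {F H : k[X]} {e : k} {M : Matrix (Fin 2) (Fin 2) k}

lemma constantCoeff_transvectant_C_mul_subst (a b : k) (n m r : ℕ)
    (f h : MvPolynomial (Fin 2) k) :
    MvPolynomial.constantCoeff
        (transvectant n m r (MvPolynomial.C a * subst M f) (MvPolynomial.C b * subst M h)) =
      a * b * M.det ^ r * MvPolynomial.constantCoeff (transvectant n m r f h) := by
  rw [transvectant_C_mul_subst, map_mul, constantCoeff_subst, MvPolynomial.constantCoeff_C]

lemma covJ_of_form_eq (h : form g F = MvPolynomial.C e * subst M (form g H)) (j : ℕ) :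
    covJ g F j = MvPolynomial.C (e * e * M.det ^ (2 * g + 2 - 2 * j)) * subst M (covJ g H j) := by
  rw [covJ, h, transvectant_C_mul_subst, covJ]

lemma covFJ_of_form_eq (h : form g F = MvPolynomial.C e * subst M (form g H)) (j : ℕ) :
    covFJ g F j = MvPolynomial.C (e * (e * e * M.det ^ (2 * g + 2 - 2 * j)) * M.det ^ (4 * j)) *
      subst M (covFJ g H j) := by
  rw [covFJ, covJ_of_form_eq h, h, transvectant_C_mul_subst, covFJ]

lemma I2_of_form_eq (h : form g F = MvPolynomial.C e * subst M (form g H)) :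
    I2 g F = (e * M.det ^ (g + 1)) ^ 2 * I2 g H := by
  rw [I2, h, constantCoeff_transvectant_C_mul_subst, I2]
  ring

lemma I3_of_form_eq (h : form g F = MvPolynomial.C e * subst M (form g H))
    (hg : Odd g) : I3 g F = (e * M.det ^ (g + 1)) ^ 3 * I3 g H := by
  obtain ⟨t, rfl⟩ := hg
  rw [I3, covJ_of_form_eq h, h, constantCoeff_transvectant_C_mul_subst, I3]
  have : 2 * (2 * t + 1) + 2 - 2 * ((2 * (2 * t + 1) + 2) / 4) = 2 * t + 2 := by omega
  rw [this]
  ring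

lemma I4'_of_form_eq (h : form g F = MvPolynomial.C e * subst M (form g H))
    (hg : 1 ≤ g) : I4' g F = (e * M.det ^ (g + 1)) ^ 4 * I4' g H := by
  obtain ⟨t, rfl⟩ := Nat.exists_eq_add_of_le hg
  rw [I4', covJ_of_form_eq h, constantCoeff_transvectant_C_mul_subst, I4']
  have : 2 * (1 + t) + 2 - 2 * 2 = 2 * t := by omega
  rw [this]
  ring

lemma invSix_of_form_eq (h : form g F = MvPolynomial.C e * subst M (form g H)) (j : ℕ)
    (hg : 4 * j ≤ 2 * g + 2) : invSix g F j = (e * M.det ^ (g + 1)) ^ 6 * invSix g H j := by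
  rw [invSix, covFJ_of_form_eq h, constantCoeff_transvectant_C_mul_subst, invSix]
  obtain ⟨t, ht⟩ := Nat.exists_eq_add_of_le hg
  have h1 : 2 * g + 2 - 2 * j = 2 * j + t := by omega
  have h2 : 2 * g + 2 - 4 * j = t := by omega
  have h3 : M.det ^ (6 * g + 6) = M.det ^ (12 * j + 3 * t) := by congr 1; omega
  rw [h1, h2]
  linear_combination (-(e ^ 6 * MvPolynomial.constantCoeff
    (transvectant t t t (covFJ g H j) (covFJ g H j)))) * h3

lemma I12_of_form_eq (h : form g F = MvPolynomial.C e * subst M (form g H))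
    (hg : 4 ≤ g) : I12 g F = (e * M.det ^ (g + 1)) ^ 12 * I12 g H := by
  obtain ⟨t, rfl⟩ := Nat.exists_eq_add_of_le hg
  rw [I12, covM, covFJ_of_form_eq h, covFJ_of_form_eq h, transvectant_C_mul_subst,
    constantCoeff_transvectant_C_mul_subst, I12, covM]
  have h1 : 2 * (4 + t) + 2 - 2 * 1 = 2 * t + 8 := by omega
  have h2 : 2 * (4 + t) + 2 - 2 * 2 = 2 * t + 6 := by omega
  have h3 : 2 * (4 + t) + 2 - 10 = 2 * t := by omega
  rw [h1, h2, h3]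
  ring

lemma I12ast_of_form_eq (h : form g F = MvPolynomial.C e * subst M (form g H))
    (hg : 3 ≤ g) : I12ast g F = (e * M.det ^ (g + 1)) ^ 12 * I12ast g H := by
  obtain ⟨t, rfl⟩ := Nat.exists_eq_add_of_le hg
  rw [I12ast, covJS, covS, covJ_of_form_eq h, covJ_of_form_eq h, transvectant_C_mul_subst,
    transvectant_C_mul_subst, constantCoeff_transvectant_C_mul_subst, I12ast, covJS, covS]
  have h1 : 2 * (3 + t) + 2 - 2 * 3 = 2 * t + 2 := by omega
  have h2 : 2 * (3 + t) + 2 - 2 * 4 = 2 * t := by omega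
  rw [h1, h2]
  ring

/-- Curves whose binary forms agree up to a linear substitution and a scalar have the same
absolute invariants: an invariant of degree `m` is multiplied by the `m`-th power of one scalar. -/
lemma invariantPoint_eq_of_form_eq (h : form g F = MvPolynomial.C e * subst M (form g H))
    (he : e ≠ 0) (hM : M.det ≠ 0)
    (hg : g = 5 ∨ g = 7 ∨ g = 8 ∨ g = 9 ∨ g = 10 ∨ g = 12) :
    invariantPoint g F = invariantPoint g H := by
  have hε : e * M.det ^ (g + 1) ≠ 0 := mul_ne_zero he (pow_ne_zero _ hM)
  have h2 := I2_of_form_eq h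
  have h4 := I4'_of_form_eq h (by omega)
  have h3 : Odd g → _ := I3_of_form_eq h
  have h6 : I6 g F = _ := invSix_of_form_eq h 1 (by omega)
  have h6' : I6' g F = _ := invSix_of_form_eq h 2 (by omega)
  have h6a : g = 8 ∨ g = 12 → I6ast g F = _ := fun hg => invSix_of_form_eq h 3 (by omega)
  have h6s : g = 10 → I6star g F = _ := fun hg => invSix_of_form_eq h 4 (by omega)
  have h12 := I12_of_form_eq h (by omega)
  have h12a := I12ast_of_form_eq h (by omega)
  simp only [← I6.eq_def, ← I6'.eq_def, ← I6ast.eq_def, ← I6star.eq_def] at h6 h6' h6a h6s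
  generalize e * M.det ^ (g + 1) = ε at *
  have hpow : ∀ (m : ℕ) (x y : k), (ε ^ m * x) / (ε ^ m * y) = x / y := fun m x y =>
    mul_div_mul_left _ _ (pow_ne_zero _ hε)
  have hz : ∀ (m : ℕ) (x y : k), x = ε ^ m * y → (x = 0 ↔ y = 0) := fun m x y hx => by
    rw [hx, mul_eq_zero, or_iff_right (pow_ne_zero _ hε)]
  rcases hg with rfl | rfl | rfl | rfl | rfl | rfl
  · have hz' := hz _ _ _ (h2)
    by_cases h0 : I2 5 H = 0
    · have h0' := hz'.2 h0
      norm_num [invariantPoint, h0, h0']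
      norm_num [h2, h4, h3 (by decide), mul_pow, ← pow_mul, hpow]
    · have h0' := mt hz'.1 h0
      norm_num [invariantPoint, h0, h0']
      norm_num [h2, h4, h3 (by decide), mul_pow, ← pow_mul, hpow]
  · have hz' := hz _ _ _ (h3 (by decide))
    by_cases h0 : I3 7 H = 0
    · have h0' := hz'.2 h0
      norm_num [invariantPoint, h0, h0']
      norm_num [h6, h6', h3 (by decide), mul_pow, ← pow_mul, hpow]
    · have h0' := mt hz'.1 h0
      norm_num [invariantPoint, h0, h0']
      norm_num [h6, h6', h3 (by decide), mul_pow, ← pow_mul, hpow]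
  · have hz' := hz _ _ _ (h2)
    by_cases h0 : I2 8 H = 0
    · have h0' := hz'.2 h0
      norm_num [invariantPoint, h0, h0']
      norm_num [h2, h4, h6a (by decide), mul_pow, ← pow_mul, hpow]
    · have h0' := mt hz'.1 h0
      norm_num [invariantPoint, h0, h0']
      norm_num [h2, h4, h6a (by decide), mul_pow, ← pow_mul, hpow]
  · have hz' := hz _ _ _ (h2)
    by_cases h0 : I2 9 H = 0
    · have h0' := hz'.2 h0
      norm_num [invariantPoint, h0, h0']
      norm_num [h2, h4, h3 (by decide), mul_pow, ← pow_mul, hpow]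
    · have h0' := mt hz'.1 h0
      norm_num [invariantPoint, h0, h0']
      norm_num [h2, h4, h3 (by decide), mul_pow, ← pow_mul, hpow]
  · have hz' := hz _ _ _ (h12)
    by_cases h0 : I12 10 H = 0
    · have h0' := hz'.2 h0
      norm_num [invariantPoint, h0, h0']
      norm_num [h6, h6', h6s rfl, h12, h12a, mul_pow, ← pow_mul, hpow]
    · have h0' := mt hz'.1 h0
      norm_num [invariantPoint, h0, h0']
      norm_num [h6, h6', h6s rfl, h12, h12a, mul_pow, ← pow_mul, hpow]
  · have hz' := hz _ _ _ (h2)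
    by_cases h0 : I2 12 H = 0
    · have h0' := hz'.2 h0
      norm_num [invariantPoint, h0, h0']
      norm_num [h2, h4, h6a (by decide), mul_pow, ← pow_mul, hpow]
    · have h0' := mt hz'.1 h0
      norm_num [invariantPoint, h0, h0']
      norm_num [h2, h4, h6a (by decide), mul_pow, ← pow_mul, hpow]

end Invariance

/-! ### Transvectants in coordinates -/

/-- The binary form `∑ᵢ (n choose i) aᵢ Xⁱ Z^(n-i)`. With the binomial coefficients split off,
differentiation is a shift of the coefficients `aᵢ`. -/
def nform (n : ℕ) (a : ℕ → k) : MvPolynomial (Fin 2) k :=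
  ∑ p ∈ Finset.HasAntidiagonal.antidiagonal n,
    MvPolynomial.C ((n.choose p.1 : k) * a p.1) *
      (MvPolynomial.X 0 ^ p.1 * MvPolynomial.X 1 ^ p.2)

lemma nform_zero (a : ℕ → k) : nform 0 a = MvPolynomial.C (a 0) := by
  simp [nform]

lemma nform_congr {n : ℕ} {a b : ℕ → k} (h : ∀ i ≤ n, a i = b i) : nform n a = nform n b := by
  refine Finset.sum_congr rfl fun p hp => ?_
  rw [h p.1 (Finset.HasAntidiagonal.mem_antidiagonal.1 hp ▸ Nat.le_add_right _ _)]

lemma C_mul_nform (c : k) (n : ℕ) (a : ℕ → k) :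
    MvPolynomial.C c * nform n a = nform n fun i => c * a i := by
  rw [nform, nform, Finset.mul_sum]
  refine Finset.sum_congr rfl fun p _ => ?_
  simp only [map_mul]
  ring

lemma nform_sum {ι : Type*} (s : Finset ι) (n : ℕ) (a : ι → ℕ → k) :
    ∑ j ∈ s, nform n (a j) = nform n fun i => ∑ j ∈ s, a j i := by
  simp only [nform]
  rw [Finset.sum_comm]
  refine Finset.sum_congr rfl fun p _ => ?_
  rw [Finset.mul_sum, map_sum, Finset.sum_mul]

lemma pderiv_zero_nform (n : ℕ) (a : ℕ → k) :
    MvPolynomial.pderiv 0 (nform (n + 1) a) =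
      MvPolynomial.C ((n + 1 : ℕ) : k) * nform n fun i => a (i + 1) := by
  rw [nform, Finset.Nat.sum_antidiagonal_succ, nform, map_add, map_sum, Finset.mul_sum]
  simp only [MvPolynomial.pderiv_mul, MvPolynomial.pderiv_C, MvPolynomial.pderiv_pow,
    MvPolynomial.pderiv_X_self, MvPolynomial.pderiv_X_of_ne (show (1 : Fin 2) ≠ 0 by decide)]
  simp only [pow_zero, mul_zero, zero_mul, zero_add, add_zero, mul_one, Nat.cast_zero]
  refine Finset.sum_congr rfl fun p _ => ?_
  have h : ((n + 1 : ℕ) : k) * (n.choose p.1 : k) =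
      ((n + 1).choose (p.1 + 1) : k) * ((p.1 + 1 : ℕ) : k) := by
    rw [← Nat.cast_mul, ← Nat.cast_mul, Nat.add_one_mul_choose_eq n p.1]
  simp only [Nat.add_sub_cancel, ← map_natCast (MvPolynomial.C (σ := Fin 2) (R := k))]
  have h' := congrArg (MvPolynomial.C (σ := Fin 2)) h
  simp only [map_mul] at h' ⊢
  linear_combination (-(MvPolynomial.C (a (p.1 + 1)) * MvPolynomial.X 0 ^ p.1 *
    MvPolynomial.X 1 ^ p.2)) * h'

lemma pderiv_one_nform (n : ℕ) (a : ℕ → k) :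
    MvPolynomial.pderiv 1 (nform (n + 1) a) =
      MvPolynomial.C ((n + 1 : ℕ) : k) * nform n a := by
  rw [nform, Finset.Nat.sum_antidiagonal_succ', nform, map_add, map_sum, Finset.mul_sum]
  simp only [MvPolynomial.pderiv_mul, MvPolynomial.pderiv_C, MvPolynomial.pderiv_pow,
    MvPolynomial.pderiv_X_self, MvPolynomial.pderiv_X_of_ne (show (0 : Fin 2) ≠ 1 by decide)]
  simp only [pow_zero, mul_zero, zero_mul, zero_add, add_zero, mul_one, Nat.cast_zero]
  refine Finset.sum_congr rfl fun p hp => ?_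
  have hp' : p.1 + p.2 = n := Finset.HasAntidiagonal.mem_antidiagonal.1 hp
  have h : ((n + 1 : ℕ) : k) * (n.choose p.1 : k) =
      ((n + 1).choose p.1 : k) * ((p.2 + 1 : ℕ) : k) := by
    have := Nat.choose_mul_succ_eq n p.1
    rw [show n + 1 - p.1 = p.2 + 1 by omega] at this
    rw [mul_comm, ← Nat.cast_mul, ← Nat.cast_mul, this]
  simp only [Nat.add_sub_cancel, ← map_natCast (MvPolynomial.C (σ := Fin 2) (R := k))]
  have h' := congrArg (MvPolynomial.C (σ := Fin 2)) h
  simp only [map_mul] at h' ⊢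
  linear_combination (-(MvPolynomial.C (a p.1) * MvPolynomial.X 0 ^ p.1 *
    MvPolynomial.X 1 ^ p.2)) * h'

lemma iterate_pderiv_C_mul (i : Fin 2) (p : ℕ) (c : k) (f : MvPolynomial (Fin 2) k) :
    (MvPolynomial.pderiv i)^[p] (MvPolynomial.C c * f) =
      MvPolynomial.C c * (MvPolynomial.pderiv i)^[p] f := by
  induction p generalizing f with
  | zero => rfl
  | succ p ih => rw [Function.iterate_succ_apply, MvPolynomial.pderiv_C_mul, ih,
      Function.iterate_succ_apply]

lemma partialXZ_nform [CharZero k] (p q n : ℕ) (a : ℕ → k) :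
    partialXZ p q (nform (n + p + q) a) =
      MvPolynomial.C (((n + p + q).factorial : k) / (n.factorial : k)) *
        nform n fun i => a (i + p) := by
  have hf : ∀ n : ℕ, (n.factorial : k) ≠ 0 := fun n => by exact_mod_cast n.factorial_ne_zero
  have h1 : ∀ (q n : ℕ), (MvPolynomial.pderiv 1)^[q] (nform (n + q) a) =
      MvPolynomial.C (((n + q).factorial : k) / (n.factorial : k)) * nform n a := by
    intro q
    induction q with
    | zero => intro n; simp [hf]
    | succ q ih =>
      intro n
      rw [Function.iterate_succ_apply', show n + (q + 1) = (n + 1) + q by ring, ih,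
        MvPolynomial.pderiv_C_mul, pderiv_one_nform, ← mul_assoc, ← map_mul]
      congr 2
      rw [Nat.factorial_succ n]
      have := hf n
      have : ((n + 1 : ℕ) : k) ≠ 0 := by exact_mod_cast n.succ_ne_zero
      push_cast at *
      field_simp
  have h2 : ∀ (p n : ℕ) (a : ℕ → k), (MvPolynomial.pderiv 0)^[p] (nform (n + p) a) =
      MvPolynomial.C (((n + p).factorial : k) / (n.factorial : k)) *
        nform n fun i => a (i + p) := by
    intro p
    induction p with
    | zero => intro n a; simp [hf]
    | succ p ih =>
      intro n a
      rw [Function.iterate_succ_apply', show n + (p + 1) = (n + 1) + p by ring, ih,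
        MvPolynomial.pderiv_C_mul, pderiv_zero_nform, ← mul_assoc, ← map_mul]
      congr 2
      · rw [Nat.factorial_succ n]
        have := hf n
        have : ((n + 1 : ℕ) : k) ≠ 0 := by exact_mod_cast n.succ_ne_zero
        push_cast at *
        field_simp
      · funext i
        congr 1
        ring
  rw [partialXZ, h1, iterate_pderiv_C_mul, h2, ← mul_assoc, ← map_mul]
  congr 2
  have := hf (n + p)
  field_simp

lemma nform_eq_sum_range (n : ℕ) (a : ℕ → k) :
    nform n a = ∑ i ∈ Finset.range (n + 1), MvPolynomial.C ((n.choose i : k) * a i) *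
      (MvPolynomial.X 0 ^ i * MvPolynomial.X 1 ^ (n - i)) := by
  rw [nform, Finset.Nat.sum_antidiagonal_eq_sum_range_succ_mk]

/-- The coefficients, up to the factor `(p + q choose p)`, of the product of two forms of degrees
`p` and `q`. -/
def mulCoeff {R : Type*} [CommSemiring R] (p q : ℕ) (a b : ℕ → R) (e : ℕ) : R :=
  ∑ i ∈ Finset.range (p + 1), if i ≤ e ∧ e ≤ i + q then
    ((e.choose i * (p + q - e).choose (p - i) : ℕ) : R) * (a i * b (e - i)) else 0

lemma nform_mul_nform [CharZero k] (p q : ℕ) (a b : ℕ → k) :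
    nform p a * nform q b =
      MvPolynomial.C (((p + q).choose p : k)⁻¹) * nform (p + q) (mulCoeff p q a b) := by
  have hf : ∀ n : ℕ, (n.factorial : k) ≠ 0 := fun n => by exact_mod_cast n.factorial_ne_zero
  rw [C_mul_nform, nform_eq_sum_range, nform_eq_sum_range, nform_eq_sum_range,
    Finset.sum_mul_sum]
  simp only [mulCoeff, Finset.mul_sum, map_sum, Finset.sum_mul]
  rw [Finset.sum_comm (s := Finset.range (p + q + 1))]
  refine Finset.sum_congr rfl fun i hi => ?_
  have hi' : i ≤ p := Nat.lt_succ_iff.1 (Finset.mem_range.1 hi)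
  have hfil : (Finset.range (p + q + 1)).filter (fun e => i ≤ e ∧ e ≤ i + q) =
      Finset.Ico i (i + q + 1) := by
    ext e
    simp only [Finset.mem_filter, Finset.mem_range, Finset.mem_Ico]
    omega
  simp only [mul_ite, mul_zero, ite_mul, zero_mul, apply_ite (MvPolynomial.C (σ := Fin 2)),
    map_zero]
  rw [← Finset.sum_filter, hfil, Finset.sum_Ico_eq_sum_range,
    show i + q + 1 - i = q + 1 by omega]
  refine Finset.sum_congr rfl fun l hl => ?_
  have hl' : l ≤ q := Nat.lt_succ_iff.1 (Finset.mem_range.1 hl)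
  obtain ⟨i', rfl⟩ := Nat.exists_eq_add_of_le hi'
  obtain ⟨l', rfl⟩ := Nat.exists_eq_add_of_le hl'
  have e1 : i + i' + (l + l') - (i + l) = i' + l' := by omega
  have key : ((i + i').choose i : k) * ((l + l').choose l : k) =
      ((i + i' + (l + l')).choose (i + l) : k) * (((i + i' + (l + l')).choose (i + i') : k)⁻¹ *
        (((i + l).choose i * (i' + l').choose i' : ℕ) : k)) := by
    push_cast
    rw [show ((i + i' + (l + l')).choose (i + l) : k) = ((i + l + (i' + l')).choose (i + l) : k) by
      congr 2; ring]
    simp only [Nat.cast_add_choose]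
    rw [show i + i' + (l + l') = i + l + (i' + l') by ring]
    have h1 := hf i
    have h2 := hf i'
    have h3 := hf l
    have h4 := hf l'
    have h5 := hf (i + i')
    have h6 := hf (l + l')
    have h7 := hf (i + l)
    have h8 := hf (i' + l')
    have h9 := hf (i + l + (i' + l'))
    field_simp
  have key' := congrArg (MvPolynomial.C (σ := Fin 2)) key
  simp only [e1, Nat.add_sub_cancel_left, pow_add, map_mul] at key' ⊢
  linear_combination (MvPolynomial.C (a i) * MvPolynomial.C (b l) * MvPolynomial.X 0 ^ i *
    MvPolynomial.X 0 ^ l * MvPolynomial.X 1 ^ i' * MvPolynomial.X 1 ^ l') * key'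

/-- The coefficients, up to the factor `(p + q choose p)`, of the `r`-th transvectant of two forms
of degrees `p + r` and `q + r`. -/
def transCoeff {R : Type*} [CommRing R] (p q r : ℕ) (a b : ℕ → R) (e : ℕ) : R :=
  ∑ j ∈ Finset.range (r + 1), ((-1) ^ j * (r.choose j : R)) *
    mulCoeff p q (fun i => a (i + (r - j))) (fun i => b (i + j)) e

lemma transvectant_nform [CharZero k] (p q r : ℕ) (a b : ℕ → k) :
    transvectant (p + r) (q + r) r (nform (p + r) a) (nform (q + r) b) =
      MvPolynomial.C (((p + q).choose p : k)⁻¹) * nform (p + q) (transCoeff p q r a b) := by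
  have hf : ∀ n : ℕ, (n.factorial : k) ≠ 0 := fun n => by exact_mod_cast n.factorial_ne_zero
  have e : transCoeff p q r a b = fun e => ∑ j ∈ Finset.range (r + 1),
      ((-1) ^ j * (r.choose j : k)) *
        mulCoeff p q (fun i => a (i + (r - j))) (fun i => b (i + j)) e := rfl
  rw [e, ← nform_sum, transvectant, Finset.mul_sum, Finset.mul_sum]
  refine Finset.sum_congr rfl fun j hj => ?_
  have hj' : j ≤ r := Nat.lt_succ_iff.1 (Finset.mem_range.1 hj)
  obtain ⟨j', rfl⟩ := Nat.exists_eq_add_of_le hj'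
  have h1 := partialXZ_nform j' j p a
  have h2 := partialXZ_nform j j' q b
  rw [show p + j' + j = p + (j + j') by ring] at h1
  rw [show q + j + j' = q + (j + j') by ring] at h2
  rw [Nat.add_sub_cancel_left, h1, h2, ← C_mul_nform, Nat.add_sub_cancel, Nat.add_sub_cancel]
  have h3 := nform_mul_nform p q (fun i => a (i + j')) (fun i => b (i + j))
  have h4 : (((q.factorial * p.factorial : ℕ) : k) /
      (((p + (j + j')).factorial * (q + (j + j')).factorial : ℕ) : k)) *
      (((p + (j + j')).factorial : k) / (p.factorial : k)) *
      (((q + (j + j')).factorial : k) / (q.factorial : k)) = 1 := by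
    have h1 := hf p
    have h2 := hf q
    have h5 := hf (p + (j + j'))
    have h6 := hf (q + (j + j'))
    push_cast
    field_simp
  have h4' := congrArg (MvPolynomial.C (σ := Fin 2)) h4
  rw [map_mul, map_mul, map_one] at h4'
  linear_combination (MvPolynomial.C ((-1) ^ j * ((j + j').choose j : k)) *
    nform p (fun i => a (i + j')) * nform q (fun i => b (i + j))) * h4' +
    MvPolynomial.C ((-1) ^ j * ((j + j').choose j : k)) * h3

/-! ### Integral polynomials in the parameter as lists of coefficients -/

/-- The value at `μ` of the polynomial whose coefficients, from the constant term on, are listed. -/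
def evalList (μ : k) : List ℤ → k
  | [] => 0
  | a :: l => a + μ * evalList μ l

/-- Sum of polynomials. -/
def listAdd : List ℤ → List ℤ → List ℤ
  | [], b => b
  | a, [] => a
  | x :: a, y :: b => (x + y) :: listAdd a b

/-- Integral multiple of a polynomial. -/
def listSmul (c : ℤ) : List ℤ → List ℤ
  | [] => []
  | x :: a => (c * x) :: listSmul c a

/-- Product of polynomials, by recursion on the first factor. -/
def listMulAux (b : List ℤ) : List ℤ → List ℤ
  | [] => []
  | x :: a => listAdd (listSmul x b) (0 :: listMulAux b a)

/-- Product of polynomials, which is the empty list as soon as one factor is. -/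
def listMul (a : List ℤ) : List ℤ → List ℤ
  | [] => []
  | y :: b => listMulAux (y :: b) a

/-- Sum of a family of polynomials. -/
def listSum (f : ℕ → List ℤ) : List ℕ → List ℤ
  | [] => []
  | i :: l => listAdd (f i) (listSum f l)

/-- Whether all coefficients vanish. -/
def listIsZero : List ℤ → Bool
  | [] => true
  | x :: a => (x == 0) && listIsZero a

lemma evalList_listAdd (μ : k) (a b : List ℤ) :
    evalList μ (listAdd a b) = evalList μ a + evalList μ b := by
  induction a generalizing b with
  | nil => simp [listAdd, evalList]
  | cons x a ih =>
    cases b with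
    | nil => simp [listAdd, evalList]
    | cons y b => simp only [listAdd, evalList, ih]; push_cast; ring

lemma evalList_listSmul (μ : k) (c : ℤ) (a : List ℤ) :
    evalList μ (listSmul c a) = c * evalList μ a := by
  induction a with
  | nil => simp [listSmul, evalList]
  | cons x a ih => simp only [listSmul, evalList, ih]; push_cast; ring

lemma evalList_listMul (μ : k) (a b : List ℤ) :
    evalList μ (listMul a b) = evalList μ a * evalList μ b := by
  cases b with
  | nil => simp [listMul, evalList]
  | cons y b =>
    rw [listMul]
    induction a with
    | nil => simp [listMulAux, evalList]
    | cons x a ih =>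
      simp only [listMulAux, evalList_listAdd, evalList_listSmul, evalList, ih]
      push_cast
      ring

lemma evalList_listSum (μ : k) (f : ℕ → List ℤ) (n : ℕ) :
    evalList μ (listSum f (List.range n)) = ∑ i ∈ Finset.range n, evalList μ (f i) := by
  have : ∀ l : List ℕ, evalList μ (listSum f l) = (l.map fun i => evalList μ (f i)).sum := by
    intro l
    induction l with
    | nil => simp [listSum, evalList]
    | cons i l ih => simp [listSum, evalList_listAdd, ih]
  rw [this]
  rfl

lemma evalList_of_listIsZero (μ : k) {a : List ℤ} (h : listIsZero a = true) :
    evalList μ a = 0 := by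
  induction a with
  | nil => rfl
  | cons x a ih =>
    simp only [listIsZero, Bool.and_eq_true, beq_iff_eq] at h
    simp [evalList, h.1, ih h.2]

/-- The binomial coefficient by factorials: unlike the recursion of Pascal, this is quick to
evaluate. -/
def quickChoose (n i : ℕ) : ℕ := n.factorial / (i.factorial * (n - i).factorial)

lemma quickChoose_eq {n i : ℕ} (h : i ≤ n) : quickChoose n i = n.choose i :=
  (Nat.choose_eq_factorial_div_factorial h).symm

/-- The coefficient sequence at `μ` of a form whose coefficients are polynomials in `μ`. -/
def coeffAt (μ : k) (A : List (List ℤ)) (i : ℕ) : k := evalList μ (A.getD i [])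

/-- The coefficients `transCoeff`, for forms whose coefficients are polynomials. -/
def listTransCoeff (p q r : ℕ) (A B : List (List ℤ)) (e : ℕ) : List ℤ :=
  listSum (fun j => listSmul (if j % 2 = 0 then quickChoose r j else -quickChoose r j)
    (listSum (fun i => if i ≤ e ∧ e ≤ i + q then
      listSmul (quickChoose e i * quickChoose (p + q - e) (p - i) : ℕ)
        (listMul (A.getD (i + (r - j)) []) (B.getD (e - i + j) [])) else [])
      (List.range (p + 1)))) (List.range (r + 1))

lemma evalList_listTransCoeff (μ : k) (p q r : ℕ) (A B : List (List ℤ)) (e : ℕ) (he : e ≤ p + q) :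
    evalList μ (listTransCoeff p q r A B e) =
      transCoeff p q r (coeffAt μ A) (coeffAt μ B) e := by
  rw [listTransCoeff, evalList_listSum, transCoeff]
  refine Finset.sum_congr rfl fun j hj => ?_
  rw [evalList_listSmul, evalList_listSum, mulCoeff]
  congr 1
  · rw [quickChoose_eq (Nat.lt_succ_iff.1 (Finset.mem_range.1 hj))]
    split_ifs with h
    · rw [(Nat.even_iff.2 h).neg_one_pow]; simp
    · rw [(Nat.odd_iff.2 (by omega)).neg_one_pow]; simp
  · refine Finset.sum_congr rfl fun i hi => ?_
    have := Finset.mem_range.1 hi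
    split_ifs with h
    · rw [evalList_listSmul, evalList_listMul, quickChoose_eq h.1, quickChoose_eq (by omega)]
      simp [coeffAt]
    · rfl

/-- Checks that the transvectant of the forms with coefficients `A` and `B` has coefficients
`c * D`. -/
def checkTrans (p q r : ℕ) (c : ℤ) (A B D : List (List ℤ)) : Bool :=
  (List.range (p + q + 1)).all fun e =>
    listIsZero (listAdd (listTransCoeff p q r A B e) (listSmul (-c) (D.getD e [])))

lemma transCoeff_of_checkTrans (μ : k) {p q r : ℕ} {c : ℤ} {A B D : List (List ℤ)}
    (h : checkTrans p q r c A B D = true) {e : ℕ} (he : e ≤ p + q) :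
    transCoeff p q r (coeffAt μ A) (coeffAt μ B) e = c * coeffAt μ D e := by
  have h1 := evalList_of_listIsZero μ
    (List.all_eq_true.1 h e (List.mem_range.2 (Nat.lt_succ_iff.2 he)))
  rw [evalList_listAdd, evalList_listSmul, evalList_listTransCoeff μ _ _ _ _ _ _ he] at h1
  rw [coeffAt]
  push_cast at h1
  linear_combination h1

/-- The form of degree `n` whose coefficients, with the binomial coefficients split off, are
`x` times the polynomials listed in `A`. -/
def listForm (μ : k) (n : ℕ) (x : ℚ) (A : List (List ℤ)) : MvPolynomial (Fin 2) k :=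
  MvPolynomial.C (x : k) * nform n (coeffAt μ A)

lemma transvectant_listForm [CharZero k] (μ : k) (p q r : ℕ) {n m : ℕ} (c : ℤ) {x y z : ℚ}
    {A B D : List (List ℤ)} (h : checkTrans p q r c A B D = true)
    (hn : n = p + r) (hm : m = q + r) (hz : x * y * c = z * quickChoose (p + q) p) :
    transvectant n m r (listForm μ n x A) (listForm μ m y B) = listForm μ (p + q) z D := by
  subst hn hm
  have hpq : (((p + q).choose p : ℕ) : k) ≠ 0 := by
    exact_mod_cast (Nat.choose_pos (Nat.le_add_right p q)).ne'
  rw [quickChoose_eq (Nat.le_add_right p q)] at hz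
  have hz' : (x : k) * y * c = z * ((p + q).choose p : k) := by
    exact_mod_cast congrArg (Rat.cast (K := k)) hz
  rw [listForm, listForm, transvectant_C_mul, transvectant_nform, ← mul_assoc, ← map_mul, listForm,
    nform_congr fun e he => transCoeff_of_checkTrans μ h he, ← C_mul_nform, ← mul_assoc, ← map_mul]
  congr 2
  field_simp
  linear_combination hz'

lemma constantCoeff_listForm (μ : k) (x : ℚ) (l : List ℤ) :
    MvPolynomial.constantCoeff (listForm μ 0 x [l]) = x * evalList μ l := by
  simp [listForm, nform_zero, coeffAt]

/-! ### The coefficients of the normal forms -/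

/-- The polynomial whose coefficients, from the constant term on, are the values at `μ` of the
listed polynomials. -/
def listPoly (μ : k) : List (List ℤ) → k[X]
  | [] => 0
  | a :: l => Polynomial.C (evalList μ a) + Polynomial.X * listPoly μ l

lemma coeff_listPoly (μ : k) (P : List (List ℤ)) (i : ℕ) :
    (listPoly μ P).coeff i = evalList μ (P.getD i []) := by
  induction P generalizing i with
  | nil => simp [listPoly, evalList]
  | cons a P ih =>
    cases i with
    | zero => simp [listPoly]
    | succ i => simp [listPoly, ih]

/-- Checks that the form of degree `d` attached to the polynomial with coefficients `P` is
`1 / D` times the one with coefficients `A`, binomial coefficients split off. -/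
def checkCoeffs (d : ℕ) (D : ℤ) (P A : List (List ℤ)) : Bool :=
  (List.range (d + 1)).all fun i =>
    listIsZero (listAdd (listSmul (quickChoose d i) (A.getD i [])) (listSmul (-D) (P.getD i [])))

lemma form_listPoly [CharZero k] (μ : k) {g d : ℕ} {D : ℤ} {P A : List (List ℤ)}
    (h : checkCoeffs d D P A = true) (hD : D ≠ 0) (hd : d = 2 * g + 2) :
    form g (listPoly μ P) = listForm μ d (1 / D) A := by
  subst hd
  rw [form, binaryForm, listForm, C_mul_nform, nform_eq_sum_range]
  refine Finset.sum_congr rfl fun i hi => ?_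
  rw [coeff_listPoly, mul_assoc]
  congr 2
  have h1 := evalList_of_listIsZero μ (List.all_eq_true.1 h i (List.mem_range.2
    (Finset.mem_range.1 hi)))
  rw [evalList_listAdd, evalList_listSmul, evalList_listSmul,
    quickChoose_eq (Nat.lt_succ_iff.1 (Finset.mem_range.1 hi))] at h1
  have hD' : (D : k) ≠ 0 := by exact_mod_cast hD
  push_cast at h1 ⊢
  rw [coeffAt]
  field_simp
  linear_combination -h1

/-! ### Covariants in genus 5 -/

/-- Coefficients of the binary form in genus `5`, binomial coefficients split off. -/
def coeffs_five : List (List ℤ) :=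
  [[2310], [], [0, -35], [], [-154], [], [0, 5], [], [-154], [], [0, -35], [], [2310]]

lemma form_five [CharZero k] (c : k) :
    form 5 (polyG c) = listForm c 12 (1 / (2310 : ℤ)) coeffs_five := by
  have h : polyG c = listPoly c
      [[1], [], [0, -1], [], [-33], [], [0, 2], [], [-33], [], [0, -1], [], [1]] := by
    simp [polyG, listPoly, evalList, map_ofNat]
    ring
  rw [h]
  exact form_listPoly c (by decide +kernel) (by decide) rfl

lemma I2_five_eq {F : k[X]} {μ : k} [CharZero k]
    (h : form 5 F = listForm μ 12 (1 / (2310 : ℤ)) coeffs_five) :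
    I2 5 F = 8 / 1155 * (5 * μ ^ 2 + 924) := by
  have h1 := (congrArg₂ (transvectant 12 12 12) h h).trans
    (transvectant_listForm μ 0 0 12 36960 (z := 8 / 1155)
      (D := [[924, 0, 5]])
      (by decide +kernel) rfl rfl (by norm_num [quickChoose, Nat.factorial]))
  refine (congrArg MvPolynomial.constantCoeff h1).trans ?_
  rw [constantCoeff_listForm]
  simp only [evalList]
  push_cast
  ring

/-- Coefficients of the covariant `J_8` in genus `5`, binomial coefficients and a rational
factor split off. -/
def coeffsJ2_five : List (List ℤ) :=
  [[2420, 0, -25], [], [], [], [484, 0, -5], [], [], [], [2420, 0, -25]]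

lemma covJ2_five_eq {F : k[X]} {μ : k} [CharZero k]
    (h : form 5 F = listForm μ 12 (1 / (2310 : ℤ)) coeffs_five) :
    covJ 5 F 2 = listForm μ 8 (2 / 27225) coeffsJ2_five :=
  (congrArg₂ (transvectant 12 12 8) h h).trans
    (transvectant_listForm μ 4 4 8 27440 (by decide +kernel) rfl rfl
      (by norm_num [quickChoose, Nat.factorial]))

/-- Coefficients of the covariant `J_12` in genus `5`, binomial coefficients and a rational
factor split off. -/
def coeffsJ3_five : List (List ℤ) :=
  [[0, 50820], [], [-71148, 0, -35], [], [0, -3388], [], [10164, 0, 5], [], [0, -3388], [],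
  [-71148, 0, -35], [], [0, 50820]]

lemma covJ3_five_eq {F : k[X]} {μ : k} [CharZero k]
    (h : form 5 F = listForm μ 12 (1 / (2310 : ℤ)) coeffs_five) :
    covJ 5 F 3 = listForm μ 12 (2 / 2934855) coeffsJ3_five :=
  (congrArg₂ (transvectant 12 12 6) h h).trans
    (transvectant_listForm μ 6 6 6 3360 (by decide +kernel) rfl rfl
      (by norm_num [quickChoose, Nat.factorial]))

lemma I4'_five_eq {F : k[X]} {μ : k} [CharZero k]
    (h : form 5 F = listForm μ 12 (1 / (2310 : ℤ)) coeffs_five) :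
    I4' 5 F = 32 / 49413375 * ((5 * μ ^ 2 - 484) ^ 2) := by
  have h1 := (congrArg₂ (transvectant 8 8 8) (covJ2_five_eq h) (covJ2_five_eq h)).trans
    (transvectant_listForm μ 0 0 8 120 (z := 32 / 49413375)
      (D := [[234256, 0, -4840, 0, 25]])
      (by decide +kernel) rfl rfl (by norm_num [quickChoose, Nat.factorial]))
  refine (congrArg MvPolynomial.constantCoeff h1).trans ?_
  rw [constantCoeff_listForm]
  simp only [evalList]
  push_cast
  ring

lemma I3_five_eq {F : k[X]} {μ : k} [CharZero k]
    (h : form 5 F = listForm μ 12 (1 / (2310 : ℤ)) coeffs_five) :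
    I3 5 F = 32 / 2934855 * (μ * (5 * μ ^ 2 + 30492)) := by
  have h1 := (congrArg₂ (transvectant 12 12 12) h (covJ3_five_eq h)).trans
    (transvectant_listForm μ 0 0 12 36960 (z := 32 / 2934855)
      (D := [[0, 30492, 0, 5]])
      (by decide +kernel) rfl rfl (by norm_num [quickChoose, Nat.factorial]))
  refine (congrArg MvPolynomial.constantCoeff h1).trans ?_
  rw [constantCoeff_listForm]
  simp only [evalList]
  push_cast
  ring

/-! ### Covariants in genus 9 -/

/-- Coefficients of the binary form in genus `9`, binomial coefficients split off. -/
def coeffs_nine : List (List ℤ) :=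
  [[106590], [], [0, -561], [], [-418], [], [0, -33], [], [-418], [], [0, 15], [], [-418], [],
  [0, -33], [], [-418], [], [0, -561], [], [106590]]

lemma form_nine [CharZero k] (c : k) :
    form 9 ((Polynomial.X ^ 8 + 14 * Polynomial.X ^ 4 + 1) * polyG c) =
      listForm c 20 (1 / (106590 : ℤ)) coeffs_nine := by
  have h : (Polynomial.X ^ 8 + 14 * Polynomial.X ^ 4 + 1) * polyG c = listPoly c
      [[1], [], [0, -1], [], [-19], [], [0, -12], [], [-494], [], [0, 26], [], [-494], [], [0,
      -12], [], [-19], [], [0, -1], [], [1]] := by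
    simp [polyG, listPoly, evalList, map_ofNat]
    ring
  rw [h]
  exact form_listPoly c (by decide +kernel) (by decide) rfl

lemma I2_nine_eq {F : k[X]} {μ : k} [CharZero k]
    (h : form 9 F = listForm μ 20 (1 / (106590 : ℤ)) coeffs_nine) :
    I2 9 F = 128 / 17765 * (3 * μ ^ 2 + 836) := by
  have h1 := (congrArg₂ (transvectant 20 20 20) h h).trans
    (transvectant_listForm μ 0 0 20 81861120 (z := 128 / 17765)
      (D := [[836, 0, 3]])
      (by decide +kernel) rfl rfl (by norm_num [quickChoose, Nat.factorial]))
  refine (congrArg MvPolynomial.constantCoeff h1).trans ?_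
  rw [constantCoeff_listForm]
  simp only [evalList]
  push_cast
  ring

/-- Coefficients of the covariant `J_8` in genus `9`, binomial coefficients and a rational
factor split off. -/
def coeffsJ2_nine : List (List ℤ) :=
  [[36100, 0, -45], [], [], [], [7220, 0, -9], [], [], [], [36100, 0, -45]]

lemma covJ2_nine_eq {F : k[X]} {μ : k} [CharZero k]
    (h : form 9 F = listForm μ 20 (1 / (106590 : ℤ)) coeffs_nine) :
    covJ 9 F 2 = listForm μ 8 (32 / 4694805) coeffsJ2_nine :=
  (congrArg₂ (transvectant 20 20 16) h h).trans
    (transvectant_listForm μ 4 4 16 5420800 (by decide +kernel) rfl rfl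
      (by norm_num [quickChoose, Nat.factorial]))

/-- Coefficients of the covariant `J_20` in genus `9`, binomial coefficients and a rational
factor split off. -/
def coeffsJ5_nine : List (List ℤ) :=
  [[0, 20252100], [], [-14851540, 0, -88077], [], [0, -79420], [], [-873620, 0, -5181], [], [0,
  -79420], [], [397100, 0, 2355], [], [0, -79420], [], [-873620, 0, -5181], [], [0, -79420], [],
  [-14851540, 0, -88077], [], [0, 20252100]]

lemma covJ5_nine_eq {F : k[X]} {μ : k} [CharZero k]
    (h : form 9 F = listForm μ 20 (1 / (106590 : ℤ)) coeffs_nine) :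
    covJ 9 F 5 = listForm μ 20 (8 / 61162354605) coeffsJ5_nine :=
  (congrArg₂ (transvectant 20 20 10) h h).trans
    (transvectant_listForm μ 10 10 10 274560 (by decide +kernel) rfl rfl
      (by norm_num [quickChoose, Nat.factorial]))

lemma I4'_nine_eq {F : k[X]} {μ : k} [CharZero k]
    (h : form 9 F = listForm μ 20 (1 / (106590 : ℤ)) coeffs_nine) :
    I4' 9 F = 8192 / 1469412932535 * ((9 * μ ^ 2 - 7220) ^ 2) := by
  have h1 := (congrArg₂ (transvectant 8 8 8) (covJ2_nine_eq h) (covJ2_nine_eq h)).trans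
    (transvectant_listForm μ 0 0 8 120 (z := 8192 / 1469412932535)
      (D := [[52128400, 0, -129960, 0, 81]])
      (by decide +kernel) rfl rfl (by norm_num [quickChoose, Nat.factorial]))
  refine (congrArg MvPolynomial.constantCoeff h1).trans ?_
  rw [constantCoeff_listForm]
  simp only [evalList]
  push_cast
  ring

lemma I3_nine_eq {F : k[X]} {μ : k} [CharZero k]
    (h : form 9 F = listForm μ 20 (1 / (106590 : ℤ)) coeffs_nine) :
    I3 9 F = 6144 / 20387451535 * (μ * (157 * μ ^ 2 + 79420)) := by
  have h1 := (congrArg₂ (transvectant 20 20 20) h (covJ5_nine_eq h)).trans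
    (transvectant_listForm μ 0 0 20 245583360 (z := 6144 / 20387451535)
      (D := [[0, 79420, 0, 157]])
      (by decide +kernel) rfl rfl (by norm_num [quickChoose, Nat.factorial]))
  refine (congrArg MvPolynomial.constantCoeff h1).trans ?_
  rw [constantCoeff_listForm]
  simp only [evalList]
  push_cast
  ring

/-! ### Covariants in genus 8 -/

/-- Coefficients of the binary form in genus `8`, binomial coefficients split off. -/
def coeffs_eight : List (List ℤ) :=
  [[], [-12376], [], [0, 273], [], [884], [], [0, -21], [], [], [], [0, 21], [], [-884], [], [0,
  -273], [], [12376], []]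

lemma form_eight [CharZero k] (c : k) :
    form 8 (Polynomial.X * (Polynomial.X ^ 4 - 1) * polyG c) =
      listForm c 18 (1 / (222768 : ℤ)) coeffs_eight := by
  have h : Polynomial.X * (Polynomial.X ^ 4 - 1) * polyG c = listPoly c
      [[], [-1], [], [0, 1], [], [34], [], [0, -3], [], [], [], [0, 3], [], [-34], [], [0, -1],
      [], [1], []] := by
    simp [polyG, listPoly, evalList, map_ofNat]
    ring
  rw [h]
  exact form_listPoly c (by decide +kernel) (by decide) rfl

lemma I2_eight_eq {F : k[X]} {μ : k} [CharZero k]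
    (h : form 8 F = listForm μ 18 (1 / (222768 : ℤ)) coeffs_eight) :
    I2 8 F = 2 / 4641 * (7 * μ ^ 2 + 884) := by
  have h1 := (congrArg₂ (transvectant 18 18 18) h h).trans
    (transvectant_listForm μ 0 0 18 21385728 (z := 2 / 4641)
      (D := [[884, 0, 7]])
      (by decide +kernel) rfl rfl (by norm_num [quickChoose, Nat.factorial]))
  refine (congrArg MvPolynomial.constantCoeff h1).trans ?_
  rw [constantCoeff_listForm]
  simp only [evalList]
  push_cast
  ring

/-- Coefficients of the covariant `J_8` in genus `8`, binomial coefficients and a rational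
factor split off. -/
def coeffsJ2_eight : List (List ℤ) :=
  [[-75140, 0, -1395], [], [], [], [-15028, 0, -279], [], [], [], [-75140, 0, -1395]]

lemma covJ2_eight_eq {F : k[X]} {μ : k} [CharZero k]
    (h : form 8 F = listForm μ 18 (1 / (222768 : ℤ)) coeffs_eight) :
    covJ 8 F 2 = listForm μ 8 (1 / 12172680) coeffsJ2_eight :=
  (congrArg₂ (transvectant 18 18 14) h h).trans
    (transvectant_listForm μ 4 4 14 285376 (by decide +kernel) rfl rfl
      (by norm_num [quickChoose, Nat.factorial]))

/-- Coefficients of the covariant `J_12` in genus `8`, binomial coefficients and a rational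
factor split off. -/
def coeffsJ3_eight : List (List ℤ) :=
  [[0, 1021020], [], [-1367548, 0, -3675], [], [0, -68068], [], [195364, 0, 525], [], [0,
  -68068], [], [-1367548, 0, -3675], [], [0, 1021020]]

lemma covJ3_eight_eq {F : k[X]} {μ : k} [CharZero k]
    (h : form 8 F = listForm μ 18 (1 / (222768 : ℤ)) coeffs_eight) :
    covJ 8 F 3 = listForm μ 12 (1 / 1421566146) coeffsJ3_eight :=
  (congrArg₂ (transvectant 18 18 12) h h).trans
    (transvectant_listForm μ 6 6 12 32256 (by decide +kernel) rfl rfl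
      (by norm_num [quickChoose, Nat.factorial]))

/-- Coefficients of the covariant `(F, J_12)^12` in genus `8`, binomial coefficients and a rational
factor split off. -/
def coeffsFJ3_eight : List (List ℤ) :=
  [[], [0, -3321188, 0, -3675], [], [], [], [0, 3321188, 0, 3675], []]

lemma covFJ3_eight_eq {F : k[X]} {μ : k} [CharZero k]
    (h : form 8 F = listForm μ 18 (1 / (222768 : ℤ)) coeffs_eight) :
    covFJ 8 F 3 = listForm μ 6 (1 / 14280278103) coeffsFJ3_eight :=
  (congrArg₂ (transvectant 18 12 12) h (covJ3_eight_eq h)).trans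
    (transvectant_listForm μ 6 0 12 22176 (by decide +kernel) rfl rfl
      (by norm_num [quickChoose, Nat.factorial]))

lemma I4'_eight_eq {F : k[X]} {μ : k} [CharZero k]
    (h : form 8 F = listForm μ 18 (1 / (222768 : ℤ)) coeffs_eight) :
    I4' 8 F = 1 / 1234784486520 * ((279 * μ ^ 2 + 15028) ^ 2) := by
  have h1 := (congrArg₂ (transvectant 8 8 8) (covJ2_eight_eq h) (covJ2_eight_eq h)).trans
    (transvectant_listForm μ 0 0 8 120 (z := 1 / 1234784486520)
      (D := [[225840784, 0, 8385624, 0, 77841]])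
      (by decide +kernel) rfl rfl (by norm_num [quickChoose, Nat.factorial]))
  refine (congrArg MvPolynomial.constantCoeff h1).trans ?_
  rw [constantCoeff_listForm]
  simp only [evalList]
  push_cast
  ring

lemma I6ast_eight_eq {F : k[X]} {μ : k} [CharZero k]
    (h : form 8 F = listForm μ 18 (1 / (222768 : ℤ)) coeffs_eight) :
    I6ast 8 F = 4 / 67975447566340426203 * (μ ^ 2 * (3675 * μ ^ 2 + 3321188) ^ 2) := by
  have h1 := (congrArg₂ (transvectant 6 6 6) (covFJ3_eight_eq h) (covFJ3_eight_eq h)).trans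
    (transvectant_listForm μ 0 0 6 12 (z := 4 / 67975447566340426203)
      (D := [[0, 0, 11030289731344, 0, 24410731800, 0, 13505625]])
      (by decide +kernel) rfl rfl (by norm_num [quickChoose, Nat.factorial]))
  refine (congrArg MvPolynomial.constantCoeff h1).trans ?_
  rw [constantCoeff_listForm]
  simp only [evalList]
  push_cast
  ring

/-! ### Covariants in genus 12 -/

/-- Coefficients of the binary form in genus `12`, binomial coefficients split off. -/
def coeffs_twelve : List (List ℤ) :=
  [[], [-430100], [], [0, 4301], [], [3400], [], [0, 187], [], [1700], [], [0, -55], [], [], [],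
  [0, 55], [], [-1700], [], [0, -187], [], [-3400], [], [0, -4301], [], [430100], []]

lemma form_twelve [CharZero k] (c : k) :
    form 12 (Polynomial.X * (Polynomial.X ^ 4 - 1) *
      (Polynomial.X ^ 8 + 14 * Polynomial.X ^ 4 + 1) * polyG c) =
      listForm c 26 (1 / (11182600 : ℤ)) coeffs_twelve := by
  have h : Polynomial.X * (Polynomial.X ^ 4 - 1) *
      (Polynomial.X ^ 8 + 14 * Polynomial.X ^ 4 + 1) * polyG c = listPoly c
      [[], [-1], [], [0, 1], [], [20], [], [0, 11], [], [475], [], [0, -38], [], [], [], [0, 38],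
      [], [-475], [], [0, -11], [], [-20], [], [0, -1], [], [1], []] := by
    simp [polyG, listPoly, evalList, map_ofNat]
    ring
  rw [h]
  exact form_listPoly c (by decide +kernel) (by decide) rfl

lemma I2_twelve_eq {F : k[X]} {μ : k} [CharZero k]
    (h : form 12 F = listForm μ 26 (1 / (11182600 : ℤ)) coeffs_twelve) :
    I2 12 F = 192 / 1397825 * (11 * μ ^ 2 + 1700) := by
  have h1 := (congrArg₂ (transvectant 26 26 26) h h).trans
    (transvectant_listForm μ 0 0 26 17176473600 (z := 192 / 1397825)
      (D := [[1700, 0, 11]])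
      (by decide +kernel) rfl rfl (by norm_num [quickChoose, Nat.factorial]))
  refine (congrArg MvPolynomial.constantCoeff h1).trans ?_
  rw [constantCoeff_listForm]
  simp only [evalList]
  push_cast
  ring

/-- Coefficients of the covariant `J_8` in genus `12`, binomial coefficients and a rational
factor split off. -/
def coeffsJ2_twelve : List (List ℤ) :=
  [[2507500, 0, -33055], [], [], [], [501500, 0, -6611], [], [], [], [2507500, 0, -33055]]

lemma covJ2_twelve_eq {F : k[X]} {μ : k} [CharZero k]
    (h : form 12 F = listForm μ 26 (1 / (11182600 : ℤ)) coeffs_twelve) :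
    covJ 12 F 2 = listForm μ 8 (8 / 10448741875) coeffsJ2_twelve :=
  (congrArg₂ (transvectant 26 26 22) h h).trans
    (transvectant_listForm μ 4 4 22 6702080 (by decide +kernel) rfl rfl
      (by norm_num [quickChoose, Nat.factorial]))

/-- Coefficients of the covariant `J_12` in genus `12`, binomial coefficients and a rational
factor split off. -/
def coeffsJ3_twelve : List (List ℤ) :=
  [[0, 1570800], [], [59500, 0, 13321], [], [0, -104720], [], [-8500, 0, -1903], [], [0,
  -104720], [], [59500, 0, 13321], [], [0, 1570800]]

lemma covJ3_twelve_eq {F : k[X]} {μ : k} [CharZero k]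
    (h : form 12 F = listForm μ 26 (1 / (11182600 : ℤ)) coeffs_twelve) :
    covJ 12 F 3 = listForm μ 12 (32 / 160910624875) coeffsJ3_twelve :=
  (congrArg₂ (transvectant 26 26 20) h h).trans
    (transvectant_listForm μ 6 6 20 22978560 (by decide +kernel) rfl rfl
      (by norm_num [quickChoose, Nat.factorial]))

/-- Coefficients of the covariant `(F, J_12)^12` in genus `12`, binomial coefficients and a rational
factor split off. -/
def coeffsFJ3_twelve : List (List ℤ) :=
  [[], [0, -62551500, 0, 230263], [], [], [], [0, -5686500, 0, 20933], [], [], [], [0, 5686500,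
  0, -20933], [], [], [], [0, 62551500, 0, -230263], []]

lemma covFJ3_twelve_eq {F : k[X]} {μ : k} [CharZero k]
    (h : form 12 F = listForm μ 26 (1 / (11182600 : ℤ)) coeffs_twelve) :
    covFJ 12 F 3 = listForm μ 14 (768 / 2921102522284375) coeffsFJ3_twelve :=
  (congrArg₂ (transvectant 26 12 12) h (covJ3_twelve_eq h)).trans
    (transvectant_listForm μ 14 0 12 14784 (by decide +kernel) rfl rfl
      (by norm_num [quickChoose, Nat.factorial]))

lemma I4'_twelve_eq {F : k[X]} {μ : k} [CharZero k]
    (h : form 12 F = listForm μ 26 (1 / (11182600 : ℤ)) coeffs_twelve) :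
    I4' 12 F = 1536 / 21835241354075703125 * ((6611 * μ ^ 2 - 501500) ^ 2) := by
  have h1 := (congrArg₂ (transvectant 8 8 8) (covJ2_twelve_eq h) (covJ2_twelve_eq h)).trans
    (transvectant_listForm μ 0 0 8 120 (z := 1536 / 21835241354075703125)
      (D := [[251502250000, 0, -6630833000, 0, 43705321]])
      (by decide +kernel) rfl rfl (by norm_num [quickChoose, Nat.factorial]))
  refine (congrArg MvPolynomial.constantCoeff h1).trans ?_
  rw [constantCoeff_listForm]
  simp only [evalList]
  push_cast
  ring

lemma I6ast_twelve_eq {F : k[X]} {μ : k} [CharZero k]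
    (h : form 12 F = listForm μ 26 (1 / (11182600 : ℤ)) coeffs_twelve) :
    I6ast 12 F = 396361728 / 775712722336012503951669921875 *
      (μ ^ 2 * (20933 * μ ^ 2 - 5686500) ^ 2) := by
  have h1 := (congrArg₂ (transvectant 14 14 14) (covFJ3_twelve_eq h) (covFJ3_twelve_eq h)).trans
    (transvectant_listForm μ 0 0 14 7392 (z := 396361728 / 775712722336012503951669921875)
      (D := [[0, 0, 32336282250000, 0, -238071009000, 0, 438190489]])
      (by decide +kernel) rfl rfl (by norm_num [quickChoose, Nat.factorial]))
  refine (congrArg MvPolynomial.constantCoeff h1).trans ?_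
  rw [constantCoeff_listForm]
  simp only [evalList]
  push_cast
  ring

/-! ### Covariants in genus 7 -/

/-- Coefficients of the binary form in genus `7`, binomial coefficients split off. -/
def coeffs_seven : List (List ℤ) :=
  [[40040], [], [-2002, 1001], [], [2112, -396], [], [-2970, 45], [], [-1848, -336], [], [8910,
  -135], [], [19008, -3564], [], [54054, -27027], [], [3243240]]

lemma form_seven [CharZero k] (μ : k) :
    form 7 ((3 * Polynomial.X ^ 4 + 6 * Polynomial.X ^ 2 - 1) * polyN μ) =
      listForm μ 16 (1 / (40040 : ℤ)) coeffs_seven := by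
  have h : (3 * Polynomial.X ^ 4 + 6 * Polynomial.X ^ 2 - 1) * polyN μ = listPoly μ
      [[1], [], [-6, 3], [], [96, -18], [], [-594, 9], [], [-594, -108], [], [1782, -27], [],
      [864, -162], [], [162, -81], [], [81]] := by
    simp [polyN, listPoly, evalList, map_ofNat]
    ring
  rw [h]
  exact form_listPoly μ (by decide +kernel) (by decide) rfl

/-- Coefficients of the covariant `J_4` in genus `7`, binomial coefficients and a rational
factor split off. -/
def coeffsJ1_seven : List (List ℤ) :=
  [[6556, 44, -61], [], [6556, 44, -61], [], [-19668, -132, 183]]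

lemma covJ1_seven_eq {F : k[X]} {μ : k} [CharZero k]
    (h : form 7 F = listForm μ 16 (1 / (40040 : ℤ)) coeffs_seven) :
    covJ 7 F 1 = listForm μ 4 (162 / 25025) coeffsJ1_seven :=
  (congrArg₂ (transvectant 16 16 14) h h).trans
    (transvectant_listForm μ 2 2 14 62270208 (by decide +kernel) rfl rfl
      (by norm_num [quickChoose, Nat.factorial]))

/-- Coefficients of the covariant `J_8` in genus `7`, binomial coefficients and a rational
factor split off. -/
def coeffsJ2_seven : List (List ℤ) :=
  [[18172, 3696, 609], [], [-7788, -1584, -261], [], [7788, 1584, 261], [], [23364, 4752, 783],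
  [], [163548, 33264, 5481]]

lemma covJ2_seven_eq {F : k[X]} {μ : k} [CharZero k]
    (h : form 7 F = listForm μ 16 (1 / (40040 : ℤ)) coeffs_seven) :
    covJ 7 F 2 = listForm μ 8 (54 / 455455) coeffsJ2_seven :=
  (congrArg₂ (transvectant 16 16 12) h h).trans
    (transvectant_listForm μ 4 4 12 13305600 (by decide +kernel) rfl rfl
      (by norm_num [quickChoose, Nat.factorial]))

/-- Coefficients of the covariant `J_16` in genus `7`, binomial coefficients and a rational
factor split off. -/
def coeffsJ4_seven : List (List ℤ) :=
  [[7695116, -4883164, 208923], [], [4221932, -405548, -22165], [], [1923900, -321420, -1881],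
  [], [743292, -369468, 14031], [], [932844, 171204, -20589], [], [-2229876, 1108404, -42093],
  [], [17315100, -2892780, -16929], [], [-113992164, 10949796, 598455], [], [623304396,
  -395536284, 16922763]]

lemma covJ4_seven_eq {F : k[X]} {μ : k} [CharZero k]
    (h : form 7 F = listForm μ 16 (1 / (40040 : ℤ)) coeffs_seven) :
    covJ 7 F 4 = listForm μ 16 (3 / 74434360) coeffsJ4_seven :=
  (congrArg₂ (transvectant 16 16 8) h h).trans
    (transvectant_listForm μ 8 8 8 831600 (by decide +kernel) rfl rfl
      (by norm_num [quickChoose, Nat.factorial]))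

/-- Coefficients of the covariant `(F, J_4)^4` in genus `7`, binomial coefficients and a rational
factor split off. -/
def coeffsFJ1_seven : List (List ℤ) :=
  [[-142068520, 5176380, 1363010, -57035], [], [17163608, -5713092, -198814, 54229], [],
  [-28413704, 1035276, 272602, -11407], [], [7355832, -2448468, -85206, 23241], [], [85241112,
  -3105828, -817806, 34221], [], [154472472, -51417828, -1789326, 488061], [], [3835850040,
  -139762260, -36801270, 1539945]]

lemma covFJ1_seven_eq {F : k[X]} {μ : k} [CharZero k]
    (h : form 7 F = listForm μ 16 (1 / (40040 : ℤ)) coeffs_seven) :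
    covFJ 7 F 1 = listForm μ 12 (243 / 250500250) coeffsFJ1_seven :=
  (congrArg₂ (transvectant 16 4 4) h (covJ1_seven_eq h)).trans
    (transvectant_listForm μ 12 0 4 6 (by decide +kernel) rfl rfl
      (by norm_num [quickChoose, Nat.factorial]))

/-- Coefficients of the covariant `(F, J_8)^8` in genus `7`, binomial coefficients and a rational
factor split off. -/
def coeffsFJ2_seven : List (List ℤ) :=
  [[20845880, 5498900, 954690, 42195], [], [], [], [-12507528, -3299340, -572814, -25317], [],
  [], [], [187612920, 49490100, 8592210, 379755]]

lemma covFJ2_seven_eq {F : k[X]} {μ : k} [CharZero k]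
    (h : form 7 F = listForm μ 16 (1 / (40040 : ℤ)) coeffs_seven) :
    covFJ 7 F 2 = listForm μ 8 (324 / 325650325) coeffsFJ2_seven :=
  (congrArg₂ (transvectant 16 8 8) h (covJ2_seven_eq h)).trans
    (transvectant_listForm μ 8 0 8 336 (by decide +kernel) rfl rfl
      (by norm_num [quickChoose, Nat.factorial]))

lemma I3_seven_eq {F : k[X]} {μ : k} [CharZero k]
    (h : form 7 F = listForm μ 16 (1 / (40040 : ℤ)) coeffs_seven) :
    I3 7 F = 1944 / 9304295 * (1093 * μ ^ 3 + 49566 * μ ^ 2 - 838068 * μ + 1549768) := by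
  have h1 := (congrArg₂ (transvectant 16 16 16) h (covJ4_seven_eq h)).trans
    (transvectant_listForm μ 0 0 16 207567360 (z := 1944 / 9304295)
      (D := [[1549768, -838068, 49566, 1093]])
      (by decide +kernel) rfl rfl (by norm_num [quickChoose, Nat.factorial]))
  refine (congrArg MvPolynomial.constantCoeff h1).trans ?_
  rw [constantCoeff_listForm]
  simp only [evalList]
  push_cast
  ring

lemma I6'_seven_eq {F : k[X]} {μ : k} [CharZero k]
    (h : form 7 F = listForm μ 16 (1 / (40040 : ℤ)) coeffs_seven) :
    I6' 7 F = 22674816 / 21209626834521125 *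
      ((97 * μ + 1606) ^ 2 * (87 * μ ^ 2 + 528 * μ + 2596) ^ 2) := by
  have h1 := (congrArg₂ (transvectant 8 8 8) (covFJ2_seven_eq h) (covFJ2_seven_eq h)).trans
    (transvectant_listForm μ 0 0 8 1080 (z := 22674816 / 21209626834521125)
      (D := [[17382028518976, 9170352762560, 2801624302576, 490346939808, 55019406684, 3222651564,
      71216721]])
      (by decide +kernel) rfl rfl (by norm_num [quickChoose, Nat.factorial]))
  refine (congrArg MvPolynomial.constantCoeff h1).trans ?_
  rw [constantCoeff_listForm]
  simp only [evalList]
  push_cast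
  ring

lemma I6_seven_eq {F : k[X]} {μ : k} [CharZero k]
    (h : form 7 F = listForm μ 16 (1 / (40040 : ℤ)) coeffs_seven) :
    I6 7 F = 612220032 / 1426144892046875 *
      ((61 * μ ^ 2 - 44 * μ - 6556) ^ 2 * (2021 * μ ^ 2 + 1496 * μ - 157476)) := by
  have h1 := (congrArg₂ (transvectant 12 12 12) (covFJ1_seven_eq h) (covFJ1_seven_eq h)).trans
    (transvectant_listForm μ 0 0 12 456192 (z := 612220032 / 1426144892046875)
      (D := [[-6768497372736, -26552534272, 213377430640, 817650240, -2206546540, -5282112,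
        7520141]])
      (by decide +kernel) rfl rfl (by norm_num [quickChoose, Nat.factorial]))
  refine (congrArg MvPolynomial.constantCoeff h1).trans ?_
  rw [constantCoeff_listForm]
  simp only [evalList]
  push_cast
  ring

/-! ### Covariants in genus 10 -/

/-- Coefficients of the binary form in genus `10`, binomial coefficients split off. -/
def coeffs_ten : List (List ℤ) :=
  [[], [45220], [], [-3876, 1938], [], [3740, -680], [], [-3570, 105], [], [-612, -324], [], [],
  [], [-1836, -972], [], [32130, -945], [], [100980, -18360], [], [313956, -156978], [],
  [10988460], []]

lemma form_ten [CharZero k] (μ : k) :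
    form 10 (Polynomial.X * (3 * Polynomial.X ^ 4 + 1) *
      (3 * Polynomial.X ^ 4 + 6 * Polynomial.X ^ 2 - 1) * polyN μ) =
      listForm μ 22 (1 / (994840 : ℤ)) coeffs_ten := by
  have h : Polynomial.X * (3 * Polynomial.X ^ 4 + 1) *
      (3 * Polynomial.X ^ 4 + 6 * Polynomial.X ^ 2 - 1) * polyN μ = listPoly μ
      [[], [1], [], [-6, 3], [], [99, -18], [], [-612, 18], [], [-306, -162], [], [], [], [-918,
      -486], [], [5508, -162], [], [2673, -486], [], [486, -243], [], [243], []] := by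
    simp [polyN, listPoly, evalList, map_ofNat]
    ring
  rw [h]
  exact form_listPoly μ (by decide +kernel) (by decide) rfl

/-- Coefficients of the covariant `J_4` in genus `10`, binomial coefficients and a rational
factor split off. -/
def coeffsJ1_ten : List (List ℤ) :=
  [[-6596, -68, 115], [], [-6596, -68, 115], [], [19788, 204, -345]]

lemma covJ1_ten_eq {F : k[X]} {μ : k} [CharZero k]
    (h : form 10 F = listForm μ 22 (1 / (994840 : ℤ)) coeffs_ten) :
    covJ 10 F 1 = listForm μ 4 (1296 / 1915067) coeffsJ1_ten :=
  (congrArg₂ (transvectant 22 22 20) h h).trans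
    (transvectant_listForm μ 2 2 20 4018636800 (by decide +kernel) rfl rfl
      (by norm_num [quickChoose, Nat.factorial]))

/-- Coefficients of the covariant `J_8` in genus `10`, binomial coefficients and a rational
factor split off. -/
def coeffsJ2_ten : List (List ℤ) :=
  [[274652, -111384, -26691], [], [-117708, 47736, 11439], [], [117708, -47736, -11439], [],
  [353124, -143208, -34317], [], [2471868, -1002456, -240219]]

lemma covJ2_ten_eq {F : k[X]} {μ : k} [CharZero k]
    (h : form 10 F = listForm μ 22 (1 / (994840 : ℤ)) coeffs_ten) :
    covJ 10 F 2 = listForm μ 8 (648 / 1273519555) coeffsJ2_ten :=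
  (congrArg₂ (transvectant 22 22 18) h h).trans
    (transvectant_listForm μ 4 4 18 35251200 (by decide +kernel) rfl rfl
      (by norm_num [quickChoose, Nat.factorial]))

/-- Coefficients of the covariant `J_12` in genus `10`, binomial coefficients and a rational
factor split off. -/
def coeffsJ3_ten : List (List ℤ) :=
  [[-3166284, -723316, 87549], [], [-287844, -65756, 7959], [], [287844, 65756, -7959], [],
  [863532, 197268, -23877], [], [-863532, -197268, 23877], [], [-2590596, -591804, 71631], [],
  [85489668, 19529532, -2363823]]

lemma covJ3_ten_eq {F : k[X]} {μ : k} [CharZero k]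
    (h : form 10 F = listForm μ 22 (1 / (994840 : ℤ)) coeffs_ten) :
    covJ 10 F 3 = listForm μ 12 (162 / 4860166465) coeffsJ3_ten :=
  (congrArg₂ (transvectant 22 22 16) h h).trans
    (transvectant_listForm μ 6 6 16 30481920 (by decide +kernel) rfl rfl
      (by norm_num [quickChoose, Nat.factorial]))

/-- Coefficients of the covariant `J_16` in genus `10`, binomial coefficients and a rational
factor split off. -/
def coeffsJ4_ten : List (List ℤ) :=
  [[-9150624340, 1983063940, -261031485], [], [-2000061492, 268411572, 35960067], [],
  [-1092902052, 171560532, 5620527], [], [-748099620, 154704420, -17158905], [], [-95435892,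
  -34712028, 28499067], [], [2244298860, -464113260, 51476715], [], [-9836118468, 1544044788,
  50584743], [], [54001660284, -7247112444, -970921809], [], [-741200571540, 160628179140,
  -21143550285]]

lemma covJ4_ten_eq {F : k[X]} {μ : k} [CharZero k]
    (h : form 10 F = listForm μ 22 (1 / (994840 : ℤ)) coeffs_ten) :
    covJ 10 F 4 = listForm μ 16 (9 / 2527286561800) coeffsJ4_ten :=
  (congrArg₂ (transvectant 22 22 14) h h).trans
    (transvectant_listForm μ 8 8 14 45360 (by decide +kernel) rfl rfl
      (by norm_num [quickChoose, Nat.factorial]))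

/-- Coefficients of the covariant `(F, J_4)^4` in genus `10`, binomial coefficients and a rational
factor split off. -/
def coeffsFJ1_ten : List (List ℤ) :=
  [[], [1023540896, -61661040, -18589704, 1259020], [], [-201164808, 62494380, 4172922,
  -1125735], [], [219330192, -13213080, -3983508, 269790], [], [-46422648, 14421780, 962982,
  -259785], [], [], [], [-139267944, 43265340, 2888946, -779355], [], [-1973971728, 118917720,
  35851572, -2428110], [], [-5431449816, 1687348260, 112668894, -30394845], [], [-82906812576,
  4994544240, 1505766024, -101980620], []]

lemma covFJ1_ten_eq {F : k[X]} {μ : k} [CharZero k]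
    (h : form 10 F = listForm μ 22 (1 / (994840 : ℤ)) coeffs_ten) :
    covFJ 10 F 1 = listForm μ 18 (162 / 238148156785) coeffsFJ1_ten :=
  (congrArg₂ (transvectant 22 4 4) h (covJ1_ten_eq h)).trans
    (transvectant_listForm μ 18 0 4 1 (by decide +kernel) rfl rfl
      (by norm_num [quickChoose, Nat.factorial]))

/-- Coefficients of the covariant `(F, J_8)^8` in genus `10`, binomial coefficients and a rational
factor split off. -/
def coeffsFJ2_ten : List (List ℤ) :=
  [[], [689690408, -201582260, -98705706, -7591683], [], [], [], [-188097384, 54976980, 26919738,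
  2070459], [], [], [], [-564292152, 164930940, 80759214, 6211377], [], [], [], [18621641016,
  -5442721020, -2665054062, -204975441], []]

lemma covFJ2_ten_eq {F : k[X]} {μ : k} [CharZero k]
    (h : form 10 F = listForm μ 22 (1 / (994840 : ℤ)) coeffs_ten) :
    covFJ 10 F 2 = listForm μ 14 (1944 / 22624074894575) coeffsFJ2_ten :=
  (congrArg₂ (transvectant 22 8 8) h (covJ2_ten_eq h)).trans
    (transvectant_listForm μ 14 0 8 168 (by decide +kernel) rfl rfl
      (by norm_num [quickChoose, Nat.factorial]))

/-- Coefficients of the covariant `(F, J_16)^16` in genus `10`, binomial coefficients and a rational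
factor split off. -/
def coeffsFJ4_ten : List (List ℤ) :=
  [[], [-13083554824, 4363415636, -402998158, -25170477], [], [], [], [-39250664472, 13090246908,
  -1208994474, -75511431], []]

lemma covFJ4_ten_eq {F : k[X]} {μ : k} [CharZero k]
    (h : form 10 F = listForm μ 22 (1 / (994840 : ℤ)) coeffs_ten) :
    covFJ 10 F 4 = listForm μ 6 (2916 / 54944181886825) coeffsFJ4_ten :=
  (congrArg₂ (transvectant 22 16 16) h (covJ4_ten_eq h)).trans
    (transvectant_listForm μ 6 0 16 14826240 (by decide +kernel) rfl rfl
      (by norm_num [quickChoose, Nat.factorial]))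

/-- Coefficients of the covariant `((F, J_4)^4, (F, J_8)^8)^12` in genus `10`, binomial
coefficients and a rational factor split off. -/
def coeffsM_ten : List (List ℤ) :=
  [[-1617033082806080, 974977052086400, 118139630711280, -72948346443520, -7685320849340,
  925838775480, 99606331725], [], [], [], [970219849683648, -584986231251840, -70883778426768,
  43769007866112, 4611192509604, -555503265288, -59763799035], [], [], [], [-14553297745254720,
  8774793468777600, 1063256676401520, -656535117991680, -69167887644060, 8332548979320,
  896456985525]]

lemma covM_ten_eq {F : k[X]} {μ : k} [CharZero k]
    (h : form 10 F = listForm μ 22 (1 / (994840 : ℤ)) coeffs_ten) :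
    covM 10 F = listForm μ 8 (544195584 / 489807430464439040540125) coeffsM_ten :=
  (congrArg₂ (transvectant 18 14 12) (covFJ1_ten_eq h) (covFJ2_ten_eq h)).trans
    (transvectant_listForm μ 6 2 12 532224 (by decide +kernel) rfl rfl
      (by norm_num [quickChoose, Nat.factorial]))

/-- Coefficients of the covariant `S = (J_12, J_16)^12` in genus `10`, binomial coefficients and a
rational factor split off. -/
def coeffsS_ten : List (List ℤ) :=
  [[-5218481614512, 322384221104, 125206813152, -125273642124, 10094216643], [], [5218481614512,
  -322384221104, -125206813152, 125273642124, -10094216643], [], [15655444843536, -967152663312,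
  -375620439456, 375820926372, -30282649929]]

lemma covS_ten_eq {F : k[X]} {μ : k} [CharZero k]
    (h : form 10 F = listForm μ 22 (1 / (994840 : ℤ)) coeffs_ten) :
    covS 10 F = listForm μ 4 (1889568 / 139579924944380795875) coeffsS_ten :=
  (congrArg₂ (transvectant 12 16 12) (covJ3_ten_eq h) (covJ4_ten_eq h)).trans
    (transvectant_listForm μ 0 4 12 114048 (by decide +kernel) rfl rfl
      (by norm_num [quickChoose, Nat.factorial]))

/-- Coefficients of the covariant `(J_16, S)^4` in genus `10`, binomial coefficients and a rational
factor split off. -/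
def coeffsJS_ten : List (List ℤ) :=
  [[-5560486392148228136640, 1414475380434878981120, -15803036992723662000,
  -154048423656857611200, 38457766390304101500, -4065366562672528080, 160653546031085415], [],
  [-1711878995773320325056, 349269134100055803648, 49043231341736506000, -48359313390710710080,
  8604885579327036300, 81431076088601568, -44516131331278509], [], [-1112097278429645627328,
  282895076086975796224, -3160607398544732400, -30809684731371522240, 7691553278060820300,
  -813073312534505616, 32130709206217083], [], [-733662426759994425024, 149686771757166772992,
  21018527717887074000, -20725420024590304320, 3687808105425872700, 34899032609400672,
  -19078341999119361], [], [3336291835288936881984, -848685228260927388672, 9481822195634197200,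
  92429054194114566720, -23074659834182460900, 2439219937603516848, -96392127618651249], [],
  [-15406910961959882925504, 3143422206900502232832, 441389082075628554000,
  -435233820516396390720, 77443970213943326700, 732879684797414112, -400645181981506581], [],
  [150133132588002159689280, -38190835271741732490240, 426681998803538874000,
  4159307438735155502400, -1038359692538210740500, 109764897192158258160, -4337645742839306205]]

lemma covJS_ten_eq {F : k[X]} {μ : k} [CharZero k]
    (h : form 10 F = listForm μ 22 (1 / (994840 : ℤ)) coeffs_ten) :
    covJS 10 F = listForm μ 12 (76527504 / 44094808576123274729609546571875) coeffsJS_ten :=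
  (congrArg₂ (transvectant 16 4 4) (covJ4_ten_eq h) (covS_ten_eq h)).trans
    (transvectant_listForm μ 12 0 4 36 (by decide +kernel) rfl rfl
      (by norm_num [quickChoose, Nat.factorial]))

lemma I6'_ten_eq {F : k[X]} {μ : k} [CharZero k]
    (h : form 10 F = listForm μ 22 (1 / (994840 : ℤ)) coeffs_ten) :
    I6' 10 F = -(9795520512 / 6647386556303101264473125) *
      ((181 * μ + 1598) ^ 2 * (3813 * μ ^ 2 + 15912 * μ - 39236) ^ 2) := by
  have h1 := (congrArg₂ (transvectant 14 14 14) (covFJ2_ten_eq h) (covFJ2_ten_eq h)).trans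
    (transvectant_listForm μ 0 0 14 199584 (z := 9795520512 / 6647386556303101264473125)
      (D := [[-3931180651960384, 2298005804048960, 789399584623376, -242337328011552,
        -105814162228476, -12385825293276, -476311163409]])
      (by decide +kernel) rfl rfl (by norm_num [quickChoose, Nat.factorial]))
  refine (congrArg MvPolynomial.constantCoeff h1).trans ?_
  rw [constantCoeff_listForm]
  simp only [evalList]
  push_cast
  ring

lemma I6_ten_eq {F : k[X]} {μ : k} [CharZero k]
    (h : form 10 F = listForm μ 22 (1 / (994840 : ℤ)) coeffs_ten) :
    I6 10 F = -(156728328192 / 667229936236387547485) *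
      ((7877 * μ ^ 2 + 3128 * μ - 374884) * (115 * μ ^ 2 - 68 * μ - 6596) ^ 2) := by
  have h1 := (congrArg₂ (transvectant 18 18 18) (covFJ1_ten_eq h) (covFJ1_ten_eq h)).trans
    (transvectant_listForm μ 0 0 18 507617280 (z := 156728328192 / 667229936236387547485)
      (D := [[16310159162944, 200201369856, -912507886704, -8198333504, 16920378732, 81828480,
      -104173325]])
      (by decide +kernel) rfl rfl (by norm_num [quickChoose, Nat.factorial]))
  refine (congrArg MvPolynomial.constantCoeff h1).trans ?_
  rw [constantCoeff_listForm]
  simp only [evalList]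
  push_cast
  ring

lemma I6star_ten_eq {F : k[X]} {μ : k} [CharZero k]
    (h : form 10 F = listForm μ 22 (1 / (994840 : ℤ)) coeffs_ten) :
    I6star 10 F = -(306110016 / 3018863123212508417108580625) *
      ((25170477 * μ ^ 3 + 402998158 * μ ^ 2 - 4363415636 * μ + 13083554824) ^ 2) := by
  have h1 := (congrArg₂ (transvectant 6 6 6) (covFJ4_ten_eq h) (covFJ4_ten_eq h)).trans
    (transvectant_listForm μ 0 0 6 36 (z := 306110016 / 3018863123212508417108580625)
      (D := [[-171179406832613670976, 114177975387009656128, -29584693000817312880,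
      2858258296241334880, 57250990463363780, -20287311733962732, -633552912407529]])
      (by decide +kernel) rfl rfl (by norm_num [quickChoose, Nat.factorial]))
  refine (congrArg MvPolynomial.constantCoeff h1).trans ?_
  rw [constantCoeff_listForm]
  simp only [evalList]
  push_cast
  ring

lemma I12_ten_eq {F : k[X]} {μ : k} [CharZero k]
    (h : form 10 F = listForm μ 22 (1 / (994840 : ℤ)) coeffs_ten) :
    I12 10 F = 63968148067341828096 / 47982263787635257178590499727066374650347003125 *
      ((251 * μ - 782) ^ 2 * (115 * μ ^ 2 - 68 * μ - 6596) ^ 2 *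
      ((181 * μ + 1598) ^ 2 * (3813 * μ ^ 2 + 15912 * μ - 39236) ^ 2)) := by
  have h1 := (congrArg₂ (transvectant 8 8 8) (covM_ten_eq h) (covM_ten_eq h)).trans
    (transvectant_listForm μ 0 0 8 1080
      (z := 63968148067341828096 / 47982263787635257178590499727066374650347003125)
      (D := [[104591839635573391125075398656, -126125611856036433954448424960,
      22740354783752834016625911808, 18651465473650463141587775488,
      -4137364762593571492822761728, -1408657128412756813800704000, 199551558700133689215281920,
      61369886924402650649898496, -2099109937553005352985104, -1150518819117386901028416,
      -26953431907301269015704, 7377552335546294088240, 396856852788429659025]])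
      (by decide +kernel) rfl rfl (by norm_num [quickChoose, Nat.factorial]))
  refine (congrArg MvPolynomial.constantCoeff h1).trans ?_
  rw [constantCoeff_listForm]
  simp only [evalList]
  push_cast
  ring

lemma I12ast_ten_eq {F : k[X]} {μ : k} [CharZero k]
    (h : form 10 F = listForm μ 22 (1 / (994840 : ℤ)) coeffs_ten) :
    I12ast 10 F = -(40479843698864750592 /
      176759285760450427180436129752448237056208462392457687685546875) *
      ((1268277 * μ ^ 2 - 5261568 * μ + 18129548) ^ 2 *
      (7959 * μ ^ 2 - 65756 * μ - 287844) ^ 2 *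
      (228384659961 * μ ^ 4 - 22196181318948 * μ ^ 3 + 185588379432544 * μ ^ 2
        - 447275488903152 * μ + 658755318269936)):= by
  have h1 := (congrArg₂ (transvectant 12 12 12) (covJS_ten_eq h) (covJS_ten_eq h)).trans
    (transvectant_listForm μ 0 0 12 76032
      (z := 40479843698864750592 /
        176759285760450427180436129752448237056208462392457687685546875)
      (D := [[-17939587380362464109852120052468474998784, 14396974373362137225100392208027693830144,
      -5766616142620631227669552324204331134976, -223581953679967447270345719924058506240,
      875525647697517896425482924307574232320, -343424724906697994088883145237045239296,
      39597486373761485299448094146202479616, 10329651450559018858063712543311084416,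
      -5092872303996928140489762884304515280, 925061367962821295042863626382615440,
      -79207528031096512181578271941327056, 2839242904674293331498114459380556,
      -23270846035011225843328542951489]])
      (by decide +kernel) rfl rfl (by norm_num [quickChoose, Nat.factorial]))
  refine (congrArg MvPolynomial.constantCoeff h1).trans ?_
  rw [constantCoeff_listForm]
  simp only [evalList]
  push_cast
  ring

/-! ### The absolute invariants of the normal forms -/

lemma invariantPoint_five [CharZero k] {F : k[X]} {μ : k}
    (h : form 5 F = listForm μ 12 (1 / (2310 : ℤ)) coeffs_five) :
    invariantPoint 5 F = paramPoint 5 (μ ^ 2) := by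
  have h2 := I2_five_eq h
  by_cases h0 : 5 * μ ^ 2 + 924 = 0
  · have h2' : I2 5 F = 0 := by rw [h2, h0, mul_zero]
    have hμ : μ ^ 2 = -924 / 5 := by linear_combination h0 / 5
    rw [invariantPoint, if_pos (by decide), if_neg (not_not.2 h2'),
      paramPoint, if_pos rfl, if_neg (not_not.2 h0)]
    rw [I4'_five_eq h, I3_five_eq h]
    simp only [mul_pow, ← pow_mul]
    rw [show μ ^ 4 = (μ ^ 2) ^ 2 by ring, hμ]
    norm_num
  · have h2' : I2 5 F ≠ 0 := by
      rw [h2]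
      exact mul_ne_zero (by norm_num) h0
    rw [invariantPoint, if_pos (by decide), if_pos h2',
      paramPoint, if_pos rfl, if_pos h0]
    rw [h2, I4'_five_eq h, I3_five_eq h]
    refine congrArg Sum.inl (Prod.ext ?_ ?_) <;> field_simp <;> ring

lemma invariantPoint_eight [CharZero k] {F : k[X]} {μ : k}
    (h : form 8 F = listForm μ 18 (1 / (222768 : ℤ)) coeffs_eight) :
    invariantPoint 8 F = paramPoint 8 (μ ^ 2) := by
  have h2 := I2_eight_eq h
  by_cases h0 : 7 * μ ^ 2 + 884 = 0
  · have h2' : I2 8 F = 0 := by rw [h2, h0, mul_zero]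
    have hμ : μ ^ 2 = -884 / 7 := by linear_combination h0 / 7
    rw [invariantPoint, if_neg (by decide), if_pos (by decide), if_neg (not_not.2 h2'),
      paramPoint, if_neg (by decide), if_neg (by decide), if_pos rfl, if_neg (not_not.2 h0)]
    rw [I4'_eight_eq h, I6ast_eight_eq h]
    simp only [mul_pow, ← pow_mul]
    rw [show μ ^ (2 * 2) = (μ ^ 2) ^ 2 by ring, hμ]
    norm_num
  · have h2' : I2 8 F ≠ 0 := by
      rw [h2]
      exact mul_ne_zero (by norm_num) h0
    rw [invariantPoint, if_neg (by decide), if_pos (by decide), if_pos h2',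
      paramPoint, if_neg (by decide), if_neg (by decide), if_pos rfl, if_pos h0]
    rw [h2, I4'_eight_eq h, I6ast_eight_eq h]
    refine congrArg Sum.inl (Prod.ext ?_ ?_) <;> field_simp <;> ring

lemma invariantPoint_nine [CharZero k] {F : k[X]} {μ : k}
    (h : form 9 F = listForm μ 20 (1 / (106590 : ℤ)) coeffs_nine) :
    invariantPoint 9 F = paramPoint 9 (μ ^ 2) := by
  have h2 := I2_nine_eq h
  by_cases h0 : 3 * μ ^ 2 + 836 = 0
  · have h2' : I2 9 F = 0 := by rw [h2, h0, mul_zero]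
    have hμ : μ ^ 2 = -836 / 3 := by linear_combination h0 / 3
    rw [invariantPoint, if_pos (by decide), if_neg (not_not.2 h2'),
      paramPoint, if_neg (by decide), if_neg (by decide), if_neg (by decide), if_pos rfl, if_neg
      (not_not.2 h0)]
    rw [I4'_nine_eq h, I3_nine_eq h]
    simp only [mul_pow, ← pow_mul]
    rw [show μ ^ 4 = (μ ^ 2) ^ 2 by ring, hμ]
    norm_num
  · have h2' : I2 9 F ≠ 0 := by
      rw [h2]
      exact mul_ne_zero (by norm_num) h0
    rw [invariantPoint, if_pos (by decide), if_pos h2',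
      paramPoint, if_neg (by decide), if_neg (by decide), if_neg (by decide), if_pos rfl, if_pos
      h0]
    rw [h2, I4'_nine_eq h, I3_nine_eq h]
    refine congrArg Sum.inl (Prod.ext ?_ ?_) <;> field_simp <;> ring

lemma invariantPoint_twelve [CharZero k] {F : k[X]} {μ : k}
    (h : form 12 F = listForm μ 26 (1 / (11182600 : ℤ)) coeffs_twelve) :
    invariantPoint 12 F = paramPoint 12 (μ ^ 2) := by
  have h2 := I2_twelve_eq h
  by_cases h0 : 11 * μ ^ 2 + 1700 = 0
  · have h2' : I2 12 F = 0 := by rw [h2, h0, mul_zero]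
    have hμ : μ ^ 2 = -1700 / 11 := by linear_combination h0 / 11
    rw [invariantPoint, if_neg (by decide), if_pos (by decide), if_neg (not_not.2 h2'),
      paramPoint, if_neg (by decide), if_neg (by decide), if_neg (by decide), if_neg (by decide),
      if_neg (by decide), if_neg (not_not.2 h0)]
    rw [I4'_twelve_eq h, I6ast_twelve_eq h]
    simp only [mul_pow, ← pow_mul]
    rw [show μ ^ (2 * 2) = (μ ^ 2) ^ 2 by ring, hμ]
    norm_num
  · have h2' : I2 12 F ≠ 0 := by
      rw [h2]
      exact mul_ne_zero (by norm_num) h0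
    rw [invariantPoint, if_neg (by decide), if_pos (by decide), if_pos h2',
      paramPoint, if_neg (by decide), if_neg (by decide), if_neg (by decide), if_neg (by decide),
      if_neg (by decide), if_pos h0]
    rw [h2, I4'_twelve_eq h, I6ast_twelve_eq h]
    refine congrArg Sum.inl (Prod.ext ?_ ?_) <;> field_simp <;> ring

lemma invariantPoint_seven [CharZero k] {F : k[X]} {μ : k}
    (h : form 7 F = listForm μ 16 (1 / (40040 : ℤ)) coeffs_seven) :
    invariantPoint 7 F = paramPoint 7 μ := by
  have h3 := I3_seven_eq h
  by_cases h0 : 1093 * μ ^ 3 + 49566 * μ ^ 2 - 838068 * μ + 1549768 = 0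
  · have h3' : I3 7 F = 0 := by rw [h3, h0, mul_zero]
    rw [invariantPoint, if_neg (by decide), if_neg (by decide), if_pos rfl, if_neg (not_not.2 h3'),
      paramPoint, if_neg (by decide), if_pos rfl, if_neg (not_not.2 h0)]
    rw [I6_seven_eq h, I6'_seven_eq h, mul_div_mul_comm, mul_div_assoc (50193 / 125)]
    norm_num
  · have h3' : I3 7 F ≠ 0 := by
      rw [h3]
      exact mul_ne_zero (by norm_num) h0
    rw [invariantPoint, if_neg (by decide), if_neg (by decide), if_pos rfl, if_pos h3',
      paramPoint, if_neg (by decide), if_pos rfl, if_pos h0]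
    rw [h3, I6_seven_eq h, I6'_seven_eq h]
    refine congrArg Sum.inl (Prod.ext ?_ ?_) <;> field_simp <;> ring

lemma invariantPoint_ten [CharZero k] {F : k[X]} {μ : k}
    (h : form 10 F = listForm μ 22 (1 / (994840 : ℤ)) coeffs_ten) :
    invariantPoint 10 F = paramPoint 10 μ := by
  have h12 := I12_ten_eq h
  by_cases h0 : (251 * μ - 782) * (115 * μ ^ 2 - 68 * μ - 6596) *
        ((181 * μ + 1598) * (3813 * μ ^ 2 + 15912 * μ - 39236)) = 0
  · have h12' : I12 10 F = 0 := by
      rw [h12]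
      simp only [mul_eq_zero] at h0
      rcases h0 with (h0 | h0) | h0 | h0 <;> rw [h0] <;> ring
    rw [invariantPoint, if_neg (by decide), if_neg (by decide), if_neg (by decide),
      if_neg (not_not.2 h12'),
      paramPoint, if_neg (by decide), if_neg (by decide), if_neg (by decide), if_neg (by decide),
      if_pos rfl, if_neg (not_not.2 h0)]
    rw [I6star_ten_eq h, I12ast_ten_eq h, mul_pow, neg_mul, div_neg, mul_div_mul_comm, ← pow_mul,
      mul_div_assoc]
    norm_num
  · have h12' : I12 10 F ≠ 0 := by
      rw [h12]
      simp only [mul_eq_zero, not_or] at h0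
      obtain ⟨⟨ha, hb⟩, hc, hd⟩ := h0
      exact mul_ne_zero (by norm_num) (mul_ne_zero (mul_ne_zero (pow_ne_zero 2 ha)
        (pow_ne_zero 2 hb)) (mul_ne_zero (pow_ne_zero 2 hc) (pow_ne_zero 2 hd)))
    rw [invariantPoint, if_neg (by decide), if_neg (by decide), if_neg (by decide), if_pos h12',
      paramPoint, if_neg (by decide), if_neg (by decide), if_neg (by decide), if_neg (by decide),
      if_pos rfl, if_pos h0]
    simp only [mul_eq_zero, not_or] at h0
    obtain ⟨⟨ha, hb⟩, hc, hd⟩ := h0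
    rw [h12, I6_ten_eq h, I6'_ten_eq h]
    refine congrArg Sum.inl (Prod.ext ?_ ?_) <;> field_simp <;> ring

/-! ### Function fields of double covers of the line -/

section FunctionFieldBasics

variable (F : k[X])

/-- The inclusion of `k(X)` into the function field. -/
def ratHom : RatFunc k →ₐ[k] FunctionField F :=
  IsScalarTower.toAlgHom k (RatFunc k) (FunctionField F)

/-- The function `X` of the curve. -/
def xGen : FunctionField F := ratHom F RatFunc.X

/-- The function `Y` of the curve. -/
def yGen : FunctionField F := AdjoinRoot.root _

lemma ratHom_apply (p : RatFunc k) : ratHom F p = AdjoinRoot.of _ p := rfl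

lemma yGen_sq : yGen F ^ 2 = ratHom F (algebraMap k[X] (RatFunc k) F) := by
  have h := AdjoinRoot.eval₂_root
    (Polynomial.X ^ 2 - Polynomial.C (algebraMap k[X] (RatFunc k) F) : (RatFunc k)[X])
  rw [Polynomial.eval₂_sub, Polynomial.eval₂_pow, Polynomial.eval₂_X, Polynomial.eval₂_C,
    sub_eq_zero] at h
  exact h

lemma ratHom_algebraMap (f : k[X]) :
    ratHom F (algebraMap k[X] (RatFunc k) f) = Polynomial.aeval (xGen F) f := by
  have h : (ratHom F).comp (IsScalarTower.toAlgHom k k[X] (RatFunc k)) =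
      Polynomial.aeval (xGen F) := by
    apply Polynomial.algHom_ext
    simp [xGen]
  exact DFunLike.congr_fun h f

lemma exists_eq_ratHom_add (z : FunctionField F) :
    ∃ p q : RatFunc k, z = ratHom F p + ratHom F q * yGen F := by
  obtain ⟨f, rfl⟩ := AdjoinRoot.mk_surjective z
  have hm : (Polynomial.X ^ 2 - Polynomial.C (algebraMap k[X] (RatFunc k) F) :
      (RatFunc k)[X]).Monic := Polynomial.monic_X_pow_sub_C _ two_ne_zero
  have hd : (Polynomial.X ^ 2 - Polynomial.C (algebraMap k[X] (RatFunc k) F) :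
      (RatFunc k)[X]).natDegree = 2 := Polynomial.natDegree_X_pow_sub_C
  have hlt := Polynomial.natDegree_modByMonic_lt f hm (by intro h; rw [h] at hd; simp at hd)
  rw [hd] at hlt
  obtain ⟨a, b, hab⟩ := Polynomial.exists_eq_X_add_C_of_natDegree_le_one (Nat.lt_succ_iff.1 hlt)
  refine ⟨b, a, ?_⟩
  conv_lhs => rw [← Polynomial.modByMonic_add_div f _, hab]
  simp only [map_add, map_mul, AdjoinRoot.mk_self, zero_mul, add_zero, AdjoinRoot.mk_X,
    AdjoinRoot.mk_C, ratHom_apply, yGen]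
  ring

lemma eq_zero_of_ratHom_add_eq_zero {p q : RatFunc k}
    (h : ratHom F p + ratHom F q * yGen F = 0) : p = 0 ∧ q = 0 := by
  have h1 : AdjoinRoot.mk (Polynomial.X ^ 2 - Polynomial.C (algebraMap k[X] (RatFunc k) F))
      (Polynomial.C p + Polynomial.C q * Polynomial.X) = 0 := by
    rw [map_add, map_mul, AdjoinRoot.mk_X, AdjoinRoot.mk_C, AdjoinRoot.mk_C]
    exact h
  rw [AdjoinRoot.mk_eq_zero] at h1
  have h2 := Polynomial.eq_zero_of_dvd_of_natDegree_lt h1 (by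
    rw [Polynomial.natDegree_X_pow_sub_C, add_comm]
    exact Nat.lt_succ_iff.2 Polynomial.natDegree_linear_le)
  constructor
  · simpa using congrArg (fun f => Polynomial.coeff f 0) h2
  · simpa using congrArg (fun f => Polynomial.coeff f 1) h2

lemma ratHom_injective : Function.Injective (ratHom F) := by
  rw [injective_iff_map_eq_zero]
  intro p hp
  exact (eq_zero_of_ratHom_add_eq_zero F (p := p) (q := 0) (by rw [hp]; simp)).1

lemma aeval_xGen_ne_zero {f : k[X]} (hf : f ≠ 0) : Polynomial.aeval (xGen F) f ≠ 0 := by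
  rw [← ratHom_algebraMap, Ne, map_eq_zero_iff _ (ratHom_injective F)]
  simpa using hf

/-- A homomorphism from the function field is determined by the images of `X` and `Y`. -/
lemma algHom_ext_gens {B : Type*} [CommRing B] [Algebra k B] {φ ψ : FunctionField F →ₐ[k] B}
    (hx : φ (xGen F) = ψ (xGen F)) (hy : φ (yGen F) = ψ (yGen F)) : φ = ψ := by
  have h1 : ∀ p : RatFunc k, φ (ratHom F p) = ψ (ratHom F p) := by
    have : (φ.comp (ratHom F)).toRingHom = (ψ.comp (ratHom F)).toRingHom := by
      apply IsLocalization.ringHom_ext (nonZeroDivisors k[X])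
      have : ((φ.comp (ratHom F)).comp (IsScalarTower.toAlgHom k k[X] (RatFunc k))) =
          ((ψ.comp (ratHom F)).comp (IsScalarTower.toAlgHom k k[X] (RatFunc k))) := by
        apply Polynomial.algHom_ext
        simpa [xGen] using hx
      exact congrArg AlgHom.toRingHom this
    exact fun p => DFunLike.congr_fun this p
  apply AlgHom.ext
  intro z
  obtain ⟨p, q, rfl⟩ := exists_eq_ratHom_add F z
  simp [h1, hy]

/-- Comparing polynomials up to squares of rational functions: a squarefree polynomial divides
every polynomial in its class, with a square as quotient. -/
lemma exists_eq_mul_sq_of_ratFunc {F G : k[X]} (hF : Squarefree F) {w : RatFunc k}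
    (h : algebraMap k[X] (RatFunc k) G = w ^ 2 * algebraMap k[X] (RatFunc k) F) :
    ∃ T : k[X], G = F * T ^ 2 := by
  have hF0 : F ≠ 0 := hF.ne_zero
  have h1 : (w * algebraMap k[X] (RatFunc k) F) ^ 2 = algebraMap k[X] (RatFunc k) (G * F) := by
    rw [map_mul, h]; ring
  obtain ⟨R, hR⟩ := IsIntegrallyClosed.exists_algebraMap_eq_of_isIntegral_pow (R := k[X])
    (x := w * algebraMap k[X] (RatFunc k) F) two_pos (h1 ▸ isIntegral_algebraMap)
  rw [← hR, ← map_pow] at h1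
  have h2 : R ^ 2 = G * F := RatFunc.algebraMap_injective k h1
  obtain ⟨T, rfl⟩ := hF.isRadical 2 R ⟨G, by rw [h2]; ring⟩
  refine ⟨T, mul_right_cancel₀ hF0 ?_⟩
  rw [← h2]; ring

lemma isField_functionField {F : k[X]} (hF : Squarefree F) (hd : 0 < F.natDegree) :
    IsField (FunctionField F) := by
  have hirr : Irreducible
      (Polynomial.X ^ 2 - Polynomial.C (algebraMap k[X] (RatFunc k) F) : (RatFunc k)[X]) := by
    refine X_pow_sub_C_irreducible_of_prime Nat.prime_two fun b hb => ?_
    have hF0 : algebraMap k[X] (RatFunc k) F ≠ 0 := by simpa using hF.ne_zero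
    have hb0 : b ≠ 0 := by rintro rfl; exact hF0 (by rw [← hb]; simp)
    obtain ⟨T, hT⟩ := exists_eq_mul_sq_of_ratFunc (G := 1) hF (w := b⁻¹) (by
      rw [← hb, map_one]; field_simp)
    have := congrArg Polynomial.natDegree hT
    have hu : IsUnit F := IsUnit.of_mul_eq_one _ hT.symm
    exact hd.ne' (Polynomial.natDegree_eq_zero_of_isUnit hu)
  have := Fact.mk hirr
  exact Field.toIsField (FunctionField F)

end FunctionFieldBasics

/-! ### Uniqueness of the double cover of the line -/

section DoubleCover

open Polynomial in
/-- A polynomial in `k[X][U]` dividing a nonzero polynomial of degree at most two in `X` has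
itself degree at most two in `X`. -/
lemma natDegree_coeff_le_two_of_dvd {P : k[X][X]} {a b c : k[X]} (ha : a ≠ 0)
    (h : P ∣ C X ^ 2 * a.map C + C X * b.map C + c.map C) (i : ℕ) :
    (P.coeff i).natDegree ≤ 2 := by
  have h1 : Bivariate.swap P ∣ X ^ 2 * C a + X * C b + C c := by
    have := map_dvd (Bivariate.swap (R := k)) h
    simpa only [map_add, map_mul, map_pow, Bivariate.swap_X, Bivariate.swap_map_C] using this
  have h2 : (X ^ 2 * C a + X * C b + C c : k[X][X]) ≠ 0 := by
    intro h0
    have := congrArg (fun f => coeff f 2) h0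
    simp at this
    exact ha this
  have h3 : (Bivariate.swap P).natDegree < 3 :=
    Nat.lt_succ_iff.2 ((natDegree_le_of_dvd h1 h2).trans (by compute_degree))
  have h4 := as_sum_range_C_mul_X_pow' _ h3
  have h5 := congrArg (Bivariate.swap (R := k)) h4
  rw [Bivariate.swap_swap_apply] at h5
  rw [h5]
  simp only [Finset.sum_range_succ, Finset.sum_range_zero, map_add, map_mul, map_pow,
    Bivariate.swap_C, Bivariate.swap_Y]
  simp only [← C_pow, coeff_add, coeff_mul_C, coeff_map]
  compute_degree

lemma exists_common_denom (t n : RatFunc k) : ∃ D T N : k[X], D ≠ 0 ∧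
    algebraMap k[X] (RatFunc k) D * t = algebraMap k[X] (RatFunc k) T ∧
    algebraMap k[X] (RatFunc k) D * n = algebraMap k[X] (RatFunc k) N := by
  have ht : algebraMap k[X] (RatFunc k) t.denom ≠ 0 := by simpa using t.denom_ne_zero
  have hn : algebraMap k[X] (RatFunc k) n.denom ≠ 0 := by simpa using n.denom_ne_zero
  refine ⟨t.denom * n.denom, t.num * n.denom, n.num * t.denom,
    mul_ne_zero t.denom_ne_zero n.denom_ne_zero, ?_, ?_⟩
  · nth_rw 2 [← RatFunc.num_div_denom t]
    rw [map_mul, map_mul]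
    field_simp
  · nth_rw 2 [← RatFunc.num_div_denom n]
    rw [map_mul, map_mul]
    field_simp

/-- If `X` is quadratic over `k(u)`, for a function `u` on the curve `Y² = F(X)` with `F` of degree
at least five, then `u` is a rational function of `X`. Otherwise the primitive equation
`A(X) U² + B(X) U + C(X)` of `u` over `k(X)` would have degree at most two in `X`, and
`B² - 4 A C`, of degree at most four, would be `F` up to squares. -/
lemma snd_eq_zero_of_quadratic [CharZero k] {F : k[X]} (hF : Squarefree F) (hd : 5 ≤ F.natDegree)
    {p q : RatFunc k} {a b c : k[X]} (ha : a ≠ 0) {u : FunctionField F}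
    (hu : u = ratHom F p + ratHom F q * yGen F)
    (h : Polynomial.aeval u a * xGen F ^ 2 + Polynomial.aeval u b * xGen F +
      Polynomial.aeval u c = 0) : q = 0 := by
  classical
  by_contra hq
  let _ : NormalizedGCDMonoid k[X] := Classical.choice inferInstance
  let ι := algebraMap k[X] (RatFunc k)
  have hι : Function.Injective ι := RatFunc.algebraMap_injective k
  obtain ⟨D, T, N, hD, hT, hN⟩ := exists_common_denom (2 * p) (p ^ 2 - q ^ 2 * ι F)
  have hD' : ι D ≠ 0 := (map_ne_zero_iff ι hι).2 hD
  -- the monic equation of `u` over `k(X)`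
  set m : (RatFunc k)[X] := Polynomial.X ^ 2 - Polynomial.C (2 * p) * Polynomial.X +
    Polynomial.C (p ^ 2 - q ^ 2 * ι F) with hm
  have hmm : m.Monic := by rw [hm]; monicity!
  have hmd : m.natDegree = 2 := by rw [hm]; compute_degree!
  have hmu : m.eval₂ (ratHom F : RatFunc k →+* FunctionField F) u = 0 := by
    have hy := yGen_sq F
    simp only [hm, Polynomial.eval₂_add, Polynomial.eval₂_sub, Polynomial.eval₂_mul,
      Polynomial.eval₂_pow, Polynomial.eval₂_X, Polynomial.eval₂_C, Polynomial.eval₂_ofNat,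
      RingHom.coe_coe, map_sub, map_mul, map_pow, map_ofNat, hu]
    change _ ^ 2 - _ + (_ - _ * ratHom F (algebraMap k[X] (RatFunc k) F)) = 0
    rw [← hy]
    ring
  -- the equation of degree two in `X`
  set Q : k[X][X] := Polynomial.C Polynomial.X ^ 2 * a.map Polynomial.C +
    Polynomial.C Polynomial.X * b.map Polynomial.C + c.map Polynomial.C with hQ
  have hQu : (Q.map ι).eval₂ (ratHom F : RatFunc k →+* FunctionField F) u = 0 := by
    have e1 : ∀ f : k[X], ((f.map Polynomial.C).map ι).eval₂
        (ratHom F : RatFunc k →+* FunctionField F) u = Polynomial.aeval u f := by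
      intro f
      rw [Polynomial.map_map, Polynomial.eval₂_map, Polynomial.aeval_def]
      congr 1
    have e2 : (Polynomial.C (ι Polynomial.X)).eval₂
        (ratHom F : RatFunc k →+* FunctionField F) u = xGen F := by
      rw [Polynomial.eval₂_C, xGen, RatFunc.algebraMap_X.symm]
      rfl
    rw [hQ]
    simp only [Polynomial.map_add, Polynomial.map_mul, Polynomial.map_pow, Polynomial.map_C,
      Polynomial.eval₂_add, Polynomial.eval₂_mul, Polynomial.eval₂_pow, e1, e2]
    linear_combination h
  have hmQ : m ∣ Q.map ι := by
    rw [← Polynomial.modByMonic_eq_zero_iff_dvd hmm]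
    have hlt := Polynomial.natDegree_modByMonic_lt (Q.map ι) hmm
      (by intro h1; rw [h1] at hmd; simp at hmd)
    rw [hmd] at hlt
    obtain ⟨α, β, hαβ⟩ :=
      Polynomial.exists_eq_X_add_C_of_natDegree_le_one (Nat.lt_succ_iff.1 hlt)
    have h1 := hQu
    rw [← Polynomial.modByMonic_add_div (Q.map ι) m, Polynomial.eval₂_add, Polynomial.eval₂_mul,
      hmu, zero_mul, add_zero, hαβ] at h1
    simp only [Polynomial.eval₂_add, Polynomial.eval₂_mul, Polynomial.eval₂_X, Polynomial.eval₂_C,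
      RingHom.coe_coe, hu] at h1
    have h2 := eq_zero_of_ratHom_add_eq_zero F (p := α * p + β) (q := α * q) (by
      rw [map_add, map_mul, map_mul, ← h1]; ring)
    have hα : α = 0 := (mul_eq_zero.1 h2.2).resolve_right hq
    have hβ : β = 0 := by simpa [hα] using h2.1
    rw [hαβ, hα, hβ]
    simp
  -- the primitive equation of `u`
  set P₀ : k[X][X] := Polynomial.C D * Polynomial.X ^ 2 - Polynomial.C T * Polynomial.X +
    Polynomial.C N with hP₀
  have hP₀m : P₀.map ι = Polynomial.C (ι D) * m := by
    simp only [hP₀, hm, Polynomial.map_add, Polynomial.map_sub, Polynomial.map_mul,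
      Polynomial.map_pow, Polynomial.map_C, Polynomial.map_X, ι, ← hT, ← hN]
    simp only [map_mul]
    ring
  have hcont := P₀.eq_C_content_mul_primPart
  set e := P₀.content
  set P := P₀.primPart
  have hPQ : P ∣ Q := by
    refine (P₀.isPrimitive_primPart).dvd_of_fraction_map_dvd_fraction_map (K := RatFunc k) ?_
    have h1 : P.map ι ∣ P₀.map ι := Polynomial.map_dvd _ ⟨_, by rw [mul_comm]; exact hcont⟩
    rw [hP₀m] at h1
    have hu : IsUnit (Polynomial.C (ι D)) := Polynomial.isUnit_C.2 hD'.isUnit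
    exact (h1.trans (hu.mul_left_dvd.2 dvd_rfl)).trans hmQ
  have hdeg := natDegree_coeff_le_two_of_dvd ha hPQ
  have c2 : D = e * P.coeff 2 := by
    have := congrArg (fun f => Polynomial.coeff f 2) hcont
    simpa [hP₀, Polynomial.coeff_X, Polynomial.coeff_C] using this
  have c1 : -T = e * P.coeff 1 := by
    have := congrArg (fun f => Polynomial.coeff f 1) hcont
    simpa [hP₀, Polynomial.coeff_X, Polynomial.coeff_C] using this
  have c0 : N = e * P.coeff 0 := by
    have := congrArg (fun f => Polynomial.coeff f 0) hcont
    simpa [hP₀, Polynomial.coeff_X, Polynomial.coeff_C] using this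
  have he : e ≠ 0 := by
    intro h0
    rw [h0, zero_mul] at c2
    exact hD c2
  have he' : ι e ≠ 0 := (map_ne_zero_iff ι hι).2 he
  -- its discriminant
  set Δ := P.coeff 1 ^ 2 - 4 * P.coeff 2 * P.coeff 0 with hΔ
  have hΔd : Δ.natDegree ≤ 4 := by
    have := hdeg 0
    have := hdeg 1
    have := hdeg 2
    refine (Polynomial.natDegree_sub_le _ _).trans (max_le ?_ ?_)
    · exact Polynomial.natDegree_pow_le.trans (by omega)
    · refine Polynomial.natDegree_mul_le.trans ?_
      refine (Nat.add_le_add_right Polynomial.natDegree_mul_le _).trans ?_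
      have : (4 : k[X]).natDegree = 0 := Polynomial.natDegree_ofNat 4
      omega
  have hΔF : ι Δ = (2 * ι D * q / ι e) ^ 2 * ι F := by
    have h1 : ι e ^ 2 * ι Δ = 4 * ι D ^ 2 * q ^ 2 * ι F := by
      have h2 : e ^ 2 * Δ = T ^ 2 - 4 * D * N := by
        rw [hΔ]
        linear_combination (T - e * P.coeff 1) * c1 + 4 * N * c2 + 4 * e * P.coeff 2 * c0
      have h3 := congrArg ι h2
      simp only [map_mul, map_sub, map_pow, map_ofNat] at h3
      rw [h3]
      change algebraMap k[X] (RatFunc k) T ^ 2 - 4 * algebraMap k[X] (RatFunc k) D *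
        algebraMap k[X] (RatFunc k) N = _
      rw [← hT, ← hN]
      ring
    field_simp
    linear_combination h1
  obtain ⟨S, hS⟩ := exists_eq_mul_sq_of_ratFunc hF hΔF
  have hΔ0 : Δ ≠ 0 := by
    rw [← map_ne_zero_iff ι hι, hΔF]
    have : ι F ≠ 0 := (map_ne_zero_iff ι hι).2 hF.ne_zero
    have h2 : (2 : RatFunc k) ≠ 0 := by
      have : ((2 : k) : k) ≠ 0 := two_ne_zero
      rw [← map_ofNat (algebraMap k (RatFunc k))]
      exact (map_ne_zero _).2 this
    exact mul_ne_zero (pow_ne_zero _ (div_ne_zero (mul_ne_zero (mul_ne_zero h2 hD') hq) he')) this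
  have := Polynomial.natDegree_le_of_dvd ⟨_, hS⟩ hΔ0
  omega

end DoubleCover

/-! ### Isomorphisms of hyperelliptic curves are given by linear substitutions -/

section Isomorphisms

variable {F H : k[X]}

/-- Every function on a double cover of the line satisfies a quadratic equation over `k[X]`. -/
lemma exists_quadratic (w : FunctionField H) : ∃ a b c : k[X], a ≠ 0 ∧
    Polynomial.aeval (xGen H) a * w ^ 2 + Polynomial.aeval (xGen H) b * w +
      Polynomial.aeval (xGen H) c = 0 := by
  obtain ⟨p, q, rfl⟩ := exists_eq_ratHom_add H w
  obtain ⟨D, T, N, hD, hT, hN⟩ := exists_common_denom (2 * p)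
    (p ^ 2 - q ^ 2 * algebraMap k[X] (RatFunc k) H)
  refine ⟨D, -T, N, hD, ?_⟩
  have hy := yGen_sq H
  rw [map_neg, ← ratHom_algebraMap, ← ratHom_algebraMap, ← ratHom_algebraMap, ← hT, ← hN]
  simp only [map_mul, map_sub, map_pow, map_ofNat, ← hy]
  ring

lemma aeval_map_xGen (φ : FunctionField H →ₐ[k] FunctionField F) (f : k[X]) :
    φ (Polynomial.aeval (xGen H) f) = Polynomial.aeval (φ (xGen H)) f :=
  (Polynomial.aeval_algHom_apply φ _ f).symm

lemma aeval_ratHom (r : RatFunc k) (f : k[X]) :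
    Polynomial.aeval (ratHom F r) f = ratHom F (Polynomial.aeval r f) :=
  Polynomial.aeval_algHom_apply (ratHom F) r f

/-- A homomorphism mapping `X` to a rational function `r` of `X` maps a rational function `s` to
`s(r)`. -/
lemma map_ratHom_of_map_xGen {φ : FunctionField H →ₐ[k] FunctionField F} {r : RatFunc k}
    (hφ : Function.Injective φ) (h : φ (xGen H) = ratHom F r) (s : RatFunc k) :
    φ (ratHom H s) = ratHom F (Polynomial.aeval r s.num / Polynomial.aeval r s.denom) := by
  have hd : Polynomial.aeval r s.denom ≠ 0 := by
    intro h0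
    have h1 : φ (Polynomial.aeval (xGen H) s.denom) = 0 := by
      rw [aeval_map_xGen, h, aeval_ratHom, h0, map_zero]
    rw [map_eq_zero_iff φ hφ] at h1
    exact aeval_xGen_ne_zero H s.denom_ne_zero h1
  have h2 : φ (ratHom H s) * ratHom F (Polynomial.aeval r s.denom) =
      ratHom F (Polynomial.aeval r s.num) := by
    rw [← aeval_ratHom, ← aeval_ratHom, ← h, ← aeval_map_xGen, ← aeval_map_xGen, ← map_mul,
      ← ratHom_algebraMap, ← ratHom_algebraMap, ← map_mul]
    congr 2
    nth_rw 1 [← RatFunc.num_div_denom s]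
    have : algebraMap k[X] (RatFunc k) s.denom ≠ 0 := by simpa using s.denom_ne_zero
    field_simp
  rw [div_eq_mul_inv, map_mul, ← h2, mul_assoc, ← map_mul, mul_inv_cancel₀ hd, map_one, mul_one]

/-- The image of `X` under an isomorphism onto the function field of a hyperelliptic curve is a
rational function of `X`. -/
lemma exists_map_xGen_eq [CharZero k] (hF : Squarefree F) (hd : 5 ≤ F.natDegree)
    (φ : FunctionField H ≃ₐ[k] FunctionField F) : ∃ r : RatFunc k, φ (xGen H) = ratHom F r := by
  obtain ⟨p, q, hu⟩ := exists_eq_ratHom_add F (φ (xGen H))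
  obtain ⟨a, b, c, ha, habc⟩ := exists_quadratic (φ.symm (xGen F))
  have h := congrArg φ habc
  simp only [map_add, map_mul, map_pow, AlgEquiv.apply_symm_apply, map_zero] at h
  have e : ∀ f : k[X], φ (Polynomial.aeval (xGen H) f) = Polynomial.aeval (φ (xGen H)) f :=
    aeval_map_xGen φ.toAlgHom
  rw [e, e, e] at h
  have hq := snd_eq_zero_of_quadratic hF hd ha hu h
  exact ⟨p, by rw [hu, hq]; simp⟩

/-- Conversely, `X` is a rational function of that image, for otherwise all functions on the
source would be mapped to rational functions of `X`. -/
lemma exists_symm_xGen_eq [CharZero k]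
    (φ : FunctionField H ≃ₐ[k] FunctionField F) {r : RatFunc k} (h : φ (xGen H) = ratHom F r) :
    ∃ s : RatFunc k, φ.symm (xGen F) = ratHom H s := by
  obtain ⟨p, q, hw⟩ := exists_eq_ratHom_add H (φ.symm (xGen F))
  have hr : ∀ s, φ (ratHom H s) = _ := map_ratHom_of_map_xGen (φ := φ.toAlgHom) φ.injective h
  by_cases hq : q = 0
  · exact ⟨p, by rw [hw, hq]; simp⟩
  exfalso
  -- the image of `Y` is a rational function
  have hy : ∃ t, φ (yGen H) = ratHom F t := by
    have h1 : yGen H = ratHom H q⁻¹ * (φ.symm (xGen F) - ratHom H p) := by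
      rw [hw, add_sub_cancel_left, ← mul_assoc, ← map_mul, inv_mul_cancel₀ hq, map_one, one_mul]
    have h2 := congrArg φ h1
    rw [map_mul, map_sub, AlgEquiv.apply_symm_apply] at h2
    have h3 := hr q⁻¹
    have h4 := hr p
    rw [h3, h4, xGen, ← map_sub, ← map_mul] at h2
    exact ⟨_, h2⟩
  obtain ⟨t, ht⟩ := hy
  obtain ⟨p', q', hpq⟩ := exists_eq_ratHom_add H (φ.symm (yGen F))
  have h5 := congrArg φ hpq
  have h3 := hr p'
  have h4 := hr q'
  rw [AlgEquiv.apply_symm_apply, map_add, map_mul, h3, h4, ht, ← map_mul, ← map_add] at h5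
  have h6 := eq_zero_of_ratHom_add_eq_zero F (p := -(Polynomial.aeval r p'.num /
    Polynomial.aeval r p'.denom + Polynomial.aeval r q'.num / Polynomial.aeval r q'.denom * t))
    (q := 1) (by rw [h5, map_neg, map_one]; ring)
  exact one_ne_zero h6.2

open Polynomial in
/-- A rational function generating `k(X)` is a fractional linear function. -/
lemma exists_fractional_linear {r s : RatFunc k}
    (h : aeval r s.num / aeval r s.denom = RatFunc.X) (hr : ∀ c, r ≠ RatFunc.C c) :
    ∃ M : Matrix (Fin 2) (Fin 2) k, M.det ≠ 0 ∧
      r.num = C (M 0 0) * X + C (M 0 1) ∧ r.denom = C (M 1 0) * X + C (M 1 1) := by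
  have htop : IntermediateField.adjoin k {r} = ⊤ := by
    rw [eq_top_iff, ← RatFunc.adjoin_X, IntermediateField.adjoin_simple_le_iff, ← h]
    have hmem : ∀ f : k[X], aeval r f ∈ IntermediateField.adjoin k {r} := by
      intro f
      exact IntermediateField.algebra_adjoin_le_adjoin k {r} (aeval_mem_adjoin_singleton k r)
    exact div_mem (hmem _) (hmem _)
  have hfin := RatFunc.finrank_eq_max_natDegree r
  rw [htop, IntermediateField.finrank_top] at hfin
  obtain ⟨a, b, hab⟩ := exists_eq_X_add_C_of_natDegree_le_one
    (hfin ▸ le_max_left r.num.natDegree r.denom.natDegree)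
  obtain ⟨c, e, hce⟩ := exists_eq_X_add_C_of_natDegree_le_one
    (hfin ▸ le_max_right r.num.natDegree r.denom.natDegree)
  refine ⟨!![a, b; c, e], ?_, by simpa using hab, by simpa using hce⟩
  intro hdet
  rw [Matrix.det_fin_two_of, sub_eq_zero] at hdet
  -- a singular matrix gives a constant function
  have hrel : r * algebraMap k[X] (RatFunc k) r.denom = algebraMap k[X] (RatFunc k) r.num := by
    nth_rw 1 [← RatFunc.num_div_denom r]
    have : algebraMap k[X] (RatFunc k) r.denom ≠ 0 := by simpa using r.denom_ne_zero
    field_simp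
  rw [hab, hce] at hrel
  simp only [map_add, map_mul, RatFunc.algebraMap_C, RatFunc.algebraMap_X] at hrel
  have hdet' : RatFunc.C a * RatFunc.C e = RatFunc.C b * RatFunc.C c := by
    rw [← map_mul, ← map_mul, hdet]
  by_cases hc : c = 0
  · have he : e ≠ 0 := by
      rintro rfl
      exact r.denom_ne_zero (by rw [hce, hc]; simp)
    have ha : a = 0 := by
      rw [hc, mul_zero] at hdet
      exact (mul_eq_zero.1 hdet).resolve_right he
    apply hr (b / e)
    have he' : RatFunc.C e ≠ 0 := by simpa using he
    rw [map_div₀, eq_div_iff he']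
    rw [hc, ha] at hrel
    simpa using hrel
  · apply hr (a / c)
    have hc' : RatFunc.C c ≠ 0 := by simpa using hc
    have hden : (RatFunc.C c * RatFunc.X + RatFunc.C e) ≠ 0 := by
      have : algebraMap k[X] (RatFunc k) r.denom ≠ 0 := by simpa using r.denom_ne_zero
      rw [hce] at this
      simpa using this
    rw [map_div₀, eq_div_iff hc']
    apply mul_right_cancel₀ hden
    linear_combination RatFunc.C c * hrel - hdet'

/-- Setting `Z = 1`. -/
def dehom : MvPolynomial (Fin 2) k →ₐ[k] k[X] := MvPolynomial.aeval ![Polynomial.X, 1]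

/-- The entries of the vector `M (X, 1)`, as polynomials in `X`. -/
def linPoly (M : Matrix (Fin 2) (Fin 2) k) (i : Fin 2) : k[X] :=
  Polynomial.C (M i 0) * Polynomial.X + Polynomial.C (M i 1)

lemma dehom_C (c : k) : dehom (MvPolynomial.C c) = Polynomial.C c := by
  simp [dehom]

lemma dehom_X_zero : dehom (MvPolynomial.X 0 : MvPolynomial (Fin 2) k) = Polynomial.X := by
  simp [dehom]

lemma dehom_X_one : dehom (MvPolynomial.X 1 : MvPolynomial (Fin 2) k) = 1 := by
  simp [dehom]

lemma dehom_binaryForm {d : ℕ} {G : k[X]} (hG : G.natDegree ≤ d) :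
    dehom (binaryForm d G) = G := by
  conv_rhs => rw [Polynomial.as_sum_range_C_mul_X_pow' G (Nat.lt_succ_iff.2 hG)]
  simp [binaryForm, dehom_X_zero, dehom_X_one]

lemma isHomogeneous_binaryForm (d : ℕ) (G : k[X]) : (binaryForm d G).IsHomogeneous d := by
  refine MvPolynomial.IsHomogeneous.sum _ _ _ fun i hi => ?_
  have h := (((MvPolynomial.isHomogeneous_C (Fin 2) (G.coeff i)).mul
    (MvPolynomial.isHomogeneous_X_pow (R := k) (0 : Fin 2) i)).mul
    (MvPolynomial.isHomogeneous_X_pow (R := k) (1 : Fin 2) (d - i)))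
  have : 0 + i + (d - i) = d := by have := Finset.mem_range.1 hi; omega
  rwa [this] at h

lemma binaryForm_add (d : ℕ) (G G' : k[X]) :
    binaryForm d (G + G') = binaryForm d G + binaryForm d G' := by
  simp only [binaryForm, Polynomial.coeff_add, map_add, add_mul, Finset.sum_add_distrib]

lemma binaryForm_C_mul (d : ℕ) (c : k) (G : k[X]) :
    binaryForm d (Polynomial.C c * G) = MvPolynomial.C c * binaryForm d G := by
  simp only [binaryForm, Polynomial.coeff_C_mul, map_mul, Finset.mul_sum, mul_assoc]

lemma binaryForm_X_pow {d i : ℕ} (hi : i ≤ d) :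
    binaryForm d (Polynomial.X ^ i : k[X]) =
      MvPolynomial.X 0 ^ i * MvPolynomial.X 1 ^ (d - i) := by
  rw [binaryForm, Finset.sum_eq_single i]
  · simp
  · intro j _ hj
    simp [Polynomial.coeff_X_pow, hj]
  · intro h
    exact absurd (Finset.mem_range.2 (Nat.lt_succ_iff.2 hi)) h

lemma binaryForm_dehom {d : ℕ} {f : MvPolynomial (Fin 2) k} (hf : f.IsHomogeneous d) :
    binaryForm d (dehom f) = f := by
  have h1 : ∀ s ∈ f.support, binaryForm d (dehom (MvPolynomial.monomial s (f.coeff s))) =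
      MvPolynomial.monomial s (f.coeff s) := by
    intro s hs
    have hs' : s 0 + s 1 = d := by
      have := hf (MvPolynomial.mem_support_iff.1 hs)
      rw [Finsupp.weight_apply, Finsupp.sum_fintype _ _ (by simp)] at this
      simpa using this
    rw [MvPolynomial.monomial_eq, Finsupp.prod_fintype _ _ (by simp), Fin.prod_univ_two, map_mul,
      map_mul, map_pow, map_pow, dehom_C, dehom_X_zero, dehom_X_one, one_pow, mul_one,
      binaryForm_C_mul, binaryForm_X_pow (by omega), show d - s 0 = s 1 by omega]
  conv_lhs => rw [f.as_sum, map_sum]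
  conv_rhs => rw [f.as_sum]
  rw [← Finset.sum_congr rfl h1]
  exact map_sum (AddMonoidHom.mk' (binaryForm d) (binaryForm_add d)) _ _

lemma isHomogeneous_subst {d : ℕ} {f : MvPolynomial (Fin 2) k} (hf : f.IsHomogeneous d)
    (M : Matrix (Fin 2) (Fin 2) k) : (subst M f).IsHomogeneous d := by
  have h := hf.aeval (S := k) (n := 1) (fun i : Fin 2 => (MvPolynomial.C (M i 0) *
    MvPolynomial.X 0 + MvPolynomial.C (M i 1) * MvPolynomial.X 1 : MvPolynomial (Fin 2) k))
    fun i => by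
      have h0 := (MvPolynomial.isHomogeneous_C (Fin 2) (M i 0)).mul
        (MvPolynomial.isHomogeneous_X k (0 : Fin 2))
      have h1 := (MvPolynomial.isHomogeneous_C (Fin 2) (M i 1)).mul
        (MvPolynomial.isHomogeneous_X k (1 : Fin 2))
      rw [zero_add] at h0 h1
      exact h0.add h1
  rwa [one_mul] at h

lemma natDegree_dehom_le {d : ℕ} {f : MvPolynomial (Fin 2) k} (hf : f.IsHomogeneous d) :
    (dehom f).natDegree ≤ d := by
  conv_lhs => rw [← binaryForm_dehom hf]
  rw [binaryForm, map_sum]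
  refine Polynomial.natDegree_sum_le_of_forall_le _ _ fun i hi => ?_
  rw [map_mul, map_mul, map_pow, map_pow, dehom_C, dehom_X_zero, dehom_X_one, one_pow, mul_one]
  exact (Polynomial.natDegree_C_mul_X_pow_le _ _).trans (Nat.lt_succ_iff.1 (Finset.mem_range.1 hi))

lemma dehom_subst_binaryForm (M : Matrix (Fin 2) (Fin 2) k) (d : ℕ) (G : k[X]) :
    dehom (subst M (binaryForm d G)) = ∑ i ∈ Finset.range (d + 1),
      Polynomial.C (G.coeff i) * linPoly M 0 ^ i * linPoly M 1 ^ (d - i) := by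
  simp [binaryForm, subst_X, dehom_X_zero, dehom_X_one, linPoly]

/-- The values at fractional linear functions of a polynomial and of its form. -/
lemma aeval_dehom_subst_binaryForm {B : Type*} [CommRing B] [Algebra k B] {d : ℕ} {G : k[X]}
    (hG : G.natDegree ≤ d) (M : Matrix (Fin 2) (Fin 2) k) {x z : B}
    (h : z * Polynomial.aeval x (linPoly M 1) = Polynomial.aeval x (linPoly M 0)) :
    Polynomial.aeval x (dehom (subst M (binaryForm d G))) =
      Polynomial.aeval z G * Polynomial.aeval x (linPoly M 1) ^ d := by
  rw [dehom_subst_binaryForm, map_sum]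
  conv_rhs => rw [Polynomial.as_sum_range_C_mul_X_pow' G (Nat.lt_succ_iff.2 hG), map_sum,
    Finset.sum_mul]
  refine Finset.sum_congr rfl fun i hi => ?_
  have hi' : i ≤ d := Nat.lt_succ_iff.1 (Finset.mem_range.1 hi)
  simp only [map_mul, map_pow, Polynomial.aeval_C, Polynomial.aeval_X, ← h]
  rw [mul_pow, ← Nat.add_sub_cancel' hi', pow_add]
  simp only [Nat.add_sub_cancel_left]
  ring

/-- `φ` maps `X` to the fractional linear function of `X` with matrix `M`. -/
def ActsBy (φ : FunctionField H ≃ₐ[k] FunctionField F) (M : Matrix (Fin 2) (Fin 2) k) : Prop :=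
  φ (xGen H) * Polynomial.aeval (xGen F) (linPoly M 1) = Polynomial.aeval (xGen F) (linPoly M 0)

/-- An isomorphism onto the function field of a hyperelliptic curve comes from a linear
substitution relating the binary forms. -/
theorem exists_form_eq_of_algEquiv [CharZero k] {g : ℕ} (hg : 2 ≤ g) (hF : IsHyperelliptic g F)
    (hH : H.natDegree ≤ 2 * g + 2) (φ : FunctionField H ≃ₐ[k] FunctionField F) :
    ∃ (M : Matrix (Fin 2) (Fin 2) k) (c : k), M.det ≠ 0 ∧ c ≠ 0 ∧ ActsBy φ M ∧
      subst M (form g H) = MvPolynomial.C c * form g F := by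
  have hsq := hF.1
  have hd5 : 5 ≤ F.natDegree := by have := hF.2; omega
  obtain ⟨r, hr⟩ := exists_map_xGen_eq hsq hd5 φ
  obtain ⟨s, hs⟩ := exists_symm_xGen_eq φ hr
  have hφ : ∀ s, φ (ratHom H s) = _ := map_ratHom_of_map_xGen (φ := φ.toAlgHom) φ.injective hr
  have hψ : ∀ s, φ.symm (ratHom F s) = _ :=
    map_ratHom_of_map_xGen (φ := φ.symm.toAlgHom) φ.symm.injective hs
  have hX : Polynomial.aeval r s.num / Polynomial.aeval r s.denom = RatFunc.X := by
    apply ratHom_injective F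
    rw [← hφ, ← hs, AlgEquiv.apply_symm_apply, xGen]
  have hrC : ∀ c, r ≠ RatFunc.C c := by
    rintro c rfl
    have h1 : φ (ratHom H (RatFunc.C c)) = ratHom F (RatFunc.C c) := by
      rw [← RatFunc.algebraMap_eq_C, AlgHom.commutes, AlgHom.commutes, AlgEquiv.commutes]
    rw [← h1, EmbeddingLike.apply_eq_iff_eq, xGen] at hr
    have h2 := ratHom_injective H hr
    have h3 := congrArg RatFunc.num h2
    rw [RatFunc.num_X, RatFunc.num_C] at h3
    exact Polynomial.X_ne_C c h3
  obtain ⟨M, hM, hnum, hden⟩ := exists_fractional_linear hX hrC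
  have hl0 : linPoly M 0 = r.num := hnum.symm
  have hl1 : linPoly M 1 = r.denom := hden.symm
  have hrd : r * algebraMap k[X] (RatFunc k) r.denom = algebraMap k[X] (RatFunc k) r.num := by
    nth_rw 1 [← RatFunc.num_div_denom r]
    have : algebraMap k[X] (RatFunc k) r.denom ≠ 0 := by simpa using r.denom_ne_zero
    field_simp
  have hact : ActsBy φ M := by
    rw [ActsBy, hl0, hl1, hr, ← ratHom_algebraMap, ← ratHom_algebraMap, ← map_mul, hrd]
  -- the image of `Y` is a multiple of `Y`
  obtain ⟨p, q, hy⟩ := exists_eq_ratHom_add F (φ (yGen H))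
  have hq : q ≠ 0 := by
    rintro rfl
    rw [map_zero, zero_mul, add_zero] at hy
    have hy' := congrArg φ.symm hy
    rw [AlgEquiv.symm_apply_apply, hψ] at hy'
    exact one_ne_zero (eq_zero_of_ratHom_add_eq_zero H
      (p := -(Polynomial.aeval s p.num / Polynomial.aeval s p.denom)) (q := 1)
      (by rw [hy', map_neg, map_one]; ring)).2
  have hy2 := congrArg φ (yGen_sq H)
  rw [map_pow, hy, ratHom_algebraMap, show φ (Polynomial.aeval (xGen H) H) =
    Polynomial.aeval (φ (xGen H)) H from aeval_map_xGen φ.toAlgHom H, hr, aeval_ratHom] at hy2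
  have hF2 := yGen_sq F
  have hz := eq_zero_of_ratHom_add_eq_zero F
    (p := p ^ 2 + q ^ 2 * algebraMap k[X] (RatFunc k) F - Polynomial.aeval r H) (q := 2 * p * q) (by
      rw [map_sub, ← hy2]
      simp only [map_add, map_mul, map_pow, ← hF2, map_ofNat]
      ring)
  have hp : p = 0 := by
    have h2 : (2 : RatFunc k) ≠ 0 := by
      rw [← map_ofNat (algebraMap k (RatFunc k))]
      exact (map_ne_zero _).2 two_ne_zero
    exact (mul_eq_zero.1 ((mul_eq_zero.1 hz.2).resolve_right hq)).resolve_left h2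
  have hrH : Polynomial.aeval r H = q ^ 2 * algebraMap k[X] (RatFunc k) F := by
    have := hz.1
    rw [hp] at this
    linear_combination -this
  -- comparison of the forms
  set G := dehom (subst M (form g H)) with hG
  have hhom : (subst M (form g H)).IsHomogeneous (2 * g + 2) :=
    isHomogeneous_subst (isHomogeneous_binaryForm _ _) M
  have hGF : algebraMap k[X] (RatFunc k) G =
      (q * algebraMap k[X] (RatFunc k) r.denom ^ (g + 1)) ^ 2 * algebraMap k[X] (RatFunc k) F := by
    have h1 := aeval_dehom_subst_binaryForm (B := RatFunc k) (d := 2 * g + 2) hH M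
      (x := RatFunc.X) (z := r) (by
        rw [hl0, hl1, RatFunc.aeval_X_left_eq_algebraMap, RatFunc.aeval_X_left_eq_algebraMap, hrd])
    rw [RatFunc.aeval_X_left_eq_algebraMap, hl1, RatFunc.aeval_X_left_eq_algebraMap, hrH] at h1
    rw [hG, form, h1]
    ring
  obtain ⟨T, hT⟩ := exists_eq_mul_sq_of_ratFunc hsq hGF
  have hF0 : algebraMap k[X] (RatFunc k) F ≠ 0 := by simpa using hsq.ne_zero
  have hG0 : G ≠ 0 := by
    intro h0
    rw [h0, map_zero, eq_comm] at hGF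
    have : algebraMap k[X] (RatFunc k) r.denom ≠ 0 := by simpa using r.denom_ne_zero
    exact mul_ne_zero (pow_ne_zero _ (mul_ne_zero hq (pow_ne_zero _ this))) hF0 hGF
  have hT0 : T ≠ 0 := by
    rintro rfl
    exact hG0 (by rw [hT]; ring)
  have hTd : T.natDegree = 0 := by
    have h1 := natDegree_dehom_le hhom
    rw [← hG, hT, Polynomial.natDegree_mul hsq.ne_zero (pow_ne_zero _ hT0),
      Polynomial.natDegree_pow] at h1
    have := hF.2
    omega
  obtain ⟨t, rfl⟩ := Polynomial.natDegree_eq_zero.1 hTd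
  have ht : t ≠ 0 := by
    rintro rfl
    exact hT0 (map_zero _)
  refine ⟨M, t ^ 2, hM, pow_ne_zero _ ht, hact, ?_⟩
  rw [← binaryForm_dehom hhom, ← hG, hT, mul_comm F, ← map_pow, binaryForm_C_mul, form]

end Isomorphisms

/-! ### Curves with equivalent binary forms are isomorphic -/

section Converse

variable {F H : k[X]}

lemma linPoly_mul (M N : Matrix (Fin 2) (Fin 2) k) (i : Fin 2) :
    linPoly (M * N) i =
      Polynomial.C (M i 0) * linPoly N 0 + Polynomial.C (M i 1) * linPoly N 1 := by
  simp only [linPoly, Matrix.mul_apply, Fin.sum_univ_two, map_add, map_mul]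
  ring

lemma linPoly_one_zero : linPoly (1 : Matrix (Fin 2) (Fin 2) k) 0 = Polynomial.X := by
  simp [linPoly]

lemma linPoly_one_one : linPoly (1 : Matrix (Fin 2) (Fin 2) k) 1 = 1 := by
  simp [linPoly]

/-- Forms of the same degree are equal if their dehomogenizations are. -/
lemma eq_of_dehom_eq {d : ℕ} {f h : MvPolynomial (Fin 2) k} (hf : f.IsHomogeneous d)
    (hh : h.IsHomogeneous d) (e : dehom f = dehom h) : f = h := by
  rw [← binaryForm_dehom hf, e, binaryForm_dehom hh]

/-- The fractional linear function with matrix `M`. -/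
def moebius (M : Matrix (Fin 2) (Fin 2) k) : RatFunc k :=
  algebraMap k[X] (RatFunc k) (linPoly M 0) / algebraMap k[X] (RatFunc k) (linPoly M 1)

lemma linPoly_ne_zero {M : Matrix (Fin 2) (Fin 2) k} (hM : M.det ≠ 0) :
    algebraMap k[X] (RatFunc k) (linPoly M 1) ≠ 0 := by
  rw [Ne, FaithfulSMul.algebraMap_eq_zero_iff]
  intro h
  have h0 := congrArg (fun f => Polynomial.coeff f 0) h
  have h1 := congrArg (fun f => Polynomial.coeff f 1) h
  simp [linPoly] at h0 h1
  exact hM (by rw [Matrix.det_fin_two, h0, h1]; ring)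

lemma moebius_mul {M : Matrix (Fin 2) (Fin 2) k} (hM : M.det ≠ 0) :
    moebius M * algebraMap k[X] (RatFunc k) (linPoly M 1) =
      algebraMap k[X] (RatFunc k) (linPoly M 0) :=
  div_mul_cancel₀ _ (linPoly_ne_zero hM)

lemma moebius_ne_C {M : Matrix (Fin 2) (Fin 2) k} (hM : M.det ≠ 0) (c : k) :
    moebius M ≠ RatFunc.C c := by
  intro h
  have h1 := moebius_mul hM
  rw [h, ← RatFunc.algebraMap_C, ← map_mul] at h1
  have h2 := RatFunc.algebraMap_injective k h1
  have e0 := congrArg (fun f => Polynomial.coeff f 0) h2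
  have e1 := congrArg (fun f => Polynomial.coeff f 1) h2
  simp [linPoly] at e0 e1
  exact hM (by rw [Matrix.det_fin_two, ← e0, ← e1]; ring)

/-- The substitution of a fractional linear function into rational functions. -/
lemma exists_ratFunc_subst {M : Matrix (Fin 2) (Fin 2) k} (hM : M.det ≠ 0) :
    ∃ σ : RatFunc k →ₐ[k] RatFunc k, σ RatFunc.X = moebius M := by
  have htr : Transcendental k (moebius M) :=
    RatFunc.transcendental_of_ne_C _ fun ⟨c, hc⟩ => moebius_ne_C hM c hc
  have hinj : Function.Injective (Polynomial.aeval (moebius M) : k[X] →ₐ[k] RatFunc k) :=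
    transcendental_iff_injective.1 htr
  refine ⟨RatFunc.liftAlgHom (Polynomial.aeval (moebius M))
    (nonZeroDivisors_le_comap_nonZeroDivisors_of_injective _ hinj), ?_⟩
  rw [RatFunc.liftAlgHom_apply]
  simp

/-- The homomorphism of function fields defined by an equality of forms. -/
lemma exists_algHom_of_form_eq {g : ℕ} (hF : F.natDegree ≤ 2 * g + 2) (hH : H.natDegree ≤ 2 * g + 2)
    {M : Matrix (Fin 2) (Fin 2) k} (hM : M.det ≠ 0) {t : k}
    (h : subst M (form g H) = MvPolynomial.C (t ^ 2) * form g F) :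
    ∃ φ : FunctionField H →ₐ[k] FunctionField F,
      φ (xGen H) * Polynomial.aeval (xGen F) (linPoly M 1) =
        Polynomial.aeval (xGen F) (linPoly M 0) ∧
      φ (yGen H) * Polynomial.aeval (xGen F) (linPoly M 1) ^ (g + 1) =
        algebraMap k (FunctionField F) t * yGen F := by
  obtain ⟨σ, hσ⟩ := exists_ratFunc_subst hM
  set D := algebraMap k[X] (RatFunc k) (linPoly M 1) with hD
  have hD0 : D ≠ 0 := linPoly_ne_zero hM
  have hH' : σ (algebraMap k[X] (RatFunc k) H) * D ^ (2 * g + 2) =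
      algebraMap k (RatFunc k) t ^ 2 * algebraMap k[X] (RatFunc k) F := by
    have h1 := aeval_dehom_subst_binaryForm (B := RatFunc k) (d := 2 * g + 2) hH M
      (x := RatFunc.X) (z := moebius M) (by
        rw [RatFunc.aeval_X_left_eq_algebraMap, RatFunc.aeval_X_left_eq_algebraMap,
          moebius_mul hM])
    change Polynomial.aeval RatFunc.X (dehom (subst M (form g H))) = _ at h1
    rw [h, map_mul, dehom_C, form, dehom_binaryForm hF, ← hσ, Polynomial.aeval_algHom_apply,
      RatFunc.aeval_X_left_eq_algebraMap, RatFunc.aeval_X_left_eq_algebraMap,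
      RatFunc.aeval_X_left_eq_algebraMap] at h1
    rw [hD, ← h1, map_mul, map_pow, map_pow]
    congr 1
  set w := algebraMap k (RatFunc k) t / D ^ (g + 1) with hw
  have hroot : (Polynomial.X ^ 2 - Polynomial.C (algebraMap k[X] (RatFunc k) H) :
      (RatFunc k)[X]).eval₂ ((ratHom F).comp σ : RatFunc k →ₐ[k] FunctionField F)
      (ratHom F w * yGen F) = 0 := by
    rw [Polynomial.eval₂_sub, Polynomial.eval₂_pow, Polynomial.eval₂_X, Polynomial.eval₂_C,
      sub_eq_zero, mul_pow, yGen_sq, ← map_pow, ← map_mul]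
    have : w ^ 2 * algebraMap k[X] (RatFunc k) F = σ (algebraMap k[X] (RatFunc k) H) := by
      rw [hw, div_pow, div_mul_eq_mul_div, ← hH', ← pow_mul, show (g + 1) * 2 = 2 * g + 2 by ring,
        mul_div_cancel_right₀ _ (pow_ne_zero _ hD0)]
    rw [this]
    rfl
  refine ⟨AdjoinRoot.liftAlgHom _ ((ratHom F).comp σ) _ hroot, ?_, ?_⟩
  · have : AdjoinRoot.liftAlgHom _ ((ratHom F).comp σ) _ hroot (xGen H) =
        ratHom F (moebius M) := by
      rw [← hσ]
      exact AdjoinRoot.liftAlgHom_of ..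
    rw [this, ← ratHom_algebraMap, ← ratHom_algebraMap, ← map_mul, moebius_mul hM]
  · have : AdjoinRoot.liftAlgHom _ ((ratHom F).comp σ) _ hroot (yGen H) =
        ratHom F w * yGen F := AdjoinRoot.liftAlgHom_root ..
    rw [this, ← ratHom_algebraMap, ← hD, mul_right_comm, ← map_pow, ← map_mul, hw,
      div_mul_cancel₀ _ (pow_ne_zero _ hD0), AlgHom.commutes]

/-- The value of a linear form at the image of `X`. -/
lemma map_aeval_linPoly_mul {φ : FunctionField H →ₐ[k] FunctionField F}
    {N : Matrix (Fin 2) (Fin 2) k}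
    (h : φ (xGen H) * Polynomial.aeval (xGen F) (linPoly N 1) =
        Polynomial.aeval (xGen F) (linPoly N 0)) (M : Matrix (Fin 2) (Fin 2) k) (i : Fin 2) :
    φ (Polynomial.aeval (xGen H) (linPoly M i)) * Polynomial.aeval (xGen F) (linPoly N 1) =
      Polynomial.aeval (xGen F) (linPoly (M * N) i) := by
  rw [linPoly_mul]
  simp only [map_add, map_mul, Polynomial.aeval_C, ← h]
  rw [linPoly]
  simp only [map_add, map_mul, Polynomial.aeval_C, Polynomial.aeval_X, AlgHom.commutes]
  ring

/-- A homomorphism of this kind followed by the one with the inverse matrix is the identity. -/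
lemma comp_eq_id {g : ℕ} {M N : Matrix (Fin 2) (Fin 2) k} (hMN : M * N = 1)
    {t u : k} (htu : t * u = 1) {φ : FunctionField H →ₐ[k] FunctionField F}
    {ψ : FunctionField F →ₐ[k] FunctionField H}
    (hφx : φ (xGen H) * Polynomial.aeval (xGen F) (linPoly M 1) =
        Polynomial.aeval (xGen F) (linPoly M 0))
    (hφy : φ (yGen H) * Polynomial.aeval (xGen F) (linPoly M 1) ^ (g + 1) =
        algebraMap k (FunctionField F) t * yGen F)
    (hψx : ψ (xGen F) * Polynomial.aeval (xGen H) (linPoly N 1) =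
        Polynomial.aeval (xGen H) (linPoly N 0))
    (hψy : ψ (yGen F) * Polynomial.aeval (xGen H) (linPoly N 1) ^ (g + 1) =
        algebraMap k (FunctionField H) u * yGen H) :
    ψ.comp φ = AlgHom.id k _ := by
  have e0 := map_aeval_linPoly_mul hψx M 0
  have e1 := map_aeval_linPoly_mul hψx M 1
  rw [hMN, linPoly_one_zero, Polynomial.aeval_X] at e0
  rw [hMN, linPoly_one_one, map_one] at e1
  refine algHom_ext_gens (F := H) ?_ ?_
  · have h := congrArg ψ hφx
    rw [map_mul] at h
    rw [AlgHom.comp_apply, AlgHom.id_apply]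
    conv_rhs => rw [← e0, ← h, mul_assoc, e1, mul_one]
  · have h := congrArg ψ hφy
    rw [map_mul, map_mul, map_pow, AlgHom.commutes] at h
    have h2 : ψ (φ (yGen H)) = ψ (φ (yGen H)) *
        ψ (Polynomial.aeval (xGen F) (linPoly M 1)) ^ (g + 1) *
        Polynomial.aeval (xGen H) (linPoly N 1) ^ (g + 1) := by
      rw [mul_assoc, ← mul_pow, e1, one_pow, mul_one]
    rw [AlgHom.comp_apply, AlgHom.id_apply, h2, h, mul_assoc, hψy, ← mul_assoc,
      ← map_mul (algebraMap k (FunctionField H)), htu, map_one, one_mul]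

/-- Curves with equivalent binary forms are isomorphic. -/
lemma exists_algEquiv_of_form_eq {g : ℕ} (hF : F.natDegree ≤ 2 * g + 2)
    (hH : H.natDegree ≤ 2 * g + 2) {M : Matrix (Fin 2) (Fin 2) k} (hM : M.det ≠ 0) {t : k}
    (ht : t ≠ 0) (h : subst M (form g H) = MvPolynomial.C (t ^ 2) * form g F) :
    ∃ φ : FunctionField H ≃ₐ[k] FunctionField F, ActsBy φ M ∧
      φ (yGen H) * Polynomial.aeval (xGen F) (linPoly M 1) ^ (g + 1) =
        algebraMap k (FunctionField F) t * yGen F := by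
  have hu : IsUnit M.det := hM.isUnit
  have hMi : (M⁻¹).det ≠ 0 := by
    rw [Matrix.det_nonsing_inv, Ring.inverse_eq_inv']
    exact inv_ne_zero hM
  obtain ⟨φ, hφx, hφy⟩ := exists_algHom_of_form_eq hF hH hM h
  have h' : subst M⁻¹ (form g F) = MvPolynomial.C (t⁻¹ ^ 2) * form g H := by
    have e : form g F = MvPolynomial.C (t⁻¹ ^ 2) * subst M (form g H) := by
      rw [h, ← mul_assoc, ← map_mul, ← mul_pow, inv_mul_cancel₀ ht, one_pow, map_one, one_mul]
    rw [e, map_mul, subst_C, subst_subst, Matrix.mul_nonsing_inv _ hu, subst_one]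
  obtain ⟨ψ, hψx, hψy⟩ := exists_algHom_of_form_eq hH hF hMi h'
  refine ⟨AlgEquiv.ofAlgHom φ ψ ?_ ?_, hφx, hφy⟩
  · exact comp_eq_id (Matrix.nonsing_inv_mul _ hu) (inv_mul_cancel₀ ht) hψx hψy hφx hφy
  · exact comp_eq_id (Matrix.mul_nonsing_inv _ hu) (mul_inv_cancel₀ ht) hφx hφy hψx hψy

lemma CurveIso.symm (h : CurveIso F H) : CurveIso H F := h.map AlgEquiv.symm

lemma CurveIso.trans {F' : k[X]} (h : CurveIso F H) (h' : CurveIso H F') : CurveIso F F' :=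
  h.elim fun e => h'.map e.trans

lemma curveIso_of_form_eq [IsAlgClosed k] {g : ℕ} (hF : F.natDegree ≤ 2 * g + 2)
    (hH : H.natDegree ≤ 2 * g + 2) {M : Matrix (Fin 2) (Fin 2) k} (hM : M.det ≠ 0) {c : k}
    (hc : c ≠ 0) (h : subst M (form g H) = MvPolynomial.C c * form g F) : CurveIso H F := by
  obtain ⟨t, rfl⟩ := IsAlgClosed.exists_pow_nat_eq c two_pos
  exact ⟨(exists_algEquiv_of_form_eq hF hH hM (by rintro rfl; simp at hc) h).choose⟩

/-- The form of `F(aX)`. -/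
lemma subst_form_of_comp {g : ℕ} (hH : H.natDegree ≤ 2 * g + 2) (hF : F.natDegree ≤ 2 * g + 2)
    {a c : k} (h : H.comp (Polynomial.C a * Polynomial.X) = Polynomial.C c * F) :
    subst !![a, 0; 0, 1] (form g H) = MvPolynomial.C c * form g F := by
  have h2 : (MvPolynomial.C c * form g F).IsHomogeneous (2 * g + 2) := by
    rw [form, ← binaryForm_C_mul]
    exact isHomogeneous_binaryForm _ _
  refine eq_of_dehom_eq (isHomogeneous_subst (isHomogeneous_binaryForm _ _) _) h2 ?_
  have h1 := aeval_dehom_subst_binaryForm (B := k[X]) (d := 2 * g + 2) hH !![a, 0; 0, 1]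
    (x := Polynomial.X) (z := Polynomial.C a * Polynomial.X) (by simp [linPoly])
  simp only [Polynomial.aeval_X_left_apply] at h1
  rw [map_mul, dehom_C]
  rw [form, h1, form, dehom_binaryForm hF, ← h]
  simp [linPoly, Polynomial.comp, Polynomial.aeval_def]

lemma curveIso_of_comp [IsAlgClosed k] {g : ℕ} (hF : F.natDegree ≤ 2 * g + 2)
    (hH : H.natDegree ≤ 2 * g + 2) {a c : k} (ha : a ≠ 0) (hc : c ≠ 0)
    (h : H.comp (Polynomial.C a * Polynomial.X) = Polynomial.C c * F) : CurveIso H F :=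
  curveIso_of_form_eq hF hH (M := !![a, 0; 0, 1]) (by simpa using ha) hc
    (subst_form_of_comp hH hF h)

/-- Curves isomorphic to a hyperelliptic curve have the same absolute invariants. -/
lemma invariantPoint_eq_of_curveIso [CharZero k] {g : ℕ}
    (hg : g = 5 ∨ g = 7 ∨ g = 8 ∨ g = 9 ∨ g = 10 ∨ g = 12) (hF : IsHyperelliptic g F)
    (hH : H.natDegree ≤ 2 * g + 2) (h : CurveIso F H) :
    invariantPoint g F = invariantPoint g H := by
  obtain ⟨φ⟩ := h.symm
  obtain ⟨M, c, hM, hc, -, hs⟩ := exists_form_eq_of_algEquiv (g := g) (by omega) hF hH φ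
  refine invariantPoint_eq_of_form_eq (e := c⁻¹) (M := M) ?_ (inv_ne_zero hc) hM hg
  rw [hs, ← mul_assoc, ← map_mul, inv_mul_cancel₀ hc, map_one, one_mul]

end Converse

/-! ### Matrices of automorphisms -/

section Representation

variable {F : k[X]}

/-- The automorphism `σ` acts on the projective line by the invertible matrix `M`. The inverse
makes this compatible with products. -/
def Represents (σ : CurveAut F) (M : Matrix (Fin 2) (Fin 2) k) : Prop :=
  M.det ≠ 0 ∧ ActsBy σ⁻¹ M

lemma Represents.mul {σ τ : CurveAut F} {M N : Matrix (Fin 2) (Fin 2) k} (hσ : Represents σ M)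
    (hτ : Represents τ N) : Represents (σ * τ) (M * N) := by
  refine ⟨by rw [Matrix.det_mul]; exact mul_ne_zero hσ.1 hτ.1, ?_⟩
  have h0 := map_aeval_linPoly_mul (φ := (τ⁻¹ : CurveAut F).toAlgHom) hτ.2 M 0
  have h1 := map_aeval_linPoly_mul (φ := (τ⁻¹ : CurveAut F).toAlgHom) hτ.2 M 1
  rw [ActsBy, ← h0, ← h1, mul_inv_rev, AlgEquiv.mul_apply, ← mul_assoc]
  congr 1
  have h2 := congrArg (τ⁻¹ : CurveAut F) hσ.2
  rw [map_mul] at h2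
  exact h2

lemma coeff_eq_zero_of_quadratic_eq_zero {a b c : k}
    (h : Polynomial.C a * Polynomial.X ^ 2 + Polynomial.C b * Polynomial.X + Polynomial.C c = 0) :
    a = 0 ∧ b = 0 ∧ c = 0 := by
  refine ⟨?_, ?_, ?_⟩
  · simpa [Polynomial.coeff_X, Polynomial.coeff_C] using congrArg (fun f => Polynomial.coeff f 2) h
  · simpa [Polynomial.coeff_X, Polynomial.coeff_C] using congrArg (fun f => Polynomial.coeff f 1) h
  · simpa [Polynomial.coeff_X, Polynomial.coeff_C] using congrArg (fun f => Polynomial.coeff f 0) h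

/-- The matrix of an automorphism is unique up to a scalar factor. -/
lemma Represents.exists_smul_eq {σ : CurveAut F} {M N : Matrix (Fin 2) (Fin 2) k}
    (hM : Represents σ M) (hN : Represents σ N) : ∃ c : k, c ≠ 0 ∧ N = c • M := by
  have h : Polynomial.aeval (xGen F) (linPoly M 0 * linPoly N 1 - linPoly N 0 * linPoly M 1) =
      0 := by
    have h1 := hM.2
    have h2 := hN.2
    rw [ActsBy] at h1 h2
    rw [map_sub, map_mul, map_mul, ← h1, ← h2]
    ring
  have h' : linPoly M 0 * linPoly N 1 - linPoly N 0 * linPoly M 1 = 0 := by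
    by_contra h0
    exact aeval_xGen_ne_zero F h0 h
  have h'' : Polynomial.C (M 0 0 * N 1 0 - N 0 0 * M 1 0) * Polynomial.X ^ 2 +
      Polynomial.C (M 0 0 * N 1 1 + M 0 1 * N 1 0 - N 0 0 * M 1 1 - N 0 1 * M 1 0) * Polynomial.X +
      Polynomial.C (M 0 1 * N 1 1 - N 0 1 * M 1 1) = 0 := by
    rw [← h']
    simp only [linPoly, map_sub, map_mul, map_add]
    ring
  obtain ⟨e2, e1, e0⟩ := coeff_eq_zero_of_quadratic_eq_zero h''
  have hadj : N.adjugate * M =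
      (N 1 1 * M 0 0 - N 0 1 * M 1 0) • (1 : Matrix (Fin 2) (Fin 2) k) := by
    rw [Matrix.adjugate_fin_two]
    ext i j
    fin_cases i <;> fin_cases j <;>
      simp only [Matrix.mul_apply, Fin.sum_univ_two, Matrix.of_apply, Matrix.cons_val',
        Fin.zero_eta, Fin.mk_one, Matrix.cons_val_zero, Matrix.cons_val_one,
        Matrix.cons_val_fin_one,
        Matrix.smul_apply, Matrix.one_apply_eq, smul_eq_mul, Fin.isValue, ne_eq, zero_ne_one,
        one_ne_zero, not_false_eq_true, Matrix.one_apply_ne]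
    · ring
    · linear_combination e0
    · linear_combination -e2
    · linear_combination -e1
  generalize N 1 1 * M 0 0 - N 0 1 * M 1 0 = α at hadj
  have hα : α ≠ 0 := by
    rintro rfl
    have h1 := congrArg Matrix.det hadj
    rw [zero_smul, Matrix.det_mul, Matrix.det_adjugate, Matrix.det_zero] at h1
    simp [hM.1, hN.1] at h1
  have h2 : N.det • M = α • N := by
    rw [← Matrix.one_mul M, ← Matrix.smul_mul, ← Matrix.mul_adjugate, Matrix.mul_assoc, hadj,
      Matrix.mul_smul, Matrix.mul_one]
  refine ⟨α⁻¹ * N.det, mul_ne_zero (inv_ne_zero hα) hN.1, ?_⟩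
  rw [mul_smul, h2, smul_smul, inv_mul_cancel₀ hα, one_smul]

/-- Automorphisms fixing `X` are those with scalar matrices. -/
lemma Represents.map_xGen_eq_iff {σ : CurveAut F} {M : Matrix (Fin 2) (Fin 2) k}
    (hσ : Represents σ M) : σ (xGen F) = xGen F ↔ ∃ c : k, M = c • 1 := by
  have e : σ (xGen F) = xGen F ↔ σ⁻¹ (xGen F) = xGen F := by
    change _ ↔ σ.symm _ = _
    rw [AlgEquiv.symm_apply_eq, eq_comm]
  rw [e]
  constructor
  · intro h
    have h1 : Represents σ 1 := by
      refine ⟨by simp, ?_⟩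
      rw [ActsBy, linPoly_one_zero, linPoly_one_one, h]
      simp
    obtain ⟨c, -, hc⟩ := h1.exists_smul_eq hσ
    exact ⟨c, hc⟩
  · rintro ⟨c, rfl⟩
    have hc : c ≠ 0 := by
      rintro rfl
      exact hσ.1 (by rw [zero_smul, Matrix.det_zero])
    have h := hσ.2
    simp only [ActsBy, linPoly, Matrix.smul_apply, Matrix.one_apply_eq, smul_eq_mul, mul_one,
      Matrix.one_apply_ne (zero_ne_one : (0 : Fin 2) ≠ 1), mul_zero, map_zero, zero_mul, add_zero,
      zero_add, Matrix.one_apply_ne (one_ne_zero : (1 : Fin 2) ≠ 0), map_mul, Polynomial.aeval_C,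
      Polynomial.aeval_X] at h
    have hu : IsUnit (algebraMap k (FunctionField F) c) := hc.isUnit.map _
    rw [mul_comm] at h
    exact hu.mul_left_cancel h

variable {g : ℕ}

lemma exists_represents [CharZero k] (hg : 2 ≤ g) (hF : IsHyperelliptic g F) (σ : CurveAut F) :
    ∃ (M : Matrix (Fin 2) (Fin 2) k) (c : k), Represents σ M ∧ c ≠ 0 ∧
      subst M (form g F) = MvPolynomial.C c * form g F := by
  obtain ⟨M, c, hM, hc, hact, hs⟩ := exists_form_eq_of_algEquiv hg hF (H := F)
    (by have := hF.2; omega) σ⁻¹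
  exact ⟨M, c, ⟨hM, hact⟩, hc, hs⟩

lemma map_yGen_eq_or [CharZero k] (hF : IsHyperelliptic g F) {σ : CurveAut F}
    (h : σ (xGen F) = xGen F) : σ (yGen F) = yGen F ∨ σ (yGen F) = -yGen F := by
  have := (isField_functionField hF.1 (by have := hF.2; omega)).isDomain
  rw [← sq_eq_sq_iff_eq_or_eq_neg, ← map_pow, yGen_sq, ratHom_algebraMap]
  have e : σ (Polynomial.aeval (xGen F) F) = Polynomial.aeval (σ (xGen F)) F :=
    aeval_map_xGen σ.toAlgHom F
  rw [e, h]

/-- The only non-trivial automorphism fixing `X` is the hyperelliptic involution. -/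
lemma eq_of_map_xGen [CharZero k] (hF : IsHyperelliptic g F) {σ τ : CurveAut F}
    (hσ : σ (xGen F) = xGen F) (hτ : τ (xGen F) = xGen F) (hσ1 : σ ≠ 1) (hτ1 : τ ≠ 1) :
    σ = τ := by
  have key : ∀ ρ : CurveAut F, ρ (xGen F) = xGen F → ρ ≠ 1 → ρ (yGen F) = -yGen F := by
    intro ρ h h1
    refine (map_yGen_eq_or hF h).resolve_left fun h2 => h1 ?_
    have : ρ.toAlgHom = AlgHom.id k _ := algHom_ext_gens F h h2
    exact AlgEquiv.ext fun z => DFunLike.congr_fun this z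
  have : σ.toAlgHom = τ.toAlgHom := algHom_ext_gens F (hσ.trans hτ.symm)
    ((key σ hσ hσ1).trans (key τ hτ hτ1).symm)
  exact AlgEquiv.ext fun z => DFunLike.congr_fun this z

/-- Automorphisms fixing `X` are central. -/
lemma commute_of_map_xGen [CharZero k] (hg : 2 ≤ g) (hF : IsHyperelliptic g F) {σ : CurveAut F}
    (hσ : σ (xGen F) = xGen F) (τ : CurveAut F) : σ * τ = τ * σ := by
  by_cases h1 : σ = 1
  · rw [h1, one_mul, mul_one]
  obtain ⟨M, -, hM, -⟩ := exists_represents hg hF σ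
  obtain ⟨N, -, hN, -⟩ := exists_represents hg hF τ
  obtain ⟨N', -, hN', -⟩ := exists_represents hg hF τ⁻¹
  obtain ⟨c, rfl⟩ := hM.map_xGen_eq_iff.1 hσ
  have h2 : (τ * σ * τ⁻¹) (xGen F) = xGen F := by
    rw [((hN.mul hM).mul hN').map_xGen_eq_iff]
    have h3 := (hN.mul hN').map_xGen_eq_iff.1 (by rw [mul_inv_cancel]; rfl)
    obtain ⟨c', h3⟩ := h3
    exact ⟨c * c', by rw [Matrix.mul_smul, Matrix.mul_one, Matrix.smul_mul, h3, smul_smul]⟩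
  have h4 : τ * σ * τ⁻¹ ≠ 1 := by
    intro h
    rw [mul_inv_eq_one] at h
    exact h1 (mul_eq_left.1 h)
  have h5 := eq_of_map_xGen hF hσ h2 h1 h4
  rw [eq_mul_inv_iff_mul_eq] at h5
  exact h5

end Representation

/-! ### Normalizing the matrices of the tetrahedral group -/

section Normalization

lemma matrix_eq_iff {R : Type*} {a b c d a' b' c' d' : R} :
    (!![a, b; c, d] : Matrix (Fin 2) (Fin 2) R) = !![a', b'; c', d'] ↔
      a = a' ∧ b = b' ∧ c = c' ∧ d = d' := by
  constructor
  · intro h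
    exact ⟨congrFun (congrFun h 0) 0, congrFun (congrFun h 0) 1, congrFun (congrFun h 1) 0,
      congrFun (congrFun h 1) 1⟩
  · rintro ⟨rfl, rfl, rfl, rfl⟩
    rfl

lemma smul_matrix_eq (e a b c d : k) : e • (!![a, b; c, d] : Matrix (Fin 2) (Fin 2) k) =
    !![e * a, e * b; e * c, e * d] := by
  ext i j
  fin_cases i <;> fin_cases j <;> simp

lemma smul_one_matrix_eq (e : k) : e • (1 : Matrix (Fin 2) (Fin 2) k) = !![e, 0; 0, e] := by
  rw [Matrix.one_fin_two, smul_matrix_eq]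
  simp

/-- Matrices that are involutions of the projective line have trace zero. -/
lemma apply_one_one_eq_neg {A : Matrix (Fin 2) (Fin 2) k} {α : k} (hA : A * A = α • 1)
    (hns : ∀ c : k, A ≠ c • 1) : A 1 1 = -A 0 0 := by
  rw [A.eta_fin_two, smul_one_matrix_eq, Matrix.mul_fin_two, matrix_eq_iff] at hA
  obtain ⟨h1, h2, h3, h4⟩ := hA
  by_contra h
  have h' : A 0 0 + A 1 1 ≠ 0 := fun h0 => h (by linear_combination h0)
  have hq : A 0 1 = 0 := (mul_eq_zero.1 (by linear_combination h2 :
    A 0 1 * (A 0 0 + A 1 1) = 0)).resolve_right h'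
  have hr : A 1 0 = 0 := (mul_eq_zero.1 (by linear_combination h3 :
    A 1 0 * (A 0 0 + A 1 1) = 0)).resolve_right h'
  have hd : A 0 0 - A 1 1 = 0 := (mul_eq_zero.1 (by linear_combination h1 - h4 :
    (A 0 0 - A 1 1) * (A 0 0 + A 1 1) = 0)).resolve_right h'
  refine hns (A 0 0) ?_
  rw [smul_one_matrix_eq]
  conv_lhs => rw [A.eta_fin_two, hq, hr, ← sub_eq_zero.1 hd]

/-- Anticommuting involutions in a suitable basis. -/
lemma exists_basis_of_anticommuting [CharZero k] {p q r x y z : k} (hA : p ^ 2 + q * r = 1)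
    (hB : x ^ 2 + y * z = 1) (hAB : 2 * p * x + q * z + r * y = 0) :
    ∃ P : Matrix (Fin 2) (Fin 2) k, P.det ≠ 0 ∧
      !![p, q; r, -p] * P = P * !![1, 0; 0, -1] ∧ !![x, y; z, -x] * P = P * !![0, 1; 1, 0] := by
  obtain ⟨v, w, hv, h1, h2⟩ : ∃ v w : k, (v ≠ 0 ∨ w ≠ 0) ∧ p * v + q * w = v ∧
      r * v - p * w = w := by
    by_cases h : p + 1 = 0
    · by_cases hr : r = 0
      · exact ⟨q, 1 - p, Or.inr fun h0 => two_ne_zero (α := k) (by linear_combination h0 + h),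
          by ring, by linear_combination hA⟩
      · exact ⟨p + 1, r, Or.inr hr, by linear_combination hA, by ring⟩
    · exact ⟨p + 1, r, Or.inl h, by linear_combination hA, by ring⟩
  have h3 : p * (x * v + y * w) + q * (z * v - x * w) = -(x * v + y * w) := by
    linear_combination v * hAB - x * h1 - y * h2
  have h4 : r * (x * v + y * w) - p * (z * v - x * w) = -(z * v - x * w) := by
    linear_combination w * hAB - z * h1 + x * h2
  have h5 : x * (x * v + y * w) + y * (z * v - x * w) = v := by linear_combination v * hB
  have h6 : z * (x * v + y * w) - x * (z * v - x * w) = w := by linear_combination w * hB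
  generalize hm : x * v + y * w = m at *
  generalize hn : z * v - x * w = n at *
  refine ⟨!![v, m; w, n], ?_, ?_, ?_⟩
  · rw [Matrix.det_fin_two_of]
    intro h0
    -- a vector proportional to eigenvectors for different eigenvalues is zero
    have e1 : v * m = 0 := by
      have : 2 * (v * m) = 0 := by linear_combination -m * h1 + v * h3 - q * h0
      exact (mul_eq_zero.1 this).resolve_left two_ne_zero
    have e2 : w * n = 0 := by
      have : 2 * (w * n) = 0 := by linear_combination -n * h2 + w * h4 + r * h0
      exact (mul_eq_zero.1 this).resolve_left two_ne_zero
    have e3 : v * n = 0 := by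
      have : 2 * (v * n) = 0 := by linear_combination -n * h1 + w * h3 + (1 + p) * h0
      exact (mul_eq_zero.1 this).resolve_left two_ne_zero
    have e4 : w * m = 0 := by linear_combination e3 - h0
    rcases hv with hv | hw
    · have hm0 := (mul_eq_zero.1 e1).resolve_left hv
      have hn0 := (mul_eq_zero.1 e3).resolve_left hv
      exact hv (by rw [← h5, hm0, hn0]; ring)
    · have hm0 := (mul_eq_zero.1 e4).resolve_left hw
      have hn0 := (mul_eq_zero.1 e2).resolve_left hw
      exact hw (by rw [← h6, hm0, hn0]; ring)
  · rw [Matrix.mul_fin_two, Matrix.mul_fin_two, matrix_eq_iff]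
    refine ⟨?_, ?_, ?_, ?_⟩
    · linear_combination h1
    · linear_combination h3
    · linear_combination h2
    · linear_combination h4
  · rw [Matrix.mul_fin_two, Matrix.mul_fin_two, matrix_eq_iff]
    refine ⟨?_, ?_, ?_, ?_⟩
    · linear_combination hm
    · linear_combination h5
    · linear_combination hn
    · linear_combination h6

/-- A matrix permuting the involutions of a Klein four-group cyclically, in a basis as above. -/
lemma exists_eq_smul_of_semicommuting [CharZero k] {T : Matrix (Fin 2) (Fin 2) k} (hT : T.det ≠ 0)
    {c c' : k} (h1 : T * !![1, 0; 0, -1] = c • (!![0, 1; 1, 0] * T))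
    (h2 : T * !![0, 1; 1, 0] = c' • (!![1, 0; 0, -1] * !![0, 1; 1, 0] * T)) :
    ∃ i τ : k, i ^ 2 = -1 ∧ τ ≠ 0 ∧ (T = τ • !![1, i; 1, -i] ∨
      !![1, 0; 0, -1] * T = τ • !![1, i; 1, -i]) := by
  rw [Matrix.det_fin_two] at hT
  rw [T.eta_fin_two] at h1 h2 ⊢
  generalize T 0 0 = x at *
  generalize T 0 1 = y at *
  generalize T 1 0 = z at *
  generalize T 1 1 = w at *
  simp only [Matrix.mul_fin_two, smul_matrix_eq, matrix_eq_iff] at h1 h2 ⊢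
  obtain ⟨a1, a2, a3, a4⟩ := h1
  obtain ⟨b1, b2, b3, b4⟩ := h2
  have hx : x ≠ 0 := by
    rintro rfl
    have : z = 0 := by linear_combination a3
    exact hT (by rw [this]; ring)
  have hc : (c - 1) * (c + 1) = 0 := by
    have : x * ((c - 1) * (c + 1)) = 0 := by linear_combination -a1 - c * a3
    exact (mul_eq_zero.1 this).resolve_left hx
  have hc' : c' ^ 2 = -1 := by
    have : x * (c' ^ 2 + 1) = 0 := by linear_combination b2 + c' * b3
    linear_combination (mul_eq_zero.1 this).resolve_left hx
  rcases mul_eq_zero.1 hc with h | h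
  · refine ⟨c', x, hc', hx, Or.inl ⟨?_, ?_, ?_, ?_⟩⟩
    · ring
    · linear_combination b1 + c' * a3 + c' * x * h
    · linear_combination a3 + x * h
    · linear_combination b3
  · refine ⟨-c', x, by rw [neg_sq, hc'], hx, Or.inr ⟨?_, ?_, ?_, ?_⟩⟩
    · ring
    · linear_combination b1 + c' * a3 + c' * x * h
    · linear_combination -a3 - x * h
    · linear_combination -b3

/-- Matrices generating a tetrahedral group in a suitable basis. -/
lemma exists_tetrahedral_basis [IsAlgClosed k] [CharZero k] {A B T : Matrix (Fin 2) (Fin 2) k}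
    (hA0 : A.det ≠ 0) (hB0 : B.det ≠ 0) (hT0 : T.det ≠ 0) {α β δ c c' : k} (hA : A * A = α • 1)
    (hB : B * B = β • 1) (hAB : A * B * (A * B) = δ • 1) (hA1 : ∀ c : k, A ≠ c • 1)
    (hB1 : ∀ c : k, B ≠ c • 1) (hAB1 : ∀ c : k, A * B ≠ c • 1) (h1 : T * A = c • (B * T))
    (h2 : T * B = c' • (A * B * T)) :
    ∃ (P : Matrix (Fin 2) (Fin 2) k) (i ω ω' τ : k), P.det ≠ 0 ∧ i ^ 2 = -1 ∧ ω ≠ 0 ∧ ω' ≠ 0 ∧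
      τ ≠ 0 ∧ A * P = P * (ω • !![1, 0; 0, -1]) ∧ B * P = P * (ω' • !![0, 1; 1, 0]) ∧
      (T * P = P * (τ • !![1, i; 1, -i]) ∨ A * T * P = P * (τ • !![1, i; 1, -i])) := by
  have tA := apply_one_one_eq_neg hA hA1
  have tB := apply_one_one_eq_neg hB hB1
  have tAB := apply_one_one_eq_neg hAB hAB1
  have hα : α ≠ 0 := by
    rintro rfl
    have := congrArg Matrix.det hA
    rw [zero_smul, Matrix.det_mul, Matrix.det_zero] at this
    simp [hA0] at this
  have hβ : β ≠ 0 := by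
    rintro rfl
    have := congrArg Matrix.det hB
    rw [zero_smul, Matrix.det_mul, Matrix.det_zero] at this
    simp [hB0] at this
  obtain ⟨ω, rfl⟩ := IsAlgClosed.exists_pow_nat_eq α two_pos
  obtain ⟨ω', rfl⟩ := IsAlgClosed.exists_pow_nat_eq β two_pos
  have hω : ω ≠ 0 := by rintro rfl; simp at hα
  have hω' : ω' ≠ 0 := by rintro rfl; simp at hβ
  obtain ⟨P, hP, hPA, hPB⟩ := exists_basis_of_anticommuting (p := ω⁻¹ * A 0 0) (q := ω⁻¹ * A 0 1)
    (r := ω⁻¹ * A 1 0) (x := ω'⁻¹ * B 0 0) (y := ω'⁻¹ * B 0 1) (z := ω'⁻¹ * B 1 0) (by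
      have := congrFun (congrFun hA 0) 0
      simp [Matrix.mul_apply, Fin.sum_univ_two] at this
      field_simp
      linear_combination this) (by
      have := congrFun (congrFun hB 0) 0
      simp [Matrix.mul_apply, Fin.sum_univ_two] at this
      field_simp
      linear_combination this) (by
      simp only [Matrix.mul_apply, Fin.sum_univ_two] at tAB
      field_simp
      rw [tA, tB] at tAB
      linear_combination tAB)
  have eA : A = ω • !![ω⁻¹ * A 0 0, ω⁻¹ * A 0 1; ω⁻¹ * A 1 0, -(ω⁻¹ * A 0 0)] := by
    conv_lhs => rw [A.eta_fin_two, tA]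
    rw [smul_matrix_eq, matrix_eq_iff]
    refine ⟨?_, ?_, ?_, ?_⟩ <;> field_simp
  have eB : B = ω' • !![ω'⁻¹ * B 0 0, ω'⁻¹ * B 0 1; ω'⁻¹ * B 1 0, -(ω'⁻¹ * B 0 0)] := by
    conv_lhs => rw [B.eta_fin_two, tB]
    rw [smul_matrix_eq, matrix_eq_iff]
    refine ⟨?_, ?_, ?_, ?_⟩ <;> field_simp
  have hPA' : A * P = P * (ω • !![1, 0; 0, -1]) := by
    conv_lhs => rw [eA, Matrix.smul_mul, hPA]
    rw [Matrix.mul_smul]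
  have hPB' : B * P = P * (ω' • !![0, 1; 1, 0]) := by
    conv_lhs => rw [eB, Matrix.smul_mul, hPB]
    rw [Matrix.mul_smul]
  have hu : IsUnit P.det := hP.isUnit
  set T' := P⁻¹ * T * P with hT'
  have hPT : T * P = P * T' := by
    rw [hT', Matrix.mul_assoc, Matrix.mul_nonsing_inv_cancel_left _ _ hu]
  have hT'0 : T'.det ≠ 0 := by
    intro h0
    have := congrArg Matrix.det hPT
    rw [Matrix.det_mul, Matrix.det_mul, h0, mul_zero] at this
    exact mul_ne_zero hT0 hP this
  have hinj : ∀ {U V : Matrix (Fin 2) (Fin 2) k}, P * U = P * V → U = V := fun {U V} h => by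
    have := congrArg (P⁻¹ * ·) h
    simpa only [Matrix.nonsing_inv_mul_cancel_left _ _ hu] using this
  have h1' : T' * !![1, 0; 0, -1] = (ω⁻¹ * (c * ω')) • (!![0, 1; 1, 0] * T') := by
    rw [mul_smul, eq_inv_smul_iff₀ hω]
    apply hinj
    rw [← Matrix.mul_smul T', ← Matrix.mul_assoc P, ← hPT, Matrix.mul_assoc, ← hPA',
      ← Matrix.mul_assoc, h1, mul_smul, Matrix.mul_smul, Matrix.smul_mul]
    congr 1
    rw [← Matrix.smul_mul, ← Matrix.mul_assoc P, ← hPB', Matrix.mul_assoc, hPT, Matrix.mul_assoc]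
  have h2' : T' * !![0, 1; 1, 0] =
      (ω'⁻¹ * (c' * (ω * ω'))) • (!![1, 0; 0, -1] * !![0, 1; 1, 0] * T') := by
    rw [mul_smul, eq_inv_smul_iff₀ hω']
    apply hinj
    rw [← Matrix.mul_smul T', ← Matrix.mul_assoc P, ← hPT, Matrix.mul_assoc, ← hPB',
      ← Matrix.mul_assoc, h2, mul_smul, Matrix.mul_smul, Matrix.smul_mul]
    congr 1
    rw [Matrix.mul_assoc, hPT, ← Matrix.mul_assoc, Matrix.mul_assoc A, hPB', ← Matrix.mul_assoc A,
      hPA', mul_smul]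
    simp only [Matrix.mul_assoc, Matrix.smul_mul, Matrix.mul_smul]
    rw [smul_comm]
  obtain ⟨i, τ, hi, hτ, h⟩ := exists_eq_smul_of_semicommuting hT'0 h1' h2'
  rcases h with h | h
  · exact ⟨P, i, ω, ω', τ, hP, hi, hω, hω', hτ, hPA', hPB', Or.inl (by rw [hPT, h])⟩
  · refine ⟨P, i, ω, ω', ω * τ, hP, hi, hω, hω', mul_ne_zero hω hτ, hPA', hPB', Or.inr ?_⟩
    rw [Matrix.mul_assoc, hPT, ← Matrix.mul_assoc, hPA', Matrix.mul_assoc, Matrix.smul_mul, h,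
      smul_smul]

lemma subst_smul {d : ℕ} {f : MvPolynomial (Fin 2) k} (hf : f.IsHomogeneous d)
    (M : Matrix (Fin 2) (Fin 2) k) (c : k) :
    subst (c • M) f = MvPolynomial.C (c ^ d) * subst M f := by
  have key : ∀ h : MvPolynomial (Fin 2) k, h.IsHomogeneous d →
      subst (c • (1 : Matrix (Fin 2) (Fin 2) k)) h = MvPolynomial.C (c ^ d) * h := by
    intro h hh
    rw [← binaryForm_dehom hh, binaryForm, map_sum, Finset.mul_sum]
    refine Finset.sum_congr rfl fun i hi => ?_
    have hi' : i ≤ d := Nat.lt_succ_iff.1 (Finset.mem_range.1 hi)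
    rw [map_mul, map_mul, map_pow, map_pow, subst_C, subst_X, subst_X]
    have : c ^ d = c ^ i * c ^ (d - i) := by rw [← pow_add, Nat.add_sub_cancel' hi']
    rw [this]
    simp only [Matrix.smul_apply, Matrix.one_apply_eq, smul_eq_mul, mul_one,
      Matrix.one_apply_ne (zero_ne_one : (0 : Fin 2) ≠ 1), mul_zero, map_zero, zero_mul, add_zero,
      zero_add, Matrix.one_apply_ne (one_ne_zero : (1 : Fin 2) ≠ 0), map_mul, map_pow]
    ring
  rw [← key _ (isHomogeneous_subst hf M), subst_subst, Matrix.mul_smul, Matrix.mul_one]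

end Normalization

section TetrahedralForm

variable {F : k[X]} {g : ℕ}

/-- A tetrahedral group of automorphisms of the line that lift to the curve: up to a linear
substitution, the form of the curve is semi-invariant under the standard generators. -/
lemma exists_semiinvariant_form [IsAlgClosed k] [CharZero k] (hg : 2 ≤ g) (hF : IsHyperelliptic g F)
    {a b t : CurveAut F} (ha : a (xGen F) ≠ xGen F) (hb : b (xGen F) ≠ xGen F)
    (hab : (a * b) (xGen F) ≠ xGen F) (ha2 : (a * a) (xGen F) = xGen F)
    (hb2 : (b * b) (xGen F) = xGen F) (hab2 : (a * b * (a * b)) (xGen F) = xGen F)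
    (h1 : t * a = b * t) (h2 : t * b = a * b * t) :
    ∃ (P : Matrix (Fin 2) (Fin 2) k) (i α β γ : k), P.det ≠ 0 ∧ i ^ 2 = -1 ∧
      subst !![1, 0; 0, -1] (subst P (form g F)) = MvPolynomial.C α * subst P (form g F) ∧
      subst !![0, 1; 1, 0] (subst P (form g F)) = MvPolynomial.C β * subst P (form g F) ∧
      subst !![1, i; 1, -i] (subst P (form g F)) = MvPolynomial.C γ * subst P (form g F) := by
  obtain ⟨A, a', hA, -, hAf⟩ := exists_represents hg hF a
  obtain ⟨B, b', hB, -, hBf⟩ := exists_represents hg hF b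
  obtain ⟨T, t', hT, -, hTf⟩ := exists_represents hg hF t
  obtain ⟨α, hα⟩ := (hA.mul hA).map_xGen_eq_iff.1 ha2
  obtain ⟨β, hβ⟩ := (hB.mul hB).map_xGen_eq_iff.1 hb2
  obtain ⟨δ, hδ⟩ := ((hA.mul hB).mul (hA.mul hB)).map_xGen_eq_iff.1 hab2
  have e1 := hT.mul hA
  rw [h1] at e1
  obtain ⟨c, -, hc⟩ := (hB.mul hT).exists_smul_eq e1
  have e2 := hT.mul hB
  rw [h2] at e2
  obtain ⟨c', -, hc'⟩ := ((hA.mul hB).mul hT).exists_smul_eq e2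
  obtain ⟨P, i, ω, ω', τ, hP, hi, hω, hω', hτ, hPA, hPB, hPT⟩ := exists_tetrahedral_basis hA.1 hB.1
    hT.1 hα hβ hδ (fun c h => ha (hA.map_xGen_eq_iff.2 ⟨c, h⟩))
    (fun c h => hb (hB.map_xGen_eq_iff.2 ⟨c, h⟩))
    (fun c h => hab ((hA.mul hB).map_xGen_eq_iff.2 ⟨c, h⟩)) hc hc'
  have key : ∀ {M N : Matrix (Fin 2) (Fin 2) k} {m ν : k}, ν ≠ 0 →
      subst M (form g F) = MvPolynomial.C m * form g F → M * P = P * (ν • N) →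
      ∃ n : k, subst N (subst P (form g F)) = MvPolynomial.C n * subst P (form g F) := by
    intro M N m ν hν hM hMP
    have hhom := isHomogeneous_subst (isHomogeneous_binaryForm (2 * g + 2) F) P
    have e := subst_smul hhom N ν
    have e3 : subst (ν • N) (subst P (form g F)) = MvPolynomial.C m * subst P (form g F) := by
      rw [subst_subst, ← hMP, ← subst_subst, hM, map_mul, subst_C]
    have hν' : ν ^ (2 * g + 2) ≠ 0 := pow_ne_zero _ hν
    refine ⟨(ν ^ (2 * g + 2))⁻¹ * m, ?_⟩
    rw [map_mul, mul_assoc, ← e3, form, e, ← mul_assoc, ← map_mul, inv_mul_cancel₀ hν', map_one,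
      one_mul]
  obtain ⟨α', hα'⟩ := key hω hAf hPA
  obtain ⟨β', hβ'⟩ := key hω' hBf hPB
  obtain ⟨γ, hγ⟩ : ∃ γ : k, subst !![1, i; 1, -i] (subst P (form g F)) =
      MvPolynomial.C γ * subst P (form g F) := by
    rcases hPT with h | h
    · exact key hτ hTf h
    · refine key hτ (m := t' * a') ?_ h
      rw [← subst_subst, hAf, map_mul, subst_C, hTf, map_mul]
      ring
  exact ⟨P, i, α', β', γ, hP, hi, hα', hβ', hγ⟩

end TetrahedralForm

/-! ### The action of the groups on the line -/

section Groups

variable {F : k[X]} {g : ℕ}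

lemma mul_self_eq_trace_smul_sub (A : Matrix (Fin 2) (Fin 2) k) :
    A * A = (A 0 0 + A 1 1) • A - A.det • 1 := by
  rw [Matrix.det_fin_two]
  ext i j
  fin_cases i <;> fin_cases j <;>
    simp [Matrix.mul_apply, Fin.sum_univ_two] <;> ring

lemma exists_eq_smul_add_of_sq {A : Matrix (Fin 2) (Fin 2) k} (h : ∀ c : k, A * A ≠ c • 1) :
    ∃ m n : k, A = m • (A * A) + n • 1 := by
  have hA := mul_self_eq_trace_smul_sub A
  have ht : A 0 0 + A 1 1 ≠ 0 := by
    intro h0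
    rw [h0, zero_smul, zero_sub, ← neg_smul] at hA
    exact h _ hA
  refine ⟨(A 0 0 + A 1 1)⁻¹, (A 0 0 + A 1 1)⁻¹ * A.det, ?_⟩
  rw [mul_smul, ← smul_add, hA, sub_add_cancel, smul_smul, inv_mul_cancel₀ ht, one_smul]

/-- The central involution of a quaternion group of automorphisms fixes `X`: otherwise its matrix
would not be scalar, and the matrices of the two generators, which are polynomials in it, would
commute. -/
lemma map_xGen_of_quaternion [CharZero k] (hg : 2 ≤ g) (hF : IsHyperelliptic g F)
    {a b z : CurveAut F} (ha : a * a = z) (hb : b * b = z) (hab : a * b = z * (b * a)) :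
    z (xGen F) = xGen F := by
  obtain ⟨A, -, hA, -⟩ := exists_represents hg hF a
  obtain ⟨B, -, hB, -⟩ := exists_represents hg hF b
  have hA2 : Represents z (A * A) := ha ▸ hA.mul hA
  have hB2 : Represents z (B * B) := hb ▸ hB.mul hB
  rw [hA2.map_xGen_eq_iff]
  by_contra! hns
  obtain ⟨e, -, he⟩ := hA2.exists_smul_eq hB2
  obtain ⟨m, n, hm⟩ := exists_eq_smul_add_of_sq hns
  obtain ⟨m', n', hm'⟩ := exists_eq_smul_add_of_sq (A := B) fun c hc => by
    obtain ⟨c', hc'⟩ := hA2.map_xGen_eq_iff.1 (hB2.map_xGen_eq_iff.2 ⟨c, hc⟩)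
    exact hns c' hc'
  have hcomm : A * B = B * A := by
    rw [he] at hm'
    generalize A * A = Z at *
    rw [hm, hm']
    simp only [Matrix.mul_add, Matrix.add_mul, Matrix.smul_mul, Matrix.mul_smul, Matrix.mul_one,
      Matrix.one_mul, smul_smul, smul_add]
    module
  have h1 := hA2.mul (hB.mul hA)
  rw [← hab, ← hcomm] at h1
  obtain ⟨c, -, hc⟩ := (hA.mul hB).exists_smul_eq h1
  refine hns c ?_
  have hu : IsUnit (A * B).det := (hA.mul hB).1.isUnit
  have := congrArg (· * (A * B)⁻¹) hc
  simpa only [Matrix.mul_nonsing_inv_cancel_right _ _ hu, Matrix.smul_mul,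
    Matrix.mul_nonsing_inv _ hu] using this

lemma map_xGen_ne_of_not_commute [CharZero k] (hg : 2 ≤ g) (hF : IsHyperelliptic g F) {G : Type*}
    [Group G] {φ : G →* CurveAut F} (hφ : Function.Injective φ) {a t : G} (h : a * t ≠ t * a) :
    φ a (xGen F) ≠ xGen F := by
  intro ha
  apply h
  apply hφ
  rw [map_mul, map_mul]
  exact commute_of_map_xGen hg hF ha _

/-- Generators of the image of the group in the automorphism group of the line. -/
lemma exists_tetrahedral_generators [CharZero k] (hg : 2 ≤ g) (hF : IsHyperelliptic g F)
    (hG : ContainsG g (CurveAut F)) :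
    ∃ a b t : CurveAut F, a (xGen F) ≠ xGen F ∧ b (xGen F) ≠ xGen F ∧
      (a * b) (xGen F) ≠ xGen F ∧ (a * a) (xGen F) = xGen F ∧ (b * b) (xGen F) = xGen F ∧
      (a * b * (a * b)) (xGen F) = xGen F ∧ t * a = b * t ∧ t * b = a * b * t := by
  rw [ContainsG] at hG
  split_ifs at hG with hodd
  · obtain ⟨φ, hφ⟩ := hG
    let a : Z2A4 := (1, ⟨Equiv.swap 0 1 * Equiv.swap 2 3,
      Equiv.Perm.mem_alternatingGroup.2 (by decide)⟩)
    let b : Z2A4 := (1, ⟨Equiv.swap 0 2 * Equiv.swap 1 3,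
      Equiv.Perm.mem_alternatingGroup.2 (by decide)⟩)
    let t : Z2A4 := (1, ⟨Equiv.swap 1 2 * Equiv.swap 2 3,
      Equiv.Perm.mem_alternatingGroup.2 (by decide)⟩)
    have ha : a * a = 1 := by decide
    have hb : b * b = 1 := by decide
    have hab : a * b * (a * b) = 1 := by decide
    refine ⟨φ a, φ b, φ t, map_xGen_ne_of_not_commute hg hF hφ (t := t) (by decide),
      map_xGen_ne_of_not_commute hg hF hφ (t := t) (by decide), ?_, ?_, ?_, ?_, ?_, ?_⟩
    · rw [← map_mul]
      exact map_xGen_ne_of_not_commute hg hF hφ (t := t) (by decide)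
    · rw [← map_mul, ha, map_one, AlgEquiv.one_apply]
    · rw [← map_mul, hb, map_one, AlgEquiv.one_apply]
    · rw [← map_mul, ← map_mul, hab, map_one, AlgEquiv.one_apply]
    · rw [← map_mul, ← map_mul]
      exact congrArg φ (by decide)
    · rw [← map_mul, ← map_mul, ← map_mul]
      exact congrArg φ (by decide)
  · obtain ⟨φ, hφ⟩ := hG
    let a : SL23 := ⟨!![0, 1; 2, 0], by decide⟩
    let b : SL23 := ⟨!![1, 1; 1, 2], by decide⟩
    let t : SL23 := ⟨!![0, 1; 2, 2], by decide⟩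
    let z : SL23 := ⟨!![2, 0; 0, 2], by decide⟩
    have ha : a * a = z := Subtype.ext (by decide)
    have hb : b * b = z := Subtype.ext (by decide)
    have hab : a * b * (a * b) = z := Subtype.ext (by decide)
    have hz : φ z (xGen F) = xGen F := by
      refine map_xGen_of_quaternion hg hF (a := φ a) (b := φ b) ?_ ?_ ?_
      · rw [← map_mul, ha]
      · rw [← map_mul, hb]
      · rw [← map_mul, ← map_mul, ← map_mul]
        exact congrArg φ (Subtype.ext (by decide))
    refine ⟨φ a, φ b, φ t, map_xGen_ne_of_not_commute hg hF hφ (t := t) (by decide),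
      map_xGen_ne_of_not_commute hg hF hφ (t := t) (by decide), ?_, ?_, ?_, ?_, ?_, ?_⟩
    · rw [← map_mul]
      exact map_xGen_ne_of_not_commute hg hF hφ (t := t) (by decide)
    · rw [← map_mul, ha, hz]
    · rw [← map_mul, hb, hz]
    · rw [← map_mul, ← map_mul, hab, hz]
    · rw [← map_mul, ← map_mul]
      exact congrArg φ (Subtype.ext (by decide))
    · rw [← map_mul, ← map_mul, ← map_mul]
      exact congrArg φ (Subtype.ext (by decide))

lemma z2a4_pow_six (a : Z2A4) : a ^ 6 = 1 := by
  revert a; decide +kernel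

lemma sl23_pow_twelve (a : SL23) : a ^ 12 = 1 := by
  revert a; decide +kernel

end Groups

/-! ### Semi-invariants of the tetrahedral group -/

section SemiInvariants

/-- The form `Φ_s = X⁴ + 2sX²Z² + Z⁴`. For `s² = -3`, the forms `Φ_s` and `Φ_{-s}` are
semi-invariants of the tetrahedral group. -/
def quartic (s : k) : MvPolynomial (Fin 2) k :=
  MvPolynomial.X 0 ^ 4 + MvPolynomial.C (2 * s) * (MvPolynomial.X 0 ^ 2 * MvPolynomial.X 1 ^ 2) +
    MvPolynomial.X 1 ^ 4

lemma subst_quartic {s i : k} (hs : s ^ 2 = -3) (hi : i ^ 2 = -1) :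
    subst !![1, i; 1, -i] (quartic s) = MvPolynomial.C (2 + 2 * s) * quartic s := by
  have hi' : (MvPolynomial.C i : MvPolynomial (Fin 2) k) ^ 2 = -1 := by
    rw [← map_pow, hi, map_neg, map_one]
  have hs' : (MvPolynomial.C s : MvPolynomial (Fin 2) k) ^ 2 = -3 := by
    rw [← map_pow, hs, map_neg, map_ofNat]
  have e : subst !![1, i; 1, -i] (quartic s) =
      (MvPolynomial.X 0 + MvPolynomial.C i * MvPolynomial.X 1) ^ 4 + 2 * MvPolynomial.C s *
      ((MvPolynomial.X 0 + MvPolynomial.C i * MvPolynomial.X 1) ^ 2 *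
        (MvPolynomial.X 0 - MvPolynomial.C i * MvPolynomial.X 1) ^ 2) +
      (MvPolynomial.X 0 - MvPolynomial.C i * MvPolynomial.X 1) ^ 4 := by
    simp [quartic, subst_X, sub_eq_add_neg]
    exact Or.inl (Or.inl (map_ofNat _ 2))
  rw [e, quartic]
  simp only [map_add, map_mul, map_ofNat]
  generalize (MvPolynomial.X 0 : MvPolynomial (Fin 2) k) = x
  generalize (MvPolynomial.X 1 : MvPolynomial (Fin 2) k) = z
  generalize (MvPolynomial.C i : MvPolynomial (Fin 2) k) = I at *
  generalize (MvPolynomial.C s : MvPolynomial (Fin 2) k) = S at *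
  linear_combination (12 * x ^ 2 * z ^ 2 - 4 * S * x ^ 2 * z ^ 2 +
    (2 + 2 * S) * z ^ 4 * (I ^ 2 - 1)) * hi' - 4 * x ^ 2 * z ^ 2 * hs'

/-- The form `XZ(X⁴ - Z⁴)`, a semi-invariant of the tetrahedral group. -/
def sextic : MvPolynomial (Fin 2) k :=
  MvPolynomial.X 0 * MvPolynomial.X 1 * (MvPolynomial.X 0 ^ 4 - MvPolynomial.X 1 ^ 4)

lemma subst_sextic {i : k} (hi : i ^ 2 = -1) :
    subst !![1, i; 1, -i] (sextic : MvPolynomial (Fin 2) k) = MvPolynomial.C (8 * i) * sextic := by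
  have hi' : (MvPolynomial.C i : MvPolynomial (Fin 2) k) ^ 2 = -1 := by
    rw [← map_pow, hi, map_neg, map_one]
  have e : subst !![1, i; 1, -i] (sextic : MvPolynomial (Fin 2) k) =
      (MvPolynomial.X 0 + MvPolynomial.C i * MvPolynomial.X 1) *
      (MvPolynomial.X 0 - MvPolynomial.C i * MvPolynomial.X 1) *
      ((MvPolynomial.X 0 + MvPolynomial.C i * MvPolynomial.X 1) ^ 4 -
      (MvPolynomial.X 0 - MvPolynomial.C i * MvPolynomial.X 1) ^ 4) := by
    simp [sextic, subst_X, sub_eq_add_neg]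
  rw [e, sextic]
  simp only [map_mul, map_ofNat]
  generalize (MvPolynomial.X 0 : MvPolynomial (Fin 2) k) = x
  generalize (MvPolynomial.X 1 : MvPolynomial (Fin 2) k) = z
  generalize (MvPolynomial.C i : MvPolynomial (Fin 2) k) = I at *
  linear_combination (- 8 * I * x * z ^ 5 * (I ^ 2 - 1)) * hi'

lemma dehom_quartic (s : k) : dehom (quartic s) =
    Polynomial.X ^ 4 + 2 * Polynomial.C s * Polynomial.X ^ 2 + 1 := by
  simp [quartic, dehom_X_zero, dehom_X_one]
  exact Or.inl (map_ofNat _ 2)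

lemma dehom_sextic : dehom (sextic : MvPolynomial (Fin 2) k) =
    Polynomial.X * (Polynomial.X ^ 4 - 1) := by
  simp [sextic, dehom_X_zero, dehom_X_one]

lemma isHomogeneous_quartic (s : k) : (quartic s).IsHomogeneous 4 := by
  have h0 := MvPolynomial.isHomogeneous_X_pow (R := k) (0 : Fin 2)
  have h1 := MvPolynomial.isHomogeneous_X_pow (R := k) (1 : Fin 2)
  have hC := MvPolynomial.isHomogeneous_C (Fin 2) (2 * s)
  exact ((h0 4).add (hC.mul ((h0 2).mul (h1 2)))).add (h1 4)

/-- The products of given degree of the two quartics are linearly independent, as the quotient of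
the quartics takes infinitely many values. -/
lemma eq_zero_of_sum_quartic [IsAlgClosed k] [CharZero k] {s : k} (hs : s ≠ 0) {n : ℕ} {c : ℕ → k}
    (h : ∑ j ∈ Finset.range (n + 1), MvPolynomial.C (c j) * quartic s ^ j * quartic (-s) ^ (n - j) =
      0) : ∀ j ≤ n, c j = 0 := by
  set p : k[X] := ∑ j ∈ Finset.range (n + 1), Polynomial.C (c j) * Polynomial.X ^ j with hp
  have hp0 : p = 0 := by
    apply Polynomial.eq_zero_of_infinite_isRoot
    refine Set.Infinite.mono (s := {1}ᶜ) ?_ (Set.Finite.infinite_compl (Set.finite_singleton _))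
    intro r hr
    have hr' : 1 - r ≠ 0 := sub_ne_zero.2 (Ne.symm hr)
    obtain ⟨w, hw⟩ := IsAlgClosed.exists_root
      (Polynomial.X ^ 2 + Polynomial.C (2 * s * (1 + r) / (1 - r)) * Polynomial.X + 1 : k[X]) (by
        have : (Polynomial.X ^ 2 + Polynomial.C (2 * s * (1 + r) / (1 - r)) * Polynomial.X + 1 :
            k[X]).degree = 2 := by compute_degree!
        rw [this]
        norm_num)
    simp only [Polynomial.IsRoot, Polynomial.eval_add, Polynomial.eval_mul, Polynomial.eval_pow,
      Polynomial.eval_X, Polynomial.eval_C, Polynomial.eval_one] at hw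
    field_simp at hw
    obtain ⟨x, rfl⟩ := IsAlgClosed.exists_pow_nat_eq w two_pos
    set Φ := MvPolynomial.eval ![x, 1] (quartic s) with hΦ
    set Ψ := MvPolynomial.eval ![x, 1] (quartic (-s)) with hΨ
    have e1 : Φ = x ^ 4 + 2 * s * x ^ 2 + 1 := by simp [hΦ, quartic]
    have e2 : Ψ = x ^ 4 - 2 * s * x ^ 2 + 1 := by simp [hΨ, quartic]; ring
    have e3 : Φ = r * Ψ := by rw [e1, e2]; linear_combination hw
    have e4 : Ψ ≠ 0 := by
      intro h0
      rw [h0, mul_zero] at e3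
      have hx : 4 * s * x ^ 2 = 0 := by linear_combination e2 - e1 + e3 - h0
      have hx0 : x = 0 := by simpa [hs] using hx
      rw [e3, hx0] at e1
      norm_num at e1
    have h' := congrArg (MvPolynomial.eval ![x, 1]) h
    rw [map_sum, map_zero] at h'
    simp only [map_mul, map_pow, MvPolynomial.eval_C, ← hΦ, ← hΨ, e3] at h'
    have h2 : p.eval r * Ψ ^ n = 0 := by
      rw [hp, Polynomial.eval_finsetSum, Finset.sum_mul, ← h']
      refine Finset.sum_congr rfl fun j hj => ?_
      have hj' : j ≤ n := Nat.lt_succ_iff.1 (Finset.mem_range.1 hj)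
      simp only [Polynomial.eval_mul, Polynomial.eval_pow, Polynomial.eval_X, Polynomial.eval_C]
      rw [mul_pow, ← Nat.add_sub_cancel' hj', pow_add, Nat.add_sub_cancel_left]
      ring
    exact (mul_eq_zero.1 h2).resolve_right (pow_ne_zero _ e4)
  intro j hj
  have := congrArg (fun q => Polynomial.coeff q j) hp0
  rw [hp] at this
  simpa [Polynomial.finsetSum_coeff, Polynomial.coeff_X_pow, Nat.lt_succ_iff, hj] using this

/-- A form in `X⁴+Z⁴` and `X²Z²` is a form in the two quartics. -/
lemma exists_sum_quartic [CharZero k] {s : k} (hs : s ≠ 0) (n : ℕ) (e : ℕ → k) : ∃ b : ℕ → k,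
    ∑ j ∈ Finset.range (n + 1), MvPolynomial.C (e j) *
      (MvPolynomial.X 0 ^ 4 + MvPolynomial.X 1 ^ 4 : MvPolynomial (Fin 2) k) ^ j *
      (MvPolynomial.X 0 ^ 2 * MvPolynomial.X 1 ^ 2) ^ (n - j) =
    ∑ j ∈ Finset.range (n + 1), MvPolynomial.C (b j) * quartic s ^ j * quartic (-s) ^ (n - j) := by
  set p : k[X] := ∑ j ∈ Finset.range (n + 1), Polynomial.C (e j) * Polynomial.X ^ j with hp
  have hpc : ∀ j ∈ Finset.range (n + 1), p.coeff j = e j := by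
    intro j hj
    simp [hp, Polynomial.coeff_X_pow, -Finset.mem_range, hj]
  have hhom := isHomogeneous_subst (isHomogeneous_binaryForm n p)
    !![1 / 2, 1 / 2; 1 / (4 * s), -(1 / (4 * s))]
  have h := binaryForm_dehom hhom
  generalize dehom (subst !![1 / 2, 1 / 2; 1 / (4 * s), -(1 / (4 * s))] (binaryForm n p)) = q at h
  refine ⟨q.coeff, ?_⟩
  have h2 := congrArg (MvPolynomial.aeval ![quartic s, quartic (-s)] :
    MvPolynomial (Fin 2) k →ₐ[k] MvPolynomial (Fin 2) k) h
  have hU : MvPolynomial.C (1 / 2) * quartic s + MvPolynomial.C (1 / 2) * quartic (-s) =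
      (MvPolynomial.X 0 ^ 4 + MvPolynomial.X 1 ^ 4 : MvPolynomial (Fin 2) k) := by
    have : (MvPolynomial.C (1 / 2) : MvPolynomial (Fin 2) k) * 2 = 1 := by
      rw [← map_ofNat MvPolynomial.C 2, ← map_mul]; norm_num
    simp only [quartic, mul_neg, map_neg]
    linear_combination (MvPolynomial.X 0 ^ 4 + MvPolynomial.X 1 ^ 4) * this
  have hV : MvPolynomial.C (1 / (4 * s)) * quartic s + MvPolynomial.C (-(1 / (4 * s))) *
      quartic (-s) = (MvPolynomial.X 0 ^ 2 * MvPolynomial.X 1 ^ 2 : MvPolynomial (Fin 2) k) := by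
    have : (MvPolynomial.C (1 / (4 * s)) : MvPolynomial (Fin 2) k) * MvPolynomial.C (2 * s) * 2 =
        1 := by
      rw [← map_ofNat MvPolynomial.C 2, ← map_mul, ← map_mul, ← map_one MvPolynomial.C]
      congr 1
      field_simp
      norm_num
    simp only [quartic, mul_neg, map_neg]
    linear_combination (MvPolynomial.X 0 ^ 2 * MvPolynomial.X 1 ^ 2) * this
  have hX : ∀ M : Matrix (Fin 2) (Fin 2) k, ∀ j, MvPolynomial.aeval ![quartic s, quartic (-s)]
      (subst M (MvPolynomial.X j)) =
      MvPolynomial.C (M j 0) * quartic s + MvPolynomial.C (M j 1) * quartic (-s) := by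
    intro M j
    rw [subst_X]
    simp [MvPolynomial.algebraMap_eq]
  rw [binaryForm, binaryForm] at h2
  simp only [map_sum, map_mul, map_pow, subst_C, MvPolynomial.aeval_C, MvPolynomial.algebraMap_eq,
    MvPolynomial.aeval_X, hX] at h2
  simp only [Matrix.of_apply, Matrix.cons_val', Matrix.cons_val_zero, Matrix.cons_val_one,
    Matrix.cons_val_fin_one] at h2
  rw [hU, hV] at h2
  rw [h2]
  exact Finset.sum_congr rfl fun j hj => by rw [hpc j hj]

end SemiInvariants

/-! ### Semi-invariants of the Klein four-group -/

section Classification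

variable {F : k[X]} {g : ℕ}

/-- The linear substitution of the form of a hyperelliptic curve is not divisible by the square of
a non-constant form. -/
lemma not_eq_sq_mul (hF : IsHyperelliptic g F) {P : Matrix (Fin 2) (Fin 2) k} (hP : P.det ≠ 0)
    {e : ℕ} (he : 1 ≤ e) {U W : MvPolynomial (Fin 2) k} (hU : U.IsHomogeneous e)
    (h : subst P (form g F) = U ^ 2 * W) : False := by
  have hu : IsUnit P.det := hP.isUnit
  have hdeg := hF.2
  have hF0 : F ≠ 0 := hF.1.ne_zero
  have h1 : form g F = subst P⁻¹ U ^ 2 * subst P⁻¹ W := by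
    rw [← map_pow, ← map_mul, ← h, subst_subst, Matrix.mul_nonsing_inv _ hu, subst_one]
  have hU' := isHomogeneous_subst hU P⁻¹
  generalize subst P⁻¹ U = U' at *
  generalize subst P⁻¹ W = W' at *
  have hd : F = dehom U' ^ 2 * dehom W' := by
    rw [← map_pow, ← map_mul, ← h1, form, dehom_binaryForm (by omega)]
  have hW0 : W' ≠ 0 := by
    rintro rfl
    exact hF0 (by rw [hd]; simp)
  have hU0 : U' ≠ 0 := by
    rintro rfl
    exact hF0 (by rw [hd]; simp)
  have hunit : IsUnit (dehom U') := hF.1 _ ⟨dehom W', by rw [← pow_two]; exact hd⟩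
  have hW : (dehom W').natDegree ≤ W'.totalDegree := by
    have := MvPolynomial.aeval_natDegree_le (m := W'.totalDegree) (n := 1) W' le_rfl
      ![(Polynomial.X : k[X]), 1] (by
        intro i
        fin_cases i <;> simp)
    rwa [mul_one] at this
  have htd := congrArg MvPolynomial.totalDegree h1
  rw [MvPolynomial.totalDegree_mul_of_isDomain (pow_ne_zero _ hU0) hW0, pow_two,
    MvPolynomial.totalDegree_mul_of_isDomain hU0 hU0, hU'.totalDegree hU0] at htd
  have hle := (isHomogeneous_binaryForm (2 * g + 2) F).totalDegree_le
  rw [form] at htd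
  have hFd : F.natDegree = (dehom W').natDegree := by
    have hW1 : dehom W' ≠ 0 := by
      intro h0
      exact hF0 (by rw [hd, h0, mul_zero])
    conv_lhs => rw [hd]
    rw [Polynomial.natDegree_mul (pow_ne_zero _ hunit.ne_zero) hW1, Polynomial.natDegree_pow,
      Polynomial.natDegree_eq_zero_of_isUnit hunit]
    simp
  omega

/-- The characters of the two involutions are determined by the degree: the element of order three
permutes the involutions, and a product of two of them is the third, up to a scalar. -/
lemma semiinvariant_sign {f : MvPolynomial (Fin 2) k} (hf0 : f ≠ 0)
    (hf : f.IsHomogeneous (2 * g + 2)) {i α β γ : k} (hi : i ^ 2 = -1)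
    (h1 : subst !![1, 0; 0, -1] f = MvPolynomial.C α * f)
    (h2 : subst !![0, 1; 1, 0] f = MvPolynomial.C β * f)
    (h3 : subst !![1, i; 1, -i] f = MvPolynomial.C γ * f) (hγ : γ ≠ 0) (hβ : β ≠ 0) :
    α = (-1) ^ (g + 1) ∧ β = (-1) ^ (g + 1) := by
  have hC : ∀ a b : k, MvPolynomial.C a * f = MvPolynomial.C b * f → a = b := fun a b h =>
    MvPolynomial.C_injective _ _ (mul_right_cancel₀ hf0 h)
  have e1 : β * γ = γ * α := by
    apply hC
    have h : subst (!![0, 1; 1, 0] * !![1, i; 1, -i]) f =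
        subst (!![1, i; 1, -i] * !![1, 0; 0, -1]) f := by
      congr 2
      simp
    rw [← subst_subst, ← subst_subst, h2, h3, map_mul, map_mul, subst_C, subst_C, h1, h3,
      ← mul_assoc, ← mul_assoc, ← map_mul, ← map_mul] at h
    exact h
  have e2 : γ * β = i ^ (2 * g + 2) * (α * (β * γ)) := by
    apply hC
    have h : subst (!![1, i; 1, -i] * !![0, 1; 1, 0]) f =
        subst (i • (!![1, 0; 0, -1] * (!![0, 1; 1, 0] * !![1, i; 1, -i]))) f := by
      congr 2
      rw [Matrix.mul_fin_two, Matrix.mul_fin_two, Matrix.mul_fin_two, smul_matrix_eq, matrix_eq_iff]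
      refine ⟨?_, ?_, ?_, ?_⟩
      · ring
      · linear_combination hi
      · ring
      · linear_combination hi
    rw [subst_smul hf, ← subst_subst, ← subst_subst, ← subst_subst, h3, h1, map_mul, map_mul,
      map_mul, subst_C, subst_C, subst_C, h2, map_mul, subst_C, h3] at h
    simp only [map_mul]
    linear_combination h
  have hαβ : β = α := mul_right_cancel₀ hγ (by rw [e1, mul_comm])
  have e3 : i ^ (2 * g + 2) = (-1) ^ (g + 1) := by
    rw [show 2 * g + 2 = 2 * (g + 1) by ring, pow_mul, hi]
  have e4 : (-1 : k) ^ (g + 1) * (-1) ^ (g + 1) = 1 := by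
    rw [← mul_pow]; norm_num
  have e5 : α = (-1) ^ (g + 1) := by
    rw [e3] at e2
    have : 1 = (-1) ^ (g + 1) * α := by
      apply mul_right_cancel₀ (mul_ne_zero hβ hγ)
      linear_combination e2
    linear_combination -(-1) ^ (g + 1) * this - α * e4
  exact ⟨e5, hαβ.trans e5⟩

/-- In terms of coefficients, semi-invariance under the four-group is a condition on the parity of
the exponents and a symmetry. -/
lemma coeff_of_semiinvariant [CharZero k] {d : ℕ} {G : k[X]} {ε : k}
    (h1 : subst !![1, 0; 0, -1] (binaryForm d G) = MvPolynomial.C ε * binaryForm d G)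
    (h2 : subst !![0, 1; 1, 0] (binaryForm d G) = MvPolynomial.C ε * binaryForm d G) (m : ℕ)
    (hm : m ≤ d) : (-1) ^ (d - m) * G.coeff m = ε * G.coeff m ∧
      G.coeff (d - m) = ε * G.coeff m := by
  have e0 : ∀ m ≤ d, (dehom (binaryForm d G)).coeff m = G.coeff m := by
    intro m hm
    simp [binaryForm, dehom_X_zero, dehom_X_one, Polynomial.finsetSum_coeff,
      Polynomial.coeff_X_pow, hm]
  constructor
  · have h := congrArg (fun f => Polynomial.coeff (dehom f) m) h1
    simp only [map_mul, dehom_C, Polynomial.coeff_C_mul, e0 m hm] at h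
    rw [← h, dehom_subst_binaryForm, Polynomial.finsetSum_coeff, Finset.sum_eq_single m]
    · rw [show linPoly !![1, 0; 0, -1] 0 = (Polynomial.X : k[X]) by simp [linPoly],
        show linPoly !![1, 0; 0, -1] 1 = Polynomial.C (-1 : k) by simp [linPoly], ← map_pow,
        Polynomial.coeff_mul_C, Polynomial.coeff_C_mul]
      simp
      ring
    · intro j _ hj
      rw [show linPoly !![1, 0; 0, -1] 0 = (Polynomial.X : k[X]) by simp [linPoly],
        show linPoly !![1, 0; 0, -1] 1 = Polynomial.C (-1 : k) by simp [linPoly], ← map_pow,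
        Polynomial.coeff_mul_C, Polynomial.coeff_C_mul, Polynomial.coeff_X_pow, if_neg hj.symm]
      simp
    · intro h
      exact absurd (Finset.mem_range.2 (Nat.lt_succ_iff.2 hm)) h
  · have h := congrArg (fun f => Polynomial.coeff (dehom f) m) h2
    simp only [map_mul, dehom_C, Polynomial.coeff_C_mul, e0 m hm] at h
    rw [← h, dehom_subst_binaryForm, Polynomial.finsetSum_coeff, Finset.sum_eq_single (d - m)]
    · rw [show linPoly !![0, 1; 1, 0] 0 = (1 : k[X]) by simp [linPoly],
        show linPoly !![0, 1; 1, 0] 1 = (Polynomial.X : k[X]) by simp [linPoly],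
        Nat.sub_sub_self hm]
      simp
    · intro j hj hjm
      have hj' : j ≤ d := Nat.lt_succ_iff.1 (Finset.mem_range.1 hj)
      rw [show linPoly !![0, 1; 1, 0] 0 = (1 : k[X]) by simp [linPoly],
        show linPoly !![0, 1; 1, 0] 1 = (Polynomial.X : k[X]) by simp [linPoly], one_pow, mul_one,
        Polynomial.coeff_C_mul, Polynomial.coeff_X_pow, if_neg (by omega), mul_zero]
    · intro h
      exact absurd (Finset.mem_range.2 (by omega)) h

/-- A semi-invariant of the four-group is, up to the sextic, a form in `X⁴+Z⁴` and `X²Z²`. -/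
lemma exists_sum_of_semiinvariant [CharZero k] {E : MvPolynomial (Fin 2) k} {n : ℕ}
    (hgn : (E = 1 ∧ (g = 5 ∧ n = 3 ∨ g = 7 ∧ n = 4 ∨ g = 9 ∧ n = 5)) ∨
      (E = sextic ∧ (g = 8 ∧ n = 3 ∨ g = 10 ∧ n = 4 ∨ g = 12 ∧ n = 5))) {G : k[X]}
    (h1 : subst !![1, 0; 0, -1] (binaryForm (2 * g + 2) G) =
      MvPolynomial.C ((-1) ^ (g + 1)) * binaryForm (2 * g + 2) G)
    (h2 : subst !![0, 1; 1, 0] (binaryForm (2 * g + 2) G) =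
      MvPolynomial.C ((-1) ^ (g + 1)) * binaryForm (2 * g + 2) G) :
    ∃ e : ℕ → k, binaryForm (2 * g + 2) G = E * ∑ j ∈ Finset.range (n + 1), MvPolynomial.C (e j) *
      (MvPolynomial.X 0 ^ 4 + MvPolynomial.X 1 ^ 4 : MvPolynomial (Fin 2) k) ^ j *
      (MvPolynomial.X 0 ^ 2 * MvPolynomial.X 1 ^ 2) ^ (n - j) := by
  -- only the coefficients `a m` with `m` even, resp. odd, occur, and those of `X^m Z^(d-m)` and
  -- `X^(d-m) Z^m` agree, up to sign; such pairs of terms are expressed by power sums in `X⁴`, `Z⁴`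
  have h := coeff_of_semiinvariant h1 h2
  generalize hc : G.coeff = a at h
  rcases hgn with ⟨rfl, hg⟩ | ⟨rfl, hg⟩
  · have hε : (-1 : k) ^ (g + 1) = 1 := Even.neg_one_pow (by
      rcases hg with h | h | h <;> rw [h.1] <;> decide)
    rw [hε] at h
    have hz : ∀ m ≤ 2 * g + 2, Odd m → a m = 0 := by
      intro m hm hmo
      have := (h m hm).1
      rw [Odd.neg_one_pow (by
        obtain ⟨l, hl⟩ := hmo
        exact ⟨g - l, by omega⟩), one_mul, neg_one_mul] at this
      exact neg_eq_self.1 this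
    have hs : ∀ m ≤ 2 * g + 2, a (2 * g + 2 - m) = a m := fun m hm => by rw [(h m hm).2, one_mul]
    rcases hg with ⟨rfl, rfl⟩ | ⟨rfl, rfl⟩ | ⟨rfl, rfl⟩
    · have z : a 1 = 0 ∧ a 3 = 0 ∧ a 5 = 0 ∧ a 7 = 0 ∧ a 9 = 0 ∧ a 11 = 0 := by
        refine ⟨?_, ?_, ?_, ?_, ?_, ?_⟩ <;>
          exact hz _ (by norm_num) (by decide)
      have s : a 12 = a 0 ∧ a 10 = a 2 ∧ a 8 = a 4 :=
        ⟨hs 0 (by norm_num), hs 2 (by norm_num), hs 4 (by norm_num)⟩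
      refine ⟨fun j => [-2 * a 2 + a 6, -3 * a 0 + a 4, a 2, a 0].getD j 0, ?_⟩
      simp only [binaryForm, Finset.sum_range_succ, Finset.sum_range_zero, hc, z, s,
        List.getD_cons_zero, List.getD_cons_succ, map_zero, map_add, map_mul, map_neg,
        map_ofNat]
      ring
    · have z : a 1 = 0 ∧ a 3 = 0 ∧ a 5 = 0 ∧ a 7 = 0 ∧ a 9 = 0 ∧ a 11 = 0 ∧ a 13 = 0 ∧
          a 15 = 0 := by
        refine ⟨?_, ?_, ?_, ?_, ?_, ?_, ?_, ?_⟩ <;>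
          exact hz _ (by norm_num) (by decide)
      have s : a 16 = a 0 ∧ a 14 = a 2 ∧ a 12 = a 4 ∧ a 10 = a 6 :=
        ⟨hs 0 (by norm_num), hs 2 (by norm_num), hs 4 (by norm_num), hs 6 (by norm_num)⟩
      refine ⟨fun j => [2 * a 0 - 2 * a 4 + a 8, -3 * a 2 + a 6, -4 * a 0 + a 4, a 2, a 0].getD j 0,
        ?_⟩
      simp only [binaryForm, Finset.sum_range_succ, Finset.sum_range_zero, hc, z, s,
        List.getD_cons_zero, List.getD_cons_succ, map_zero, map_add, map_sub, map_mul, map_neg,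
        map_ofNat]
      ring
    · have z : a 1 = 0 ∧ a 3 = 0 ∧ a 5 = 0 ∧ a 7 = 0 ∧ a 9 = 0 ∧ a 11 = 0 ∧ a 13 = 0 ∧ a 15 = 0 ∧
        a 17 = 0 ∧ a 19 = 0 := by
        refine ⟨?_, ?_, ?_, ?_, ?_, ?_, ?_, ?_, ?_, ?_⟩ <;>
          exact hz _ (by norm_num) (by decide)
      have s : a 20 = a 0 ∧ a 18 = a 2 ∧ a 16 = a 4 ∧ a 14 = a 6 ∧ a 12 = a 8 :=
        ⟨hs 0 (by norm_num), hs 2 (by norm_num), hs 4 (by norm_num), hs 6 (by norm_num),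
          hs 8 (by norm_num)⟩
      refine ⟨fun j => [2 * a 2 - 2 * a 6 + a 10, 5 * a 0 - 3 * a 4 + a 8, -4 * a 2 + a 6,
        -5 * a 0 + a 4, a 2, a 0].getD j 0, ?_⟩
      simp only [binaryForm, Finset.sum_range_succ, Finset.sum_range_zero, hc, z, s,
        List.getD_cons_zero, List.getD_cons_succ, map_zero, map_add, map_sub, map_mul, map_neg,
        map_ofNat]
      ring
  · have hε : (-1 : k) ^ (g + 1) = -1 := Odd.neg_one_pow (by
      rcases hg with h | h | h <;> rw [h.1] <;> decide)
    rw [hε] at h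
    have hz : ∀ m ≤ 2 * g + 2, Even m → a m = 0 := by
      intro m hm hmo
      have := (h m hm).1
      rw [Even.neg_one_pow (by
        obtain ⟨l, hl⟩ := hmo
        exact ⟨g + 1 - l, by omega⟩), one_mul, neg_one_mul] at this
      exact self_eq_neg.1 this
    have hs : ∀ m ≤ 2 * g + 2, a (2 * g + 2 - m) = -a m := fun m hm => by
      rw [(h m hm).2, neg_one_mul]
    rcases hg with ⟨rfl, rfl⟩ | ⟨rfl, rfl⟩ | ⟨rfl, rfl⟩
    · have z : a 0 = 0 ∧ a 2 = 0 ∧ a 4 = 0 ∧ a 6 = 0 ∧ a 8 = 0 ∧ a 10 = 0 ∧ a 12 = 0 ∧ a 14 = 0 ∧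
        a 16 = 0 ∧ a 18 = 0 := by
        refine ⟨?_, ?_, ?_, ?_, ?_, ?_, ?_, ?_, ?_, ?_⟩ <;>
          exact hz _ (by norm_num) (by decide)
      have z' : a 9 = 0 := self_eq_neg.1 (hs 9 (by norm_num))
      have s : a 17 = -a 1 ∧ a 15 = -a 3 ∧ a 13 = -a 5 ∧ a 11 = -a 7 :=
        ⟨hs 1 (by norm_num), hs 3 (by norm_num), hs 5 (by norm_num), hs 7 (by norm_num)⟩
      refine ⟨fun j => [a 3 - a 7, 2 * a 1 - a 5, -a 3, -a 1].getD j 0, ?_⟩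
      simp only [binaryForm, Finset.sum_range_succ, Finset.sum_range_zero, hc, z, s,
        List.getD_cons_zero, List.getD_cons_succ, map_zero, map_sub, map_mul, map_neg,
        map_ofNat, z', sextic]
      ring
    · have z : a 0 = 0 ∧ a 2 = 0 ∧ a 4 = 0 ∧ a 6 = 0 ∧ a 8 = 0 ∧ a 10 = 0 ∧ a 12 = 0 ∧ a 14 = 0 ∧
        a 16 = 0 ∧ a 18 = 0 ∧ a 20 = 0 ∧ a 22 = 0 := by
        refine ⟨?_, ?_, ?_, ?_, ?_, ?_, ?_, ?_, ?_, ?_, ?_, ?_⟩ <;>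
          exact hz _ (by norm_num) (by decide)
      have z' : a 11 = 0 := self_eq_neg.1 (hs 11 (by norm_num))
      have s : a 21 = -a 1 ∧ a 19 = -a 3 ∧ a 17 = -a 5 ∧ a 15 = -a 7 ∧ a 13 = -a 9 :=
        ⟨hs 1 (by norm_num), hs 3 (by norm_num), hs 5 (by norm_num), hs 7 (by norm_num),
          hs 9 (by norm_num)⟩
      refine ⟨fun j => [-a 1 + a 5 - a 9, 2 * a 3 - a 7, 3 * a 1 - a 5, -a 3, -a 1].getD j 0, ?_⟩
      simp only [binaryForm, Finset.sum_range_succ, Finset.sum_range_zero, hc, z, s,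
        List.getD_cons_zero, List.getD_cons_succ, map_zero, map_add, map_sub, map_mul, map_neg,
        map_ofNat, z', sextic]
      ring
    · have z : a 0 = 0 ∧ a 2 = 0 ∧ a 4 = 0 ∧ a 6 = 0 ∧ a 8 = 0 ∧ a 10 = 0 ∧ a 12 = 0 ∧ a 14 = 0 ∧
        a 16 = 0 ∧ a 18 = 0 ∧ a 20 = 0 ∧ a 22 = 0 ∧ a 24 = 0 ∧ a 26 = 0 := by
        refine ⟨?_, ?_, ?_, ?_, ?_, ?_, ?_, ?_, ?_, ?_, ?_, ?_, ?_, ?_⟩ <;>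
          exact hz _ (by norm_num) (by decide)
      have z' : a 13 = 0 := self_eq_neg.1 (hs 13 (by norm_num))
      have s : a 25 = -a 1 ∧ a 23 = -a 3 ∧ a 21 = -a 5 ∧ a 19 = -a 7 ∧ a 17 = -a 9 ∧ a 15 = -a 11 :=
        ⟨hs 1 (by norm_num), hs 3 (by norm_num), hs 5 (by norm_num), hs 7 (by norm_num),
          hs 9 (by norm_num), hs 11 (by norm_num)⟩
      refine ⟨fun j => [-a 3 + a 7 - a 11, -3 * a 1 + 2 * a 5 - a 9, 3 * a 3 - a 7, 4 * a 1 - a 5,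
        -a 3, -a 1].getD j 0, ?_⟩
      simp only [binaryForm, Finset.sum_range_succ, Finset.sum_range_zero, hc, z, s,
        List.getD_cons_zero, List.getD_cons_succ, map_zero, map_add, map_sub, map_mul, map_neg,
        map_ofNat, z', sextic]
      ring

end Classification

/-! ### Semi-invariants of the tetrahedral group in terms of the quartics -/

section NormalForms

variable {F : k[X]} {g : ℕ}

lemma cube_two_add {s : k} (hs : s ^ 2 = -3) : (2 + 2 * s) ^ 3 = -64 := by
  linear_combination (24 + 8 * s) * hs

/-- Two products `Φ_s ^ j * Φ_{-s} ^ (n - j)` occurring in a semi-invariant have the same character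
under the element of order three, so that their exponents `j` agree modulo three. -/
lemma coeff_mul_coeff_eq_zero [CharZero k] {s ε γ : k} (hs : s ^ 2 = -3) (hε : ε ≠ 0) {n : ℕ}
    {b : ℕ → k}
    (hb : ∀ j ≤ n, b j * (ε * (2 + 2 * s) ^ j * (2 - 2 * s) ^ (n - j) - γ) = 0) {j l : ℕ}
    (hjl : j + l ≤ n) (hl : l % 3 ≠ 0) : b j = 0 ∨ b (j + l) = 0 := by
  by_contra! h
  have hs0 : s ≠ 0 := by rintro rfl; norm_num at hs
  have e1 := (mul_eq_zero.1 (hb j (by omega))).resolve_left h.1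
  have e2 := (mul_eq_zero.1 (hb (j + l) hjl)).resolve_left h.2
  have cp := cube_two_add hs
  have cm : (2 - 2 * s) ^ 3 = -64 := by
    have := cube_two_add (s := -s) (by rw [neg_sq, hs])
    rw [← this]; ring
  have hp0 : 2 + 2 * s ≠ 0 := by intro h0; rw [h0] at cp; norm_num at cp
  have hm0 : 2 - 2 * s ≠ 0 := by intro h0; rw [h0] at cm; norm_num at cm
  have e3 : (2 + 2 * s) ^ l = (2 - 2 * s) ^ l := by
    have hx : ε * (2 + 2 * s) ^ j * (2 - 2 * s) ^ (n - (j + l)) ≠ 0 :=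
      mul_ne_zero (mul_ne_zero hε (pow_ne_zero _ hp0)) (pow_ne_zero _ hm0)
    apply mul_left_cancel₀ hx
    rw [show n - j = n - (j + l) + l by omega, pow_add] at e1
    rw [pow_add] at e2
    linear_combination e2 - e1
  -- only the residue of the exponent modulo three matters
  have h3 : ∀ x : k, x ^ 3 = -64 → x ^ l = (-64) ^ (l / 3) * x ^ (l % 3) := by
    intro x hx
    conv_lhs => rw [← Nat.div_add_mod l 3, pow_add, pow_mul, hx]
  rw [h3 _ cp, h3 _ cm] at e3
  have e4 := mul_left_cancel₀ (pow_ne_zero _ (by norm_num)) e3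
  have h5 : l % 3 = 1 ∨ l % 3 = 2 := by omega
  rcases h5 with h5 | h5
  · rw [h5] at e4
    have : 4 * s = 0 := by linear_combination e4
    simp [hs0] at this
  · rw [h5] at e4
    have : 16 * s = 0 := by linear_combination e4
    simp [hs0] at this

/-- A semi-invariant of the tetrahedral group is, up to the sextic, a combination of products of
the two quartics with the same character. -/
lemma exists_sum_of_tetrahedral [IsAlgClosed k] [CharZero k] {E : MvPolynomial (Fin 2) k} {n : ℕ}
    (hgn : (E = 1 ∧ (g = 5 ∧ n = 3 ∨ g = 7 ∧ n = 4 ∨ g = 9 ∧ n = 5)) ∨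
      (E = sextic ∧ (g = 8 ∧ n = 3 ∨ g = 10 ∧ n = 4 ∨ g = 12 ∧ n = 5)))
    {f : MvPolynomial (Fin 2) k} (hf0 : f ≠ 0) (hf : f.IsHomogeneous (2 * g + 2)) {i α β γ s : k}
    (hi : i ^ 2 = -1) (hs : s ^ 2 = -3)
    (h1 : subst !![1, 0; 0, -1] f = MvPolynomial.C α * f)
    (h2 : subst !![0, 1; 1, 0] f = MvPolynomial.C β * f)
    (h3 : subst !![1, i; 1, -i] f = MvPolynomial.C γ * f) :
    ∃ b : ℕ → k, f = E * ∑ j ∈ Finset.range (n + 1),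
        MvPolynomial.C (b j) * quartic s ^ j * quartic (-s) ^ (n - j) ∧
      ∀ j l, j + l ≤ n → l % 3 ≠ 0 → b j = 0 ∨ b (j + l) = 0 := by
  have hs0 : s ≠ 0 := by rintro rfl; norm_num at hs
  have hi0 : i ≠ 0 := by rintro rfl; norm_num at hi
  -- the eigenvalues are not zero, since the matrices are invertible
  have hne : ∀ (M : Matrix (Fin 2) (Fin 2) k) (c : k), M.det ≠ 0 →
      subst M f = MvPolynomial.C c * f → c ≠ 0 := by
    rintro M c hM h rfl
    rw [map_zero, zero_mul] at h
    have := congrArg (subst M⁻¹) h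
    rw [subst_subst, Matrix.mul_nonsing_inv _ hM.isUnit, subst_one, map_zero] at this
    exact hf0 this
  have hβ := hne _ _ (by simp) h2
  have hγ := hne _ _ (by
    rw [Matrix.det_fin_two_of]
    intro h
    have : 2 * i = 0 := by linear_combination -h
    simp [hi0] at this) h3
  obtain ⟨rfl, rfl⟩ := semiinvariant_sign hf0 hf hi h1 h2 h3 hγ hβ
  obtain ⟨ε, hε, hE0, hE⟩ : ∃ ε : k, ε ≠ 0 ∧ E ≠ 0 ∧
      subst !![1, i; 1, -i] E = MvPolynomial.C ε * E := by
    rcases hgn with ⟨rfl, -⟩ | ⟨rfl, -⟩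
    · exact ⟨1, one_ne_zero, one_ne_zero, by simp⟩
    · refine ⟨8 * i, mul_ne_zero (by norm_num) hi0, ?_, subst_sextic hi⟩
      intro h
      have := congrArg (MvPolynomial.eval ![2, 1]) h
      norm_num [sextic] at this
  obtain ⟨e, he⟩ := exists_sum_of_semiinvariant hgn (G := dehom f)
    (by rw [binaryForm_dehom hf]; exact h1) (by rw [binaryForm_dehom hf]; exact h2)
  rw [binaryForm_dehom hf] at he
  obtain ⟨b, hb⟩ := exists_sum_quartic hs0 n e
  rw [hb] at he
  refine ⟨b, he, fun j l hjl hl => coeff_mul_coeff_eq_zero (γ := γ) hs hε ?_ hjl hl⟩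
  apply eq_zero_of_sum_quartic hs0 (c := fun j => b j *
    (ε * (2 + 2 * s) ^ j * (2 - 2 * s) ^ (n - j) - γ))
  apply mul_left_cancel₀ hE0
  rw [mul_zero]
  have hm := subst_quartic (s := -s) (by rw [neg_sq, hs]) hi
  rw [mul_neg, ← sub_eq_add_neg] at hm
  have hp := subst_quartic hs hi
  rw [he, map_mul, hE, map_sum] at h3
  simp only [map_mul, map_pow, subst_C, hm, hp] at h3
  rw [← sub_eq_zero] at h3
  rw [← h3]
  simp only [Finset.mul_sum, ← Finset.sum_sub_distrib]
  refine Finset.sum_congr rfl fun j _ => ?_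
  simp only [map_mul, map_sub, map_pow, mul_pow]
  ring

end NormalForms

/-! ### Isomorphisms with the normal forms -/

section NormalFormIso

variable {F : k[X]} {g : ℕ}

/-- The product of the quartics, apart from the general semi-invariant of degree twelve, in the
form of a curve; `n` is the number of quartics in the form. -/
def quarticFactor (n : ℕ) (s : k) : MvPolynomial (Fin 2) k :=
  if n = 3 then 1 else if n = 4 then quartic s else quartic s * quartic (-s)

/-- A square-free combination of products of the two quartics with the same character is a
combination of the cubes of the quartics, times a product of quartics depending on the degree
only. -/
lemma exists_cubes {E f : MvPolynomial (Fin 2) k} {n : ℕ} (hn : n = 3 ∨ n = 4 ∨ n = 5) {s : k}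
    {b : ℕ → k} (hf : f = E * ∑ j ∈ Finset.range (n + 1),
      MvPolynomial.C (b j) * quartic s ^ j * quartic (-s) ^ (n - j))
    (hb : ∀ j l, j + l ≤ n → l % 3 ≠ 0 → b j = 0 ∨ b (j + l) = 0)
    (hsq : ∀ (e : ℕ) (U W : MvPolynomial (Fin 2) k), 1 ≤ e → U.IsHomogeneous e → f ≠ U ^ 2 * W) :
    ∃ s' α β : k, (s' = s ∨ s' = -s) ∧ f = E * quarticFactor n s' *
      (MvPolynomial.C α * quartic s' ^ 3 + MvPolynomial.C β * quartic (-s') ^ 3) := by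
  have hp : ∀ W, f ≠ quartic s ^ 2 * W := fun W =>
    hsq 4 _ W (by norm_num) (isHomogeneous_quartic s)
  have hm : ∀ W, f ≠ quartic (-s) ^ 2 * W := fun W =>
    hsq 4 _ W (by norm_num) (isHomogeneous_quartic (-s))
  rcases hn with rfl | rfl | rfl
  · simp only [Finset.sum_range_succ, Finset.sum_range_zero] at hf
    have b1 : b 1 = 0 := by
      by_contra h
      have h0 := (hb 0 1 (by norm_num) (by norm_num)).resolve_right h
      have h2 := (hb 1 1 (by norm_num) (by norm_num)).resolve_left h
      have h3 := (hb 1 2 (by norm_num) (by norm_num)).resolve_left h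
      norm_num at h2 h3
      refine hm (E * MvPolynomial.C (b 1) * quartic s) ?_
      rw [hf, h0, h2, h3, map_zero]
      ring
    have b2 : b 2 = 0 := by
      by_contra h
      have h0 := (hb 0 2 (by norm_num) (by norm_num)).resolve_right h
      have h3 := (hb 2 1 (by norm_num) (by norm_num)).resolve_left h
      norm_num at h3
      refine hp (E * MvPolynomial.C (b 2) * quartic (-s)) ?_
      rw [hf, h0, b1, h3, map_zero]
      ring
    refine ⟨s, b 3, b 0, Or.inl rfl, ?_⟩
    rw [hf, b1, b2, map_zero, quarticFactor, if_pos rfl]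
    ring
  · simp only [Finset.sum_range_succ, Finset.sum_range_zero] at hf
    have b2 : b 2 = 0 := by
      by_contra h
      have h0 := (hb 0 2 (by norm_num) (by norm_num)).resolve_right h
      have h1 := (hb 1 1 (by norm_num) (by norm_num)).resolve_right h
      have h3 := (hb 2 1 (by norm_num) (by norm_num)).resolve_left h
      have h4 := (hb 2 2 (by norm_num) (by norm_num)).resolve_left h
      norm_num at h3 h4
      refine hp (E * MvPolynomial.C (b 2) * quartic (-s) ^ 2) ?_
      rw [hf, h0, h1, h3, h4, map_zero]
      ring
    by_cases h : b 1 = 0 ∧ b 4 = 0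
    · refine ⟨-s, b 0, b 3, Or.inr rfl, ?_⟩
      rw [hf, h.1, h.2, b2, map_zero, quarticFactor, if_neg (by norm_num), if_pos rfl, neg_neg]
      ring
    · have h03 : b 0 = 0 ∧ b 3 = 0 := by
        by_cases h1 : b 1 = 0
        · have h4 : b 4 ≠ 0 := fun h4 => h ⟨h1, h4⟩
          exact ⟨(hb 0 4 (by norm_num) (by norm_num)).resolve_right h4,
            (hb 3 1 (by norm_num) (by norm_num)).resolve_right h4⟩
        · exact ⟨(hb 0 1 (by norm_num) (by norm_num)).resolve_right h1,
            (hb 1 2 (by norm_num) (by norm_num)).resolve_left h1⟩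
      refine ⟨s, b 4, b 1, Or.inl rfl, ?_⟩
      rw [hf, h03.1, h03.2, b2, map_zero, quarticFactor, if_neg (by norm_num), if_pos rfl]
      ring
  · simp only [Finset.sum_range_succ, Finset.sum_range_zero] at hf
    by_cases h : b 1 = 0 ∧ b 4 = 0
    · exfalso
      by_cases h03 : b 0 = 0 ∧ b 3 = 0
      · refine hp (E * (MvPolynomial.C (b 2) * quartic (-s) ^ 3 +
          MvPolynomial.C (b 5) * quartic s ^ 3)) ?_
        rw [hf, h.1, h.2, h03.1, h03.2, map_zero]
        ring
      · have h25 : b 2 = 0 ∧ b 5 = 0 := by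
          by_cases h0 : b 0 = 0
          · have h3 : b 3 ≠ 0 := fun h3 => h03 ⟨h0, h3⟩
            exact ⟨(hb 2 1 (by norm_num) (by norm_num)).resolve_right h3,
              (hb 3 2 (by norm_num) (by norm_num)).resolve_left h3⟩
          · exact ⟨(hb 0 2 (by norm_num) (by norm_num)).resolve_left h0,
              (hb 0 5 (by norm_num) (by norm_num)).resolve_left h0⟩
        refine hm (E * (MvPolynomial.C (b 0) * quartic (-s) ^ 3 +
          MvPolynomial.C (b 3) * quartic s ^ 3)) ?_
        rw [hf, h.1, h.2, h25.1, h25.2, map_zero]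
        ring
    · have h' : b 0 = 0 ∧ b 2 = 0 ∧ b 3 = 0 ∧ b 5 = 0 := by
        by_cases h1 : b 1 = 0
        · have h4 : b 4 ≠ 0 := fun h4 => h ⟨h1, h4⟩
          exact ⟨(hb 0 4 (by norm_num) (by norm_num)).resolve_right h4,
            (hb 2 2 (by norm_num) (by norm_num)).resolve_right h4,
            (hb 3 1 (by norm_num) (by norm_num)).resolve_right h4,
            (hb 4 1 (by norm_num) (by norm_num)).resolve_left h4⟩
        · exact ⟨(hb 0 1 (by norm_num) (by norm_num)).resolve_right h1,
            (hb 1 1 (by norm_num) (by norm_num)).resolve_left h1,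
            (hb 1 2 (by norm_num) (by norm_num)).resolve_left h1,
            (hb 1 4 (by norm_num) (by norm_num)).resolve_left h1⟩
      refine ⟨s, b 4, b 1, Or.inl rfl, ?_⟩
      rw [hf, h'.1, h'.2.1, h'.2.2.1, h'.2.2.2, map_zero, quarticFactor, if_neg (by norm_num),
        if_neg (by norm_num)]
      ring

/-- The members of the pencil of semi-invariants of degree twelve are the `G_λ`. -/
lemma cubes_eq_polyG {s α β c : k} (hs : s ^ 2 = -3) (hc : (α + β) * c = -6 * s * (α - β)) :
    Polynomial.C α * dehom (quartic s) ^ 3 + Polynomial.C β * dehom (quartic (-s)) ^ 3 =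
      Polynomial.C (α + β) * polyG c := by
  have hs' : (Polynomial.C s : k[X]) ^ 2 = -3 := by
    rw [← map_pow, hs, map_neg, map_ofNat]
  have hc' := congrArg (Polynomial.C : k → k[X]) hc
  simp only [map_mul, map_add, map_sub, map_neg, map_ofNat] at hc'
  rw [dehom_quartic, dehom_quartic, polyG, map_neg, map_add]
  generalize (Polynomial.C s : k[X]) = S at *
  generalize (Polynomial.C α : k[X]) = A at *
  generalize (Polynomial.C β : k[X]) = B at *
  generalize (Polynomial.C c : k[X]) = D at *
  linear_combination (12 * (A + B) * (Polynomial.X ^ 4 + 1) * Polynomial.X ^ 4 +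
    8 * S * (A - B) * Polynomial.X ^ 6) * hs' +
    (Polynomial.X ^ 10 - 2 * Polynomial.X ^ 6 + Polynomial.X ^ 2) * hc'

lemma natDegree_normalForm_le (hg : g = 5 ∨ g = 7 ∨ g = 8 ∨ g = 9 ∨ g = 10 ∨ g = 12) (s c : k) :
    (normalForm g s c).natDegree ≤ 2 * g + 2 := by
  rcases hg with rfl | rfl | rfl | rfl | rfl | rfl <;>
    norm_num [normalForm, polyG] <;> compute_degree!

lemma dehom_eq_normalForm {E : MvPolynomial (Fin 2) k} {n : ℕ}
    (hgn : (E = 1 ∧ (g = 5 ∧ n = 3 ∨ g = 7 ∧ n = 4 ∨ g = 9 ∧ n = 5)) ∨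
      (E = sextic ∧ (g = 8 ∧ n = 3 ∨ g = 10 ∧ n = 4 ∨ g = 12 ∧ n = 5)))
    {s c : k} (hs : s ^ 2 = -3) :
    dehom (E * quarticFactor n s) * polyG c = normalForm g s c := by
  have hs' : (Polynomial.C s : k[X]) ^ 2 = -3 := by
    rw [← map_pow, hs, map_neg, map_ofNat]
  have h8 : (Polynomial.X ^ 4 + 2 * Polynomial.C s * Polynomial.X ^ 2 + 1) *
      (Polynomial.X ^ 4 + 2 * Polynomial.C (-s) * Polynomial.X ^ 2 + 1) =
      (Polynomial.X ^ 8 + 14 * Polynomial.X ^ 4 + 1 : k[X]) := by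
    rw [map_neg]
    linear_combination -4 * Polynomial.X ^ 4 * hs'
  rcases hgn with ⟨rfl, ⟨rfl, rfl⟩ | ⟨rfl, rfl⟩ | ⟨rfl, rfl⟩⟩ |
    ⟨rfl, ⟨rfl, rfl⟩ | ⟨rfl, rfl⟩ | ⟨rfl, rfl⟩⟩ <;>
  simp only [normalForm, quarticFactor, map_mul, map_one, dehom_sextic, h8, dehom_quartic,
    reduceIte, Nat.reduceEqDiff, one_mul, mul_one]

/-- A hyperelliptic curve with the given automorphisms is isomorphic to a normal form. -/
lemma exists_curveIso_normalForm [IsAlgClosed k] [CharZero k]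
    (hg : g = 5 ∨ g = 7 ∨ g = 8 ∨ g = 9 ∨ g = 10 ∨ g = 12) (hF : IsHyperelliptic g F)
    (hG : ContainsG g (CurveAut F)) :
    ∃ s c : k, s ^ 2 = -3 ∧ CurveIso F (normalForm g s c) := by
  have hg2 : 2 ≤ g := by omega
  obtain ⟨a, b, t, h1, h2, h3, h4, h5, h6, h7, h8⟩ := exists_tetrahedral_generators hg2 hF hG
  obtain ⟨P, i, α, β, γ, hP, hi, e1, e2, e3⟩ := exists_semiinvariant_form hg2 hF h1 h2 h3 h4 h5 h6
    h7 h8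
  obtain ⟨s, hs⟩ := IsAlgClosed.exists_pow_nat_eq (-3 : k) two_pos
  obtain ⟨E, n, hgn⟩ : ∃ (E : MvPolynomial (Fin 2) k) (n : ℕ),
      (E = 1 ∧ (g = 5 ∧ n = 3 ∨ g = 7 ∧ n = 4 ∨ g = 9 ∧ n = 5)) ∨
      (E = sextic ∧ (g = 8 ∧ n = 3 ∨ g = 10 ∧ n = 4 ∨ g = 12 ∧ n = 5)) := by
    rcases hg with rfl | rfl | rfl | rfl | rfl | rfl
    · exact ⟨1, 3, by simp⟩
    · exact ⟨1, 4, by simp⟩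
    · exact ⟨sextic, 3, by simp⟩
    · exact ⟨1, 5, by simp⟩
    · exact ⟨sextic, 4, by simp⟩
    · exact ⟨sextic, 5, by simp⟩
  have hsq := fun (e : ℕ) (U W : MvPolynomial (Fin 2) k) (he : 1 ≤ e) (hU : U.IsHomogeneous e)
    (h : subst P (form g F) = U ^ 2 * W) => not_eq_sq_mul hF hP he hU h
  have hf0 : subst P (form g F) ≠ 0 := fun h =>
    hsq 1 (MvPolynomial.X 0) 0 le_rfl (MvPolynomial.isHomogeneous_X k 0) (by rw [h, mul_zero])
  have hhom : (subst P (form g F)).IsHomogeneous (2 * g + 2) :=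
    isHomogeneous_subst (isHomogeneous_binaryForm (2 * g + 2) F) P
  obtain ⟨b, hb, hbz⟩ := exists_sum_of_tetrahedral hgn hf0 hhom hi hs e1 e2 e3
  obtain ⟨s', α', β', hs', hf⟩ := exists_cubes (by omega) hb hbz hsq
  have hs2 : s' ^ 2 = -3 := by
    rcases hs' with rfl | rfl
    · exact hs
    · rw [neg_sq, hs]
  -- `α' + β' = 0` would make the form divisible by `X²`
  have hαβ : α' + β' ≠ 0 := by
    intro h
    have hβ : β' = -α' := by linear_combination h
    refine hsq 1 (MvPolynomial.X 0) (E * quarticFactor n s' * (MvPolynomial.C α' *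
      (2 * MvPolynomial.C (2 * s') * MvPolynomial.X 1 ^ 2 * (quartic s' ^ 2 +
        quartic s' * quartic (-s') + quartic (-s') ^ 2)))) le_rfl
      (MvPolynomial.isHomogeneous_X k 0) ?_
    have hd : quartic s' - quartic (-s') = MvPolynomial.X 0 ^ 2 *
        (2 * MvPolynomial.C (2 * s') * MvPolynomial.X 1 ^ 2) := by
      simp only [quartic, mul_neg, map_neg]
      ring
    rw [hf, hβ, map_neg]
    linear_combination E * quarticFactor n s' * MvPolynomial.C α' * (quartic s' ^ 2 +
        quartic s' * quartic (-s') + quartic (-s') ^ 2) * hd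
  set c := -6 * s' * (α' - β') / (α' + β') with hc
  have hc' : (α' + β') * c = -6 * s' * (α' - β') := mul_div_cancel₀ _ hαβ
  refine ⟨s', c, hs2, curveIso_of_form_eq (natDegree_normalForm_le hg s' c)
    (by have := hF.2; omega) hP hαβ ?_⟩
  rw [← binaryForm_dehom hhom, form.eq_1 g (normalForm g s' c), ← binaryForm_C_mul]
  congr 1
  rw [hf, map_mul, map_add, map_mul dehom (MvPolynomial.C _), map_mul dehom (MvPolynomial.C _),
    map_pow, map_pow, dehom_C, dehom_C, cubes_eq_polyG hs2 hc', ← dehom_eq_normalForm hgn hs2]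
  ring

end NormalFormIso

section Parametrization

/-! ### Injectivity of the parametrization in genus 5 and 9 -/

/-- The values of `t²` and of a cubic `(a t + b) (2 b - a t)²`, whose linear term vanishes but whose
cubic term does not, determine `t`. -/
lemma eq_of_sq_eq_of_cubic_eq [CharZero k] {a b t u : k} (ha : a ≠ 0) (h : t ^ 2 = u ^ 2)
    (h' : (a * t + b) * (2 * b - a * t) ^ 2 = (a * u + b) * (2 * b - a * u) ^ 2) : t = u := by
  rcases sq_eq_sq_iff_eq_or_eq_neg.1 h with h1 | rfl
  · exact h1
  · have h2 : 2 * (a * u) ^ 3 = 0 := by linear_combination -h'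
    have h3 : u = 0 := by simpa [ha] using h2
    rw [h3, neg_zero]

lemma paramPoint_five_injective [CharZero k] {μ ν : k} (h : paramPoint 5 ν = paramPoint 5 μ) :
    ν = μ := by
  simp only [paramPoint, reduceIte] at h
  split_ifs at h with h1 h2 h2
  · simp only [Sum.inl.injEq, Prod.mk.injEq] at h
    obtain ⟨e1, e2⟩ := h
    have key : ∀ x : k, 5 * x + 924 ≠ 0 →
        10 / 27951 * (x * (5 * x + 30492) ^ 2) / (5 * x + 924) ^ 3 =
        10 / 27951 / 160 * ((21 * ((5 * x - 484) / (5 * x + 924)) + 11) *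
          (2 * 11 - 21 * ((5 * x - 484) / (5 * x + 924))) ^ 2) := by
      intro x hx
      have k1 : 21 * ((5 * x - 484) / (5 * x + 924)) + 11 = 160 * x / (5 * x + 924) := by
        rw [eq_div_iff hx, add_mul, mul_assoc, div_mul_cancel₀ _ hx]
        ring
      have k2 : 2 * 11 - 21 * ((5 * x - 484) / (5 * x + 924)) =
          (5 * x + 30492) / (5 * x + 924) := by
        rw [eq_div_iff hx, sub_mul, mul_assoc 21, div_mul_cancel₀ _ hx]
        ring
      rw [k1, k2]
      generalize 5 * x + 924 = D
      ring
    rw [key ν h1, key μ h2] at e2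
    rw [mul_div_assoc, mul_div_assoc, ← div_pow, ← div_pow] at e1
    have e3 := eq_of_sq_eq_of_cubic_eq (by norm_num) (mul_left_cancel₀ (by norm_num) e1)
      (mul_left_cancel₀ (by norm_num) e2)
    rw [div_eq_div_iff h1 h2] at e3
    have e4 : 7040 * (ν - μ) = 0 := by linear_combination e3
    exact sub_eq_zero.1 ((mul_eq_zero.1 e4).resolve_left (by norm_num))
  · simp only [ne_eq, not_not] at h1 h2
    have e4 : 5 * (ν - μ) = 0 := by linear_combination h1 - h2
    exact sub_eq_zero.1 ((mul_eq_zero.1 e4).resolve_left (by norm_num))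

lemma paramPoint_nine_injective [CharZero k] {μ ν : k} (h : paramPoint 9 ν = paramPoint 9 μ) :
    ν = μ := by
  simp only [paramPoint, reduceIte, Nat.reduceEqDiff] at h
  split_ifs at h with h1 h2 h2
  · simp only [Sum.inl.injEq, Prod.mk.injEq] at h
    obtain ⟨e1, e2⟩ := h
    have key : ∀ x : k, 3 * x + 836 ≠ 0 →
        90 / 370680937 * (x * (157 * x + 79420) ^ 2) / (3 * x + 836) ^ 3 =
        90 / 370680937 / 384 / 9 * ((11 * ((9 * x - 7220) / (3 * x + 836)) + 95) *
          (2 * 95 - 11 * ((9 * x - 7220) / (3 * x + 836))) ^ 2) := by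
      intro x hx
      have k1 : 11 * ((9 * x - 7220) / (3 * x + 836)) + 95 = 384 * x / (3 * x + 836) := by
        rw [eq_div_iff hx, add_mul, mul_assoc, div_mul_cancel₀ _ hx]
        ring
      have k2 : 2 * 95 - 11 * ((9 * x - 7220) / (3 * x + 836)) =
          3 * (157 * x + 79420) / (3 * x + 836) := by
        rw [eq_div_iff hx, sub_mul, mul_assoc 11, div_mul_cancel₀ _ hx]
        ring
      rw [k1, k2]
      generalize 3 * x + 836 = D
      ring
    rw [key ν h1, key μ h2] at e2
    rw [mul_div_assoc, mul_div_assoc, ← div_pow, ← div_pow] at e1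
    have e3 := eq_of_sq_eq_of_cubic_eq (by norm_num) (mul_left_cancel₀ (by norm_num) e1)
      (mul_left_cancel₀ (by norm_num) e2)
    rw [div_eq_div_iff h1 h2] at e3
    have e4 : 29184 * (ν - μ) = 0 := by linear_combination e3
    exact sub_eq_zero.1 ((mul_eq_zero.1 e4).resolve_left (by norm_num))
  · simp only [ne_eq, not_not] at h1 h2
    have e4 : 3 * (ν - μ) = 0 := by linear_combination h1 - h2
    exact sub_eq_zero.1 ((mul_eq_zero.1 e4).resolve_left (by norm_num))

end Parametrization

section Models

/-! ### The explicit models -/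

variable {F : k[X]} {g : ℕ}

lemma natDegree_model_le (hg : g = 5 ∨ g = 7 ∨ g = 8 ∨ g = 9 ∨ g = 10 ∨ g = 12) (μ : k) :
    (model g μ).natDegree ≤ 2 * g + 2 := by
  rcases hg with rfl | rfl | rfl | rfl | rfl | rfl <;>
    norm_num [model, polyM, polyN] <;> compute_degree!

lemma polyG_comp_of_sq {t c : k} (ht : t ^ 2 = c) :
    (polyG c).comp (Polynomial.C t * Polynomial.X) = polyM (c ^ 2) := by
  subst ht
  simp only [polyG, polyM, Polynomial.sub_comp, Polynomial.add_comp, Polynomial.mul_comp,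
    Polynomial.pow_comp, Polynomial.X_comp, Polynomial.C_comp, Polynomial.ofNat_comp,
    Polynomial.one_comp, map_pow]
  ring

lemma polyG_comp_of_pow_four {t μ : k} (ht : (t ^ 2) ^ 2 = -3) :
    (polyG (μ * t ^ 2)).comp (Polynomial.C t * Polynomial.X) = -polyN μ := by
  have ht' : ((Polynomial.C t : k[X]) ^ 2) ^ 2 = -3 := by
    rw [← map_pow, ← map_pow, ht, map_neg, map_ofNat]
  simp only [polyG, polyN, Polynomial.sub_comp, Polynomial.add_comp, Polynomial.mul_comp,
    Polynomial.pow_comp, Polynomial.X_comp, Polynomial.C_comp, Polynomial.ofNat_comp,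
    Polynomial.one_comp, map_mul, map_pow]
  generalize (Polynomial.C t : k[X]) = T at *
  generalize (Polynomial.C μ : k[X]) = D at *
  linear_combination ((T ^ 8 - 3 * T ^ 4 + 9) * Polynomial.X ^ 12
    - D * (T ^ 8 - 3 * T ^ 4 + 9) * Polynomial.X ^ 10 - 33 * (T ^ 4 - 3) * Polynomial.X ^ 8
    + 2 * D * (T ^ 4 - 3) * Polynomial.X ^ 6 - 33 * Polynomial.X ^ 4 - D * Polynomial.X ^ 2) * ht'

/-- In genus 7 and 10 a scaling of `X` transforms the normal form into the model. -/
lemma exists_normalForm_comp_of_seven_or_ten [IsAlgClosed k] [CharZero k] (hg : g = 7 ∨ g = 10)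
    {s : k} (hs : s ^ 2 = -3) (μ : k) : ∃ a e : k, a ≠ 0 ∧ e ≠ 0 ∧
      (normalForm g s (μ * s)).comp (Polynomial.C a * Polynomial.X) =
        Polynomial.C e * model g μ := by
  obtain ⟨t, rfl⟩ := IsAlgClosed.exists_pow_nat_eq s two_pos
  have ht0 : t ≠ 0 := by rintro rfl; norm_num at hs
  have ht' : ((Polynomial.C t : k[X]) ^ 2) ^ 2 = -3 := by
    rw [← map_pow, ← map_pow, hs, map_neg, map_ofNat]
  rcases hg with rfl | rfl
  · refine ⟨t, 1, ht0, one_ne_zero, ?_⟩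
    simp only [normalForm, model, Nat.reduceEqDiff, reduceIte, Polynomial.mul_comp,
      polyG_comp_of_pow_four hs]
    simp only [Polynomial.add_comp, Polynomial.mul_comp, Polynomial.pow_comp, Polynomial.X_comp,
      Polynomial.C_comp, Polynomial.ofNat_comp, Polynomial.one_comp, map_pow, map_one]
    linear_combination -(Polynomial.X ^ 4 + 2 * Polynomial.X ^ 2) * polyN μ * ht'
  · refine ⟨t, -t, ht0, neg_ne_zero.2 ht0, ?_⟩
    simp only [normalForm, model, Nat.reduceEqDiff, reduceIte, Polynomial.mul_comp,
      polyG_comp_of_pow_four hs]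
    simp only [Polynomial.add_comp, Polynomial.sub_comp, Polynomial.mul_comp, Polynomial.pow_comp,
      Polynomial.X_comp, Polynomial.C_comp, Polynomial.ofNat_comp, Polynomial.one_comp, map_pow,
      map_neg]
    generalize (Polynomial.C t : k[X]) = T at *
    linear_combination (-T * Polynomial.X * polyN μ * (Polynomial.X ^ 4 *
      (T ^ 4 * Polynomial.X ^ 4 + 2 * T ^ 4 * Polynomial.X ^ 2 + 1) +
      (-3 * Polynomial.X ^ 4 - 1) * (Polynomial.X ^ 4 + 2 * Polynomial.X ^ 2))) * ht'

/-- In the other cases a scaling of `X` transforms the normal form into the model if `μ ≠ 0`. -/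
lemma exists_normalForm_comp [IsAlgClosed k] (hg : g = 5 ∨ g = 8 ∨ g = 9 ∨ g = 12) (s : k) {c : k}
    (hc : c ≠ 0) : ∃ a e : k, a ≠ 0 ∧ e ≠ 0 ∧
      (normalForm g s c).comp (Polynomial.C a * Polynomial.X) =
        Polynomial.C e * model g (c ^ 2) := by
  obtain ⟨t, ht⟩ := IsAlgClosed.exists_pow_nat_eq c two_pos
  have ht0 : t ≠ 0 := by rintro rfl; simp [← ht] at hc
  have hG := polyG_comp_of_sq ht
  rcases hg with rfl | rfl | rfl | rfl
  · refine ⟨t, 1, ht0, one_ne_zero, ?_⟩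
    simp only [normalForm, model, reduceIte, hG, map_one, one_mul]
  · refine ⟨t, t, ht0, ht0, ?_⟩
    simp only [normalForm, model, Nat.reduceEqDiff, reduceIte, Polynomial.mul_comp, hG]
    simp only [← ht, Polynomial.sub_comp, Polynomial.pow_comp, Polynomial.X_comp,
      Polynomial.one_comp, map_pow]
    ring
  · refine ⟨t, 1, ht0, one_ne_zero, ?_⟩
    simp only [normalForm, model, Nat.reduceEqDiff, reduceIte, Polynomial.mul_comp, hG]
    simp only [← ht, Polynomial.add_comp, Polynomial.mul_comp, Polynomial.pow_comp,
      Polynomial.X_comp, Polynomial.one_comp, Polynomial.ofNat_comp, map_pow, map_one]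
    ring
  · refine ⟨t, t, ht0, ht0, ?_⟩
    simp only [normalForm, model, Nat.reduceEqDiff, reduceIte, Polynomial.mul_comp, hG]
    simp only [← ht, Polynomial.add_comp, Polynomial.sub_comp, Polynomial.mul_comp,
      Polynomial.pow_comp, Polynomial.X_comp, Polynomial.one_comp, Polynomial.ofNat_comp, map_pow]
    ring

lemma invariantPoint_normalForm [IsAlgClosed k] [CharZero k]
    (hg : g = 5 ∨ g = 7 ∨ g = 8 ∨ g = 9 ∨ g = 10 ∨ g = 12) {s c μ : k} (hs : s ^ 2 = -3)
    (hμ : if g = 7 ∨ g = 10 then c = μ * s else μ = c ^ 2) :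
    invariantPoint g (normalForm g s c) = paramPoint g μ := by
  by_cases h : g = 7 ∨ g = 10
  · rw [if_pos h] at hμ
    subst hμ
    obtain ⟨a, e, ha, he, hcomp⟩ := exists_normalForm_comp_of_seven_or_ten h hs μ
    have hs := subst_form_of_comp (natDegree_normalForm_le hg s _) (natDegree_model_le hg μ) hcomp
    rw [← invariantPoint_eq_of_form_eq (F := model g μ) (e := e⁻¹) (M := !![a, 0; 0, 1]) (by
      rw [hs, ← mul_assoc, ← map_mul, inv_mul_cancel₀ he, map_one, one_mul]) (inv_ne_zero he)
      (by simpa using ha) hg]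
    rcases h with rfl | rfl
    · apply invariantPoint_seven
      rw [model]
      simp only [Nat.reduceEqDiff, reduceIte]
      exact form_seven μ
    · apply invariantPoint_ten
      rw [model]
      simp only [Nat.reduceEqDiff, reduceIte]
      exact form_ten μ
  · rw [if_neg h] at hμ
    subst hμ
    rcases hg with rfl | rfl | rfl | rfl | rfl | rfl
    · apply invariantPoint_five
      rw [normalForm]
      simp only [reduceIte]
      exact form_five c
    · simp at h
    · apply invariantPoint_eight
      rw [normalForm]
      simp only [Nat.reduceEqDiff, reduceIte]
      exact form_eight c
    · apply invariantPoint_nine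
      rw [normalForm]
      simp only [Nat.reduceEqDiff, reduceIte]
      exact form_nine c
    · simp at h
    · apply invariantPoint_twelve
      rw [normalForm]
      simp only [Nat.reduceEqDiff, reduceIte]
      exact form_twelve c

lemma invariantPoint_of_isParameter [IsAlgClosed k] [CharZero k]
    (hg : g = 5 ∨ g = 7 ∨ g = 8 ∨ g = 9 ∨ g = 10 ∨ g = 12) (hF : IsHyperelliptic g F) {μ : k}
    (h : IsParameter g F μ) : invariantPoint g F = paramPoint g μ := by
  obtain ⟨s, c, hs, hμ, hiso⟩ := h
  rw [invariantPoint_eq_of_curveIso hg hF (natDegree_normalForm_le hg s c) hiso,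
    invariantPoint_normalForm hg hs hμ]

lemma exists_isParameter [IsAlgClosed k] [CharZero k]
    (hg : g = 5 ∨ g = 7 ∨ g = 8 ∨ g = 9 ∨ g = 10 ∨ g = 12) (hF : IsHyperelliptic g F)
    (hG : ContainsG g (CurveAut F)) : ∃ μ : k, IsParameter g F μ := by
  obtain ⟨s, c, hs, hiso⟩ := exists_curveIso_normalForm hg hF hG
  have hs0 : s ≠ 0 := by rintro rfl; norm_num at hs
  by_cases h : g = 7 ∨ g = 10
  · exact ⟨c / s, s, c, hs, by rw [if_pos h, div_mul_cancel₀ _ hs0], hiso⟩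
  · exact ⟨c ^ 2, s, c, hs, by rw [if_neg h], hiso⟩

end Models

section ExtraAutomorphism

/-! ### The curves with `μ = 0` have more automorphisms -/

variable {F H : k[X]} {g : ℕ}

lemma exists_scaling_automorphism (hH : H.natDegree ≤ 2 * g + 2) {i t : k} (hi : i ≠ 0)
    (ht : t ≠ 0) (h : H.comp (Polynomial.C i * Polynomial.X) = Polynomial.C (t ^ 2) * H) :
    ∃ ψ : CurveAut H, ψ (xGen H) = algebraMap k _ i * xGen H ∧
      ψ (yGen H) = algebraMap k _ t * yGen H := by
  obtain ⟨ψ, hx, hy⟩ := exists_algEquiv_of_form_eq hH hH (M := !![i, 0; 0, 1]) (by simpa using hi)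
    ht (subst_form_of_comp hH hH h)
  refine ⟨ψ, ?_, ?_⟩
  · simpa [ActsBy, linPoly] using hx
  · simpa [linPoly] using hy

lemma pow_apply_of_eigenvector {ψ : CurveAut H} {z : FunctionField H} {a : k}
    (h : ψ z = algebraMap k _ a * z) (n : ℕ) : (ψ ^ n) z = algebraMap k _ (a ^ n) * z := by
  induction n with
  | zero => simp
  | succ n ih =>
    rw [pow_succ ψ n, AlgEquiv.mul_apply, h, map_mul, AlgEquiv.commutes, ih, ← mul_assoc,
      ← map_mul, pow_succ' a n]

lemma not_isomorphicToG_of_zero [IsAlgClosed k] [CharZero k]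
    (hg : g = 5 ∨ g = 8 ∨ g = 9 ∨ g = 12) (s : k) :
    ¬ IsomorphicToG g (CurveAut (normalForm g s 0)) := by
  obtain ⟨i, hi⟩ := IsAlgClosed.exists_pow_nat_eq (-1 : k) two_pos
  have hi0 : i ≠ 0 := by rintro rfl; norm_num at hi
  have hd := natDegree_normalForm_le (g := g) (by omega) s 0
  have hi' : (Polynomial.C i : k[X]) ^ 2 = -1 := by rw [← map_pow, hi, map_neg, map_one]
  have hI : ∀ n, (Polynomial.C i : k[X]) ^ (2 * n) = (-1) ^ n := fun n => by rw [pow_mul, hi']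
  have hG : (polyG (0 : k)).comp (Polynomial.C i * Polynomial.X) = polyG 0 := by
    simp only [polyG, Polynomial.sub_comp, Polynomial.add_comp, Polynomial.mul_comp,
      Polynomial.pow_comp, Polynomial.X_comp, Polynomial.ofNat_comp,
      Polynomial.one_comp, map_zero, Polynomial.zero_comp, mul_pow, hI 6, hI 4, hI 2]
    ring
  have h2 : ∀ z : FunctionField (normalForm g s 0), z = -z → z = 0 := by
    intro z hz
    have h3 : algebraMap k (FunctionField (normalForm g s 0)) 2⁻¹ *
        algebraMap k (FunctionField (normalForm g s 0)) 2 = 1 := by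
      rw [← map_mul, inv_mul_cancel₀ two_ne_zero, map_one]
    rw [map_ofNat] at h3
    linear_combination algebraMap k (FunctionField (normalForm g s 0)) 2⁻¹ * hz - z * h3
  rw [IsomorphicToG]
  split_ifs with hodd
  · rintro ⟨e⟩
    have hcomp : (normalForm g s 0).comp (Polynomial.C i * Polynomial.X) =
        Polynomial.C (1 ^ 2) * normalForm g s 0 := by
      rw [one_pow, map_one, one_mul]
      rcases hg with rfl | rfl | rfl | rfl
      · simp only [normalForm, reduceIte, hG]
      · exact absurd hodd (by decide)
      · simp only [normalForm, Nat.reduceEqDiff, reduceIte, Polynomial.mul_comp, hG]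
        simp only [Polynomial.add_comp, Polynomial.mul_comp, Polynomial.pow_comp,
          Polynomial.X_comp, Polynomial.one_comp, Polynomial.ofNat_comp, mul_pow, hI 4, hI 2]
        ring
      · exact absurd hodd (by decide)
    obtain ⟨ψ, hx, -⟩ := exists_scaling_automorphism hd hi0 one_ne_zero hcomp
    have h6 : ψ ^ 6 = 1 := e.injective (by rw [map_pow, z2a4_pow_six, map_one])
    have h := pow_apply_of_eigenvector hx 6
    rw [h6, AlgEquiv.one_apply, show i ^ 6 = -1 by
      rw [show i ^ 6 = (i ^ 2) ^ 3 by ring, hi]; norm_num, map_neg, map_one, neg_one_mul] at h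
    refine aeval_xGen_ne_zero (normalForm g s 0) Polynomial.X_ne_zero ?_
    rw [Polynomial.aeval_X]
    exact h2 _ h
  · rintro ⟨e⟩
    obtain ⟨t, ht⟩ := IsAlgClosed.exists_pow_nat_eq i two_pos
    have ht0 : t ≠ 0 := by rintro rfl; simp [← ht] at hi0
    have hcomp : (normalForm g s 0).comp (Polynomial.C i * Polynomial.X) =
        Polynomial.C (t ^ 2) * normalForm g s 0 := by
      rw [ht]
      rcases hg with rfl | rfl | rfl | rfl
      · exact absurd (by decide) hodd
      · simp only [normalForm, Nat.reduceEqDiff, reduceIte, Polynomial.mul_comp, hG]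
        simp only [Polynomial.sub_comp, Polynomial.pow_comp,
          Polynomial.X_comp, Polynomial.one_comp, mul_pow, hI 2]
        ring
      · exact absurd (by decide) hodd
      · simp only [normalForm, Nat.reduceEqDiff, reduceIte, Polynomial.mul_comp, hG]
        simp only [Polynomial.add_comp, Polynomial.sub_comp, Polynomial.mul_comp,
          Polynomial.pow_comp, Polynomial.X_comp, Polynomial.one_comp, Polynomial.ofNat_comp,
          mul_pow, hI 4, hI 2]
        ring
    obtain ⟨ψ, -, hy⟩ := exists_scaling_automorphism hd hi0 ht0 hcomp
    have h12 : ψ ^ 12 = 1 := e.injective (by rw [map_pow, sl23_pow_twelve, map_one])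
    have h := pow_apply_of_eigenvector hy 12
    rw [h12, AlgEquiv.one_apply, show t ^ 12 = -1 by
      rw [show t ^ 12 = ((t ^ 2) ^ 2) ^ 3 by ring, ht, hi]; norm_num, map_neg, map_one,
      neg_one_mul] at h
    refine one_ne_zero (α := RatFunc k) (eq_zero_of_ratHom_add_eq_zero (normalForm g s 0)
      (p := 0) (q := 1) ?_).2
    rw [map_zero, map_one, zero_add, one_mul]
    exact h2 _ h

lemma IsomorphicToG.of_curveIso (h : IsomorphicToG g (CurveAut F)) (hiso : CurveIso F H) :
    IsomorphicToG g (CurveAut H) := by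
  obtain ⟨φ⟩ := hiso
  rw [IsomorphicToG] at h ⊢
  split_ifs at h ⊢
  · exact h.map fun e => (AlgEquiv.autCongr φ).symm.trans e
  · exact h.map fun e => (AlgEquiv.autCongr φ).symm.trans e

/-- A curve is isomorphic to the model of its parameter. -/
lemma curveIso_model_of_isParameter [IsAlgClosed k] [CharZero k]
    (hg : g = 5 ∨ g = 7 ∨ g = 8 ∨ g = 9 ∨ g = 10 ∨ g = 12) {μ : k} (h : IsParameter g F μ)
    (h0 : μ ≠ 0 ∨ g = 7 ∨ g = 10 ∨ IsomorphicToG g (CurveAut F)) : CurveIso F (model g μ) := by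
  obtain ⟨s, c, hs, hμ, hiso⟩ := h
  have key : (∃ a e : k, a ≠ 0 ∧ e ≠ 0 ∧ (normalForm g s c).comp
      (Polynomial.C a * Polynomial.X) = Polynomial.C e * model g μ) → CurveIso F (model g μ) := by
    rintro ⟨a, e, ha, he, hcomp⟩
    exact hiso.trans (curveIso_of_comp (natDegree_model_le hg μ) (natDegree_normalForm_le hg s c)
      ha he hcomp)
  apply key
  by_cases h7 : g = 7 ∨ g = 10
  · rw [if_pos h7] at hμ
    subst hμ
    exact exists_normalForm_comp_of_seven_or_ten h7 hs μ
  · rw [if_neg h7] at hμ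
    subst hμ
    have hg' : g = 5 ∨ g = 8 ∨ g = 9 ∨ g = 12 := by omega
    refine exists_normalForm_comp hg' s ?_
    rintro rfl
    rcases h0 with h0 | h0 | h0 | h0
    · simp at h0
    · exact h7 (Or.inl h0)
    · exact h7 (Or.inr h0)
    · exact not_isomorphicToG_of_zero hg' s (h0.of_curveIso hiso)

end ExtraAutomorphism

end HyperA4

end

theorem proposition5p1 {k : Type*} [Field k] [IsAlgClosed k] [CharZero k]
    (g : ℕ) (hg : g = 5 ∨ g = 7 ∨ g = 8 ∨ g = 9 ∨ g = 10 ∨ g = 12)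
    (F : Polynomial k) (hF : HyperA4.IsHyperelliptic g F)
    (hG : HyperA4.ContainsG g (HyperA4.CurveAut F)) :
    -- the curve has a parameter, and the parametrization gives its invariants
    (∃ μ : k, HyperA4.IsParameter g F μ) ∧
    (∀ μ : k, HyperA4.IsParameter g F μ →
      HyperA4.invariantPoint g F = HyperA4.paramPoint g μ) ∧
    -- the curve is isomorphic to the model, for its parameter `μ`, and for every `μ` that is
    -- determined by the invariants of the curve
    (∀ μ : k,
      (HyperA4.IsParameter g F μ ∨
        (HyperA4.invariantPoint g F = HyperA4.paramPoint g μ ∧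
          (g = 5 ∨ g = 9 ∨
            ∀ ν : k, HyperA4.paramPoint g ν = HyperA4.paramPoint g μ → ν = μ))) →
      (μ ≠ 0 ∨ g = 7 ∨ g = 10 ∨ HyperA4.IsomorphicToG g (HyperA4.CurveAut F)) →
      HyperA4.CurveIso F (HyperA4.model g μ)) := by
  have hpar := HyperA4.exists_isParameter hg hF hG
  have hinv : ∀ μ : k, HyperA4.IsParameter g F μ →
      HyperA4.invariantPoint g F = HyperA4.paramPoint g μ := fun μ h =>
    HyperA4.invariantPoint_of_isParameter hg hF h
  refine ⟨hpar, hinv, fun μ h h0 => ?_⟩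
  have hμ : HyperA4.IsParameter g F μ := by
    rcases h with h | ⟨h, h'⟩
    · exact h
    · obtain ⟨ν, hν⟩ := hpar
      have e : HyperA4.paramPoint g ν = HyperA4.paramPoint g μ := (hinv ν hν).symm.trans h
      have hνμ : ν = μ := by
        rcases h' with rfl | rfl | h'
        · exact HyperA4.paramPoint_five_injective e
        · exact HyperA4.paramPoint_nine_injective e
        · exact h' ν e
      exact hνμ ▸ hν
  exact HyperA4.curveIso_model_of_isParameter hg hμ h0
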